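/- Let $d\in\mathbb{N}$, $0<T<\infty$, and let $h\downarrow0$ denote a sequence of positive numbers tending to $0$. Functions of space are functions on the unit torus $[0,1)^d$ (i.e. $\mathbb{Z}^d$-periodic), all functions are Lebesgue measurable, and $*$ denotes convolution on $\mathbb{R}^d$. For $z\in\mathbb{R}^d$ let $G_h(z)=(2\pi h)^{-d/2}\exp(-\frac{|z|^2}{2h})$, let $c_0=\frac{1}{\sqrt{2\pi}}$, and for $[0,1]$-valued functions $u,u'$ of space set $$E_h(u)=\frac{1}{\sqrt h}\int_{[0,1)^d}(1-u)\,G_h*u\,dx,\qquad d_h(u,u')=\Big(2\sqrt h\int_{[0,1)^d}|G_{h/2}*(u-u')|^2dx\Big)^{1/2}.$$ For a function $\chi$ on $(0,T)\times[0,1)^d$, $\nabla\chi$ denotes its distributional gradient in $x$ on $(0,T)\times[0,1)^d$, and $\int|\nabla\chi|\,dt\in[0,\infty]$ the total variation of $\nabla\chi$ there. If $\nabla\chi$ is a bounded measure, $|\nabla\chi|\,dt$ denotes its total variation measure and $\nu$ the measure-theoretic normal, i.e. $\nabla\chi=\nu|\nabla\chi|dt$ with $|\nu|=1$ $|\nabla\chi|dt$-a.e.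 It is called equi-integrable in $t$ if for every $\varepsilon>0$ there is $\delta>0$ such that $\int_{(A\cap(0,T))\times[0,1)^d}|\nabla\chi|dt<\varepsilon$ for all Borel sets $A\subset\mathbb{R}$ of Lebesgue measure less than $\delta$. i) Let $\{\chi_h\}_{h\downarrow0}$ be a sequence of $\{0,1\}$-valued functions on $(0,T)\times[0,1)^d$ that are piecewise constant in time with step size $h$: there are functions $\chi_h^n$ of space, $n=0,1,2,\dots$, with $\chi_h(t)=\chi_h^n$ for $t\in[nh,(n+1)h)$, $t<T$, and $\chi_h(t)=\chi_h^0$ for $t\le0$. Suppose that $$\operatorname*{ess\,sup}_{t\in(0,T)}E_h(\chi_h(t))+\int_0^T\frac{1}{2h^2}d_h^2(\chi_h(t),\chi_h(t-h))\,dt\quad\text{stays bounded as }h\downarrow0.$$ Then the sequence is compact in $L^1((0,T)\times[0,1)^d)$, that is, every subsequence has a further subsequence that converges in $L^1$. Moreover, if $\chi$ is the weak $L^1$-limit of $\{\chi_h\}$, or of a subsequence, then $\nabla\chi$ is a bounded measure, equi-integrable in $t$, and $$c_0\int|\nabla\chi|\,dt\le\liminf_{h\downarrow0}\int_0^TE_h(\chi_h(t))\,dt,$$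 where the $\liminf$ is taken along the sequence or subsequence that converges to $\chi$. ii) Let $\{u_h\}_{h\downarrow0}$ be a sequence of $[0,1]$-valued functions and $\chi$ a $\{0,1\}$-valued function on $(0,T)\times[0,1)^d$ such that $u_h\rightharpoonup\chi$ weakly in $L^1((0,T)\times[0,1)^d)$, such that $$\limsup_{h\downarrow0}\int_0^TE_h(u_h(t))\,dt\le c_0\int|\nabla\chi|\,dt,$$ and such that $\operatorname{ess\,sup}_{t\in(0,T)}E_h(u_h(t))$ stays bounded as $h\downarrow0$. Then $\nabla\chi$ is a bounded measure, equi-integrable in $t$, and, as measures in $(z,t,x)\in\mathbb{R}^d\times(0,T)\times[0,1)^d$, we have the weak convergences $$G_1(z)\tfrac{1}{\sqrt h}\,u_h(t,x)\,(1-u_h)(t,x-\sqrt h z)\,dx\,dt\,dz\rightharpoonup G_1(z)(\nu\cdot z)_+|\nabla\chi|\,dt\,dz,$$ $$G_1(z)\tfrac{1}{\sqrt h}\,(1-u_h)(t,x)\,u_h(t,x-\sqrt h z)\,dx\,dt\,dz\rightharpoonup G_1(z)(\nu\cdot z)_-|\nabla\chi|\,dt\,dz,$$ where $a_\pm=\max\{\pm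 a,0\}$. Here the convergence holds for all test functions $\zeta(z,t,x)$ that are continuous on $\mathbb{R}^d\times(0,T)\times[0,1)^d$ (periodic in $x$) and have at most polynomial growth in $z$: $|\zeta(z,t,x)|\le C(1+|z|)^m$ for some $C,m$. -/

import Mathlib

open MeasureTheory Filter Topology
open scoped ENNReal ContDiff

noncomputable section

namespace Thresholding

/-- Euclidean space `ℝ^d`. -/
abbrev Euc (d : ℕ) : Type := EuclideanSpace ℝ (Fin d)

/-- The unit torus `(ℝ/ℤ)^d`, i.e. `[0,1)^d` with periodic identification; its `volume` is the
Lebesgue measure, of total mass one. -/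
abbrev Torus (d : ℕ) : Type := UnitAddTorus (Fin d)

/-- The projection `ℝ^d → (ℝ/ℤ)^d`. -/
def proj {d : ℕ} (z : Euc d) : Torus d := fun i => ((z i : ℝ) : UnitAddCircle)

/-- The Gaussian `G_h(z) = (2πh)^{-d/2} exp(-|z|²/(2h))`. -/
def gauss {d : ℕ} (h : ℝ) (z : Euc d) : ℝ :=
  1 / Real.sqrt (2 * Real.pi * h) ^ d * Real.exp (-‖z‖ ^ 2 / (2 * h))

/-- The convolution `G_h * u` over `ℝ^d`, for a function `u` on the torus. -/
def gaussConv {d : ℕ} (h : ℝ) (u : Torus d → ℝ) (x : Torus d) : ℝ :=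
  ∫ z : Euc d, gauss h z * u (x - proj z)

/-- The energy `E_h(u) = h^{-1/2} ∫ (1 - u) G_h * u dx`. -/
def energy {d : ℕ} (h : ℝ) (u : Torus d → ℝ) : ℝ :=
  1 / Real.sqrt h * ∫ x : Torus d, (1 - u x) * gaussConv h u x

/-- The distance `d_h(u,u') = (2 √h ∫ |G_{h/2} * (u - u')|² dx)^{1/2}`. -/
def thDist {d : ℕ} (h : ℝ) (u u' : Torus d → ℝ) : ℝ :=
  Real.sqrt (2 * Real.sqrt h * ∫ x : Torus d, |gaussConv (h / 2) (fun y => u y - u' y) x| ^ 2)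

/-- The constant `c₀ = 1/√(2π)`. -/
def c₀ : ℝ := 1 / Real.sqrt (2 * Real.pi)

/-- Lebesgue measure `dt dx` on `(0,T) × [0,1)^d`. -/
def spaceTime (d : ℕ) (T : ℝ) : Measure (ℝ × Torus d) :=
  (volume.restrict (Set.Ioo 0 T)).prod volume

/-- `χ` is, up to time `T`, the piecewise constant interpolation with step size `h` of a sequence
of functions of space: `χ(t) = c n` for `t ∈ [nh,(n+1)h)`, and `χ(t) = c 0` for `t ≤ 0`
(the natural-number floor of a negative number is `0`). -/
def IsPiecewiseConstant {d : ℕ} (T h : ℝ) (χ : ℝ → Torus d → ℝ) : Prop :=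
  ∃ c : ℕ → Torus d → ℝ, ∀ t < T, χ t = c ⌊t / h⌋₊

/-- Weak convergence in `L¹((0,T) × [0,1)^d)`. -/
def WeakL1Tendsto {d : ℕ} (T : ℝ) (u : ℕ → ℝ → Torus d → ℝ) (χ : ℝ → Torus d → ℝ) : Prop :=
  Integrable (fun p : ℝ × Torus d => χ p.1 p.2) (spaceTime d T) ∧
  ∀ g : ℝ × Torus d → ℝ, MemLp g ∞ (spaceTime d T) →
    Tendsto (fun k => ∫ p, u k p.1 p.2 * g p ∂(spaceTime d T)) atTop
      (𝓝 (∫ p, χ p.1 p.2 * g p ∂(spaceTime d T)))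

/-- Strong convergence in `L¹((0,T) × [0,1)^d)`. -/
def StrongL1Tendsto {d : ℕ} (T : ℝ) (u : ℕ → ℝ → Torus d → ℝ) (χ : ℝ → Torus d → ℝ) : Prop :=
  Integrable (fun p : ℝ × Torus d => χ p.1 p.2) (spaceTime d T) ∧
  Tendsto (fun k => ∫ p, |u k p.1 p.2 - χ p.1 p.2| ∂(spaceTime d T)) atTop (𝓝 0)

/-- Vector fields `ξ ∈ C₀^∞((0,T) × [0,1)^d)^d`: smooth, periodic in space and compactly
supported in the open time interval. -/
structure IsTestField {d : ℕ} (T : ℝ) (ξ : ℝ → Torus d → Euc d) : Prop where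
  smooth : ContDiff ℝ ∞ (fun p : ℝ × Euc d => ξ p.1 (proj p.2))
  support : ∃ a b : ℝ, 0 < a ∧ b < T ∧ ∀ t, t ∉ Set.Icc a b → ∀ x, ξ t x = 0

/-- The spatial divergence `∇·ξ = ∑ᵢ ∂ᵢ ξᵢ`. -/
def divergence {d : ℕ} (ξ : ℝ → Torus d → Euc d) (t : ℝ) (x : Torus d) : ℝ :=
  ∑ i : Fin d, deriv (fun s : ℝ => ξ t (x + proj (EuclideanSpace.single i s)) i) 0

/-- The total variation `∫ |∇χ| dt ∈ [0,∞]` of the distributional spatial gradient of `χ` in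
`(0,T) × [0,1)^d`: the supremum of `∫ χ ∇·ξ dx dt` over test fields with `|ξ| ≤ 1`. -/
def totalVariation {d : ℕ} (T : ℝ) (χ : ℝ → Torus d → ℝ) : ℝ≥0∞ :=
  ⨆ (ξ : ℝ → Torus d → Euc d) (_ : IsTestField T ξ) (_ : ∀ t x, ‖ξ t x‖ ≤ 1),
    ENNReal.ofReal (∫ p, χ p.1 p.2 * divergence ξ p.1 p.2 ∂(spaceTime d T))

/-- The distributional spatial gradient of `χ` in `(0,T) × [0,1)^d` is a bounded (vector-valued)
measure with polar factorization `∇χ = ν μ`, `|ν| = 1` `μ`-almost everywhere; that is, `μ` is the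
total variation measure `|∇χ| dt` and `ν` the measure-theoretic normal. -/
structure IsPolarGradient {d : ℕ} (T : ℝ) (χ : ℝ → Torus d → ℝ)
    (μ : Measure (ℝ × Torus d)) (ν : ℝ × Torus d → Euc d) : Prop where
  finite : IsFiniteMeasure μ
  concentrated : μ (Set.Ioo 0 T ×ˢ Set.univ)ᶜ = 0
  measurable : Measurable ν
  unit : ∀ᵐ p ∂μ, ‖ν p‖ = 1
  integral_eq : ∀ ξ : ℝ → Torus d → Euc d, IsTestField T ξ →
    ∫ p, χ p.1 p.2 * divergence ξ p.1 p.2 ∂(spaceTime d T) =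
      -∫ p, inner ℝ (ξ p.1 p.2) (ν p) ∂μ

/-- (Lebesgue) equi-integrability in `t` of a measure on time-space. -/
def EquiIntegrableInTime {d : ℕ} (μ : Measure (ℝ × Torus d)) : Prop :=
  ∀ ε : ℝ≥0∞, 0 < ε → ∃ δ : ℝ≥0∞, 0 < δ ∧ ∀ A : Set ℝ, MeasurableSet A → volume A < δ →
    μ (A ×ˢ Set.univ) < ε

/-- Test functions `ζ(z,t,x)` on `ℝ^d × (0,T) × [0,1)^d`: continuous, and of at most polynomial
growth in `z` (uniformly in `t` and `x`). -/
def IsPolyGrowthTest {d : ℕ} (T : ℝ) (ζ : Euc d × (ℝ × Torus d) → ℝ) : Prop :=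
  ContinuousOn ζ (Set.univ ×ˢ (Set.Ioo 0 T ×ˢ Set.univ)) ∧
  ∃ (C : ℝ) (m : ℕ), ∀ z, ∀ t ∈ Set.Ioo 0 T, ∀ x, |ζ (z, (t, x))| ≤ C * (1 + ‖z‖) ^ m

end Thresholding

end

/-! Everything rests on the translation defect D(y) = ∫ v(x)(1 - v(x - y)) dx of a [0,1]-valued
function v. By Fubini and scaling (`energy_eq`) the energy is h^{-1/2} times the G_1-average of z ↦
D(√h z). A pointwise inequality (`mix_triangle`) makes D subadditive, so its Gaussian average
controls every single value: D(√h z) ≤ K E_h(v) √h (1 + |z|) (`exists_defect_le`).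

Gradient. For a fixed shift z, the two jump densities `outJump` and `inJump` are nonnegative, and by
the defect bound their mass over A × [0,1)^d is at most a constant times (1 + |z|)|A|. Their
difference is a difference quotient of u_h in space; discrete integration by parts moves it onto the
test function, so in the limit it becomes the derivative of χ in direction z. Vague limits of the
densities for the coordinate directions therefore represent ∇χ by measures whose time marginals have
bounded densities. This yields the polar decomposition and the equi-integrability in t
(`exists_polarGradient`), together with convergence of the differences to (ν·z)|∇χ|dt along the
whole sequence.

Lower semicontinuity. A nonnegative density dominates its difference with the other one, so it
asymptotically dominates the positive part of the limit of that difference, namely (ν·z)_+ or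
(ν·z)_- times |∇χ|dt (`lintegral_posPart_le_liminf`). Integrating against G_1(z) with Fatou's lemma
and using ∫ G_1(z)(e·z)_+ dz = c₀ for unit vectors e (`integral_gauss_mul_inner`) gives the liminf
inequality for the energy.

Part ii). The same lower semicontinuity holds with any nonnegative test weight. If in addition the
total masses do not exceed the limiting mass asymptotically, nothing can be lost: applying it to P +
ζ, P - ζ and R - min(P, R), for a majorant P of |ζ| of polynomial growth, bounds ∫ ζ from both sides
(`tendsto_integral_of_lsc`). The Gaussian moments and the linear growth in z of the masses prevent
escape to infinity in z.

Compactness. For characteristic functions the defect is half the L¹ distance to the translate, so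
the energy bound is an L¹ modulus in space at scales above √h. It also shows that G_{h/2} * χ is
within O(√h) of χ in L¹. The dissipation controls the L² increments of G_{h/2} * χ over one time
step. Telescoping with Cauchy-Schwarz over times of order √h gives L¹ increments of χ of order √h,
and chaining such blocks gives the modulus t + √h in time (`stepIntegral_stepDist_le`). A
Kolmogorov-type argument with box averages then upgrades weak to strong convergence
(`exists_strong_subseq`). -/

noncomputable section

namespace Thresholding

section

variable {d : ℕ}

/-! ### The torus and its translations. -/

section Torus

theorem proj_add (z w : Euc d) : proj (z + w) = proj z + proj w := by
  funext i; simp [proj]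

theorem proj_sub (z w : Euc d) : proj (z - w) = proj z - proj w := by
  funext i; simp [proj]

@[simp] theorem proj_zero : proj (0 : Euc d) = 0 := by
  funext i; simp [proj]

theorem isOpenQuotientMap_proj : IsOpenQuotientMap (proj : Euc d → Torus d) := by
  have h1 : IsOpenQuotientMap (Pi.map (fun (_ : Fin d) (s : ℝ) => (s : UnitAddCircle))) :=
    IsOpenQuotientMap.piMap fun _ => QuotientAddGroup.isOpenQuotientMap_mk
  have h2 : IsOpenQuotientMap (WithLp.ofLp : Euc d → (Fin d → ℝ)) :=
    (PiLp.homeomorph 2 (fun _ : Fin d => ℝ)).isOpenQuotientMap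
  exact h1.comp h2

@[fun_prop] theorem continuous_proj : Continuous (proj : Euc d → Torus d) :=
  isOpenQuotientMap_proj.continuous

@[fun_prop] theorem measurable_proj : Measurable (proj : Euc d → Torus d) :=
  continuous_proj.measurable

instance isProbabilityMeasure_torus : IsProbabilityMeasure (volume : Measure (Torus d)) := by
  constructor
  rw [volume_pi, ← Set.pi_univ Set.univ, Measure.pi_pi]
  simp

instance isFiniteMeasure_spaceTime (T : ℝ) : IsFiniteMeasure (spaceTime d T) := by
  unfold spaceTime; infer_instance

theorem integral_translate (f : Torus d → ℝ) (y : Torus d) :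
    ∫ x, f (x - y) = ∫ x, f x :=
  integral_sub_right_eq_self f y

theorem measurePreserving_spaceTime_sub (T : ℝ) (y : Torus d) :
    MeasurePreserving (fun p : ℝ × Torus d => (p.1, p.2 - y)) (spaceTime d T) (spaceTime d T) :=
  (MeasurePreserving.id _).prod (measurePreserving_sub_right volume y)

theorem measurePreserving_spaceTime_add (T : ℝ) (y : Torus d) :
    MeasurePreserving (fun p : ℝ × Torus d => (p.1, p.2 + y)) (spaceTime d T) (spaceTime d T) :=
  (MeasurePreserving.id _).prod (measurePreserving_add_right volume y)

theorem spaceTime_eq_restrict (T : ℝ) : spaceTime d T =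
    (volume : Measure (ℝ × Torus d)).restrict (Set.Ioo 0 T ×ˢ Set.univ) := by
  rw [Measure.volume_eq_prod, ← Measure.prod_restrict, Measure.restrict_univ]; rfl

theorem ae_spaceTime_mem (T : ℝ) : ∀ᵐ p ∂(spaceTime d T), p.1 ∈ Set.Ioo 0 T := by
  rw [spaceTime_eq_restrict]
  filter_upwards [ae_restrict_mem (measurableSet_Ioo.prod MeasurableSet.univ)] with p hp using hp.1

end Torus

/-! ### Gaussian kernels: scaling, mass and moments. -/

section Gauss

theorem gauss_nonneg (h : ℝ) (z : Euc d) : 0 ≤ gauss h z := by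
  unfold gauss; positivity

@[fun_prop] theorem continuous_gauss (h : ℝ) : Continuous (gauss h : Euc d → ℝ) := by
  unfold gauss; fun_prop

theorem gauss_smul {h : ℝ} (hh : 0 < h) (z : Euc d) :
    gauss h (Real.sqrt h • z) = (Real.sqrt h ^ d)⁻¹ * gauss 1 z := by
  unfold gauss
  have h1 : Real.sqrt (2 * Real.pi * h) = Real.sqrt (2 * Real.pi * 1) * Real.sqrt h := by
    rw [mul_one, Real.sqrt_mul (by positivity)]
  have h2 : -‖Real.sqrt h • z‖ ^ 2 / (2 * h) = -‖z‖ ^ 2 / (2 * 1) := by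
    rw [norm_smul, Real.norm_of_nonneg (Real.sqrt_nonneg _), mul_pow, Real.sq_sqrt hh.le]
    field_simp
  rw [h1, h2, mul_pow]
  field_simp

/-- The substitution z ↦ √h z. It trades the shrinking kernel G_h for the fixed kernel G_1 evaluated
at shifts √h z, the form in which all later limits are taken. -/
theorem integral_gauss_mul {h : ℝ} (hh : 0 < h) (f : Euc d → ℝ) :
    ∫ z, gauss h z * f z = ∫ z, gauss 1 z * f (Real.sqrt h • z) := by
  have hs : 0 < Real.sqrt h := Real.sqrt_pos.2 hh
  have := Measure.integral_comp_smul (volume : Measure (Euc d))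
    (fun z => gauss h z * f z) (Real.sqrt h)
  simp only [gauss_smul hh, finrank_euclideanSpace, Fintype.card_fin, smul_eq_mul, mul_assoc,
    integral_const_mul] at this
  rw [abs_of_pos (by positivity)] at this
  exact (mul_left_cancel₀ (by positivity) this).symm

/-- The closed formula for the Gaussian integral is strictly positive, while the integral of a
nonintegrable function is 0 by convention; hence the function is integrable. -/
theorem integrable_exp_neg_mul_sq {b : ℝ} (hb : 0 < b) :
    Integrable (fun z : Euc d => Real.exp (-b * ‖z‖ ^ 2)) := by
  by_contra hc
  have h1 := GaussianFourier.integral_rexp_neg_mul_sq_norm (V := Euc d) hb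
  rw [integral_undef hc] at h1
  have : 0 < (Real.pi / b) ^ ((Module.finrank ℝ (Euc d) : ℝ) / 2) := by
    have := Real.pi_pos
    positivity
  exact this.ne h1

theorem integral_gauss_one : ∫ z : Euc d, gauss 1 z = 1 := by
  have h1 := GaussianFourier.integral_rexp_neg_mul_sq_norm (V := Euc d) (b := 1 / 2) (by norm_num)
  have h2 : ∀ z : Euc d, gauss 1 z
      = 1 / Real.sqrt (2 * Real.pi) ^ d * Real.exp (-(1 / 2) * ‖z‖ ^ 2) := by
    intro z
    unfold gauss
    congr 2
    · simp
    · ring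
  simp_rw [h2, integral_const_mul]
  rw [h1]
  have h3 : Real.pi / (1 / 2) = 2 * Real.pi := by ring
  have h4 : (2 * Real.pi) ^ ((Module.finrank ℝ (Euc d) : ℝ) / 2) = Real.sqrt (2 * Real.pi) ^ d := by
    rw [finrank_euclideanSpace, Fintype.card_fin, Real.sqrt_eq_rpow, ← Real.rpow_natCast,
      ← Real.rpow_mul (by positivity)]
    congr 1; ring
  rw [h3, h4]
  have := Real.pi_pos
  field_simp

/-- The standard Gaussian has moments of all orders. -/
theorem integrable_pow_mul_gauss (m : ℕ) :
    Integrable (fun z : Euc d => (1 + ‖z‖) ^ m * gauss 1 z) := by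
  have hI := (integrable_exp_neg_mul_sq (d := d) (b := 1 / 4) (by norm_num)).const_mul
    (m.factorial * Real.exp 2 * (1 / Real.sqrt (2 * Real.pi * 1) ^ d))
  refine hI.mono' (by fun_prop) (Eventually.of_forall fun z => ?_)
  rw [Real.norm_of_nonneg (mul_nonneg (by positivity) (gauss_nonneg _ _))]
  unfold gauss
  have hr : 0 ≤ ‖z‖ := norm_nonneg z
  have h1 : (1 + ‖z‖) ^ m ≤ m.factorial * Real.exp (1 + ‖z‖) := by
    have := Real.pow_div_factorial_le_exp (1 + ‖z‖) (by positivity) m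
    rw [div_le_iff₀ (by positivity)] at this
    linarith
  have h2 : Real.exp (1 + ‖z‖) * Real.exp (-‖z‖ ^ 2 / (2 * 1))
      ≤ Real.exp 2 * Real.exp (-(1 / 4) * ‖z‖ ^ 2) := by
    rw [← Real.exp_add, ← Real.exp_add]
    apply Real.exp_le_exp.2
    nlinarith [sq_nonneg (‖z‖ - 2)]
  calc (1 + ‖z‖) ^ m * (1 / Real.sqrt (2 * Real.pi * 1) ^ d * Real.exp (-‖z‖ ^ 2 / (2 * 1)))
      ≤ m.factorial * Real.exp (1 + ‖z‖)
        * (1 / Real.sqrt (2 * Real.pi * 1) ^ d * Real.exp (-‖z‖ ^ 2 / (2 * 1))) := by gcongr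
    _ = m.factorial * (1 / Real.sqrt (2 * Real.pi * 1) ^ d) *
        (Real.exp (1 + ‖z‖) * Real.exp (-‖z‖ ^ 2 / (2 * 1))) := by ring
    _ ≤ m.factorial * (1 / Real.sqrt (2 * Real.pi * 1) ^ d) *
        (Real.exp 2 * Real.exp (-(1 / 4) * ‖z‖ ^ 2)) := by gcongr
    _ = _ := by ring

theorem integrable_gauss_one : Integrable (fun z : Euc d => gauss 1 z) := by
  simpa using integrable_pow_mul_gauss (d := d) 0

theorem integrable_gauss {h : ℝ} (hh : 0 < h) : Integrable (fun z : Euc d => gauss h z) := by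
  have := (integrable_exp_neg_mul_sq (d := d) (b := 1 / (2 * h)) (by positivity)).const_mul
    (1 / Real.sqrt (2 * Real.pi * h) ^ d)
  refine this.congr (Eventually.of_forall fun z => ?_)
  unfold gauss
  simp only
  congr 2
  field_simp

theorem integral_gauss {h : ℝ} (hh : 0 < h) : ∫ z : Euc d, gauss h z = 1 := by
  have := integral_gauss_mul (d := d) hh (fun _ => 1)
  simpa [integral_gauss_one] using this

end Gauss

/-! ### Translation defects and their control by the energy. -/

section Defect

/-- `∫ v(x) (1 - v(x - y)) dx`, which measures how far `v` is from being invariant under translation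
by `y`. -/
def defect (v : Torus d → ℝ) (y : Torus d) : ℝ := ∫ x, v x * (1 - v (x - y))

variable {v : Torus d → ℝ}

theorem integrable_of_mem_Icc {α : Type*} [MeasurableSpace α] {μ : Measure α} [IsFiniteMeasure μ]
    {f : α → ℝ} (hf : Measurable f) (h : ∀ x, f x ∈ Set.Icc (0 : ℝ) 1) : Integrable f μ := by
  refine Integrable.of_bound hf.aestronglyMeasurable 1 (Eventually.of_forall fun x => ?_)
  rw [Real.norm_of_nonneg (h x).1]; exact (h x).2

theorem mul_mem_Icc {a b : ℝ} (ha : a ∈ Set.Icc (0 : ℝ) 1) (hb : b ∈ Set.Icc (0 : ℝ) 1) :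
    a * b ∈ Set.Icc (0 : ℝ) 1 :=
  ⟨mul_nonneg ha.1 hb.1, mul_le_one₀ ha.2 hb.1 hb.2⟩

theorem one_sub_mem_Icc {a : ℝ} (ha : a ∈ Set.Icc (0 : ℝ) 1) : 1 - a ∈ Set.Icc (0 : ℝ) 1 :=
  ⟨by linarith [ha.2], by linarith [ha.1]⟩

theorem defect_nonneg (hv : ∀ x, v x ∈ Set.Icc (0 : ℝ) 1) (y : Torus d) : 0 ≤ defect v y :=
  integral_nonneg fun x => (mul_mem_Icc (hv x) (one_sub_mem_Icc (hv _))).1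

theorem defect_le_one (hm : Measurable v) (hv : ∀ x, v x ∈ Set.Icc (0 : ℝ) 1) (y : Torus d) :
    defect v y ≤ 1 := by
  have h1 : defect v y ≤ ∫ _ : Torus d, (1 : ℝ) :=
    integral_mono (integrable_of_mem_Icc (by fun_prop)
      fun x => mul_mem_Icc (hv x) (one_sub_mem_Icc (hv _))) (integrable_const _)
      fun x => (mul_mem_Icc (hv x) (one_sub_mem_Icc (hv _))).2
  simpa using h1

/-- Both halves of the translation defect agree. -/
theorem defect_eq (hm : Measurable v) (hv : ∀ x, v x ∈ Set.Icc (0 : ℝ) 1) (y : Torus d) :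
    defect v y = ∫ x, (1 - v x) * v (x - y) := by
  have h1 : Integrable v := integrable_of_mem_Icc hm hv
  have h2 : Integrable (fun x => v (x - y)) := integrable_of_mem_Icc (by fun_prop) fun x => hv _
  have h3 : Integrable (fun x => v x * v (x - y)) :=
    integrable_of_mem_Icc (by fun_prop) fun x => mul_mem_Icc (hv _) (hv _)
  simp only [defect, mul_sub, sub_mul, mul_one, one_mul]
  rw [integral_sub h1 h3, integral_sub h2 h3, integral_translate v y]

/-- The symmetrized integrand, unlike that of `defect`, satisfies a pointwise triangle inequality,
and by `defect_eq` symmetrizing only doubles the integral. -/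
theorem two_mul_defect (hm : Measurable v) (hv : ∀ x, v x ∈ Set.Icc (0 : ℝ) 1) (y : Torus d) :
    2 * defect v y = ∫ x, (v x * (1 - v (x - y)) + (1 - v x) * v (x - y)) := by
  rw [integral_add, ← defect_eq hm hv, two_mul]; rfl
  · exact integrable_of_mem_Icc (by fun_prop) fun x => mul_mem_Icc (hv x) (one_sub_mem_Icc (hv _))
  · exact integrable_of_mem_Icc (by fun_prop) fun x => mul_mem_Icc (one_sub_mem_Icc (hv _)) (hv _)

/-- The quantity a(1 - c) + (1 - a)c is the probability that independent Bernoulli variables with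
means a and c differ. If they differ, one of them differs from a third independent variable of mean
b. Algebraically, the gap between the two sides is 2b(1 - a)(1 - c) + 2(1 - b)ac. -/
theorem mix_triangle {a b c : ℝ} (ha : a ∈ Set.Icc (0 : ℝ) 1) (hb : b ∈ Set.Icc (0 : ℝ) 1)
    (hc : c ∈ Set.Icc (0 : ℝ) 1) :
    a * (1 - c) + (1 - a) * c ≤ (a * (1 - b) + (1 - a) * b) + (b * (1 - c) + (1 - b) * c) := by
  obtain ⟨a0, a1⟩ := ha
  obtain ⟨b0, b1⟩ := hb
  obtain ⟨c0, c1⟩ := hc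
  have h1 : 0 ≤ b * ((1 - a) * (1 - c)) :=
    mul_nonneg b0 (mul_nonneg (by linarith) (by linarith))
  have h2 : 0 ≤ (1 - b) * (a * c) := mul_nonneg (by linarith) (mul_nonneg a0 c0)
  nlinarith [h1, h2]

theorem integrable_mix (hm : Measurable v) (hv : ∀ x, v x ∈ Set.Icc (0 : ℝ) 1) (y y' : Torus d) :
    Integrable (fun x => v (x - y) * (1 - v (x - y')) + (1 - v (x - y)) * v (x - y')) :=
  (integrable_of_mem_Icc (by fun_prop)
    fun x => mul_mem_Icc (hv _) (one_sub_mem_Icc (hv _))).add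
  (integrable_of_mem_Icc (by fun_prop)
    fun x => mul_mem_Icc (one_sub_mem_Icc (hv _)) (hv _))

/-- Integrate `mix_triangle` along the points x, x - y, x - y - y'; translation invariance turns the
last leg into the defect of y'. -/
theorem defect_add_le (hm : Measurable v) (hv : ∀ x, v x ∈ Set.Icc (0 : ℝ) 1) (y y' : Torus d) :
    defect v (y + y') ≤ defect v y + defect v y' := by
  have h1 := two_mul_defect hm hv (y + y')
  have h2 := two_mul_defect hm hv y
  have h3 := two_mul_defect hm hv y'
  rw [← integral_translate _ y] at h3
  have i0 := integrable_mix hm hv 0 (y + y')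
  have i1 := integrable_mix hm hv 0 y
  have i2 := integrable_mix hm hv y (y + y')
  simp only [sub_zero] at i0 i1
  simp only [sub_sub] at h3
  have h4 : ∫ x, (v x * (1 - v (x - (y + y'))) + (1 - v x) * v (x - (y + y'))) ≤
      ∫ x, ((v x * (1 - v (x - y)) + (1 - v x) * v (x - y)) +
        (v (x - y) * (1 - v (x - (y + y'))) + (1 - v (x - y)) * v (x - (y + y')))) :=
    integral_mono i0 (i1.add i2) fun x => mix_triangle (hv _) (hv _) (hv _)
  rw [integral_add i1 i2] at h4
  linarith

theorem measurable_defect (hm : Measurable v) : Measurable (defect v) := by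
  have : Measurable (Function.uncurry fun (y x : Torus d) => v x * (1 - v (x - y))) := by
    unfold Function.uncurry; fun_prop
  exact (this.stronglyMeasurable.integral_prod_right' (ν := (volume : Measure (Torus d)))).measurable

/-- Fubini in (x, z): the energy is an average of defects, so estimates on single shifts and on the
energy can be exchanged. -/
theorem energy_eq (hm : Measurable v) (hv : ∀ x, v x ∈ Set.Icc (0 : ℝ) 1) {h : ℝ} (hh : 0 < h) :
    energy h v = 1 / Real.sqrt h * ∫ z : Euc d, gauss 1 z * defect v (proj (Real.sqrt h • z)) := by
  unfold energy gaussConv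
  congr 1
  have hint : Integrable (Function.uncurry fun (x : Torus d) (z : Euc d) =>
      (1 - v x) * (gauss h z * v (x - proj z))) (volume.prod volume) := by
    have hg : Integrable (fun q : Torus d × Euc d => (1 : ℝ) * gauss h q.2) (volume.prod volume) :=
      (integrable_const (1 : ℝ)).mul_prod (integrable_gauss hh)
    refine hg.mono' ?_ (Eventually.of_forall fun q => ?_)
    · apply Measurable.aestronglyMeasurable
      unfold Function.uncurry
      have := (continuous_gauss (d := d) h).measurable
      fun_prop
    · unfold Function.uncurry
      have h1 := one_sub_mem_Icc (hv q.1)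
      have h2 := hv (q.1 - proj q.2)
      have h3 := gauss_nonneg h q.2
      rw [Real.norm_of_nonneg (mul_nonneg h1.1 (mul_nonneg h3 h2.1))]
      have h4 := (mul_mem_Icc h1 h2).2
      nlinarith
  calc ∫ x, (1 - v x) * ∫ z, gauss h z * v (x - proj z)
      = ∫ x, ∫ z, (1 - v x) * (gauss h z * v (x - proj z)) := by
        simp_rw [integral_const_mul]
    _ = ∫ z, ∫ x, (1 - v x) * (gauss h z * v (x - proj z)) := integral_integral_swap hint
    _ = ∫ z, gauss h z * defect v (proj z) := by
        congr 1; funext z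
        rw [defect_eq hm hv, ← integral_const_mul]
        congr 1; funext x; ring
    _ = _ := integral_gauss_mul hh _

theorem defect_nsmul_le (hm : Measurable v) (hv : ∀ x, v x ∈ Set.Icc (0 : ℝ) 1) (y : Torus d)
    (n : ℕ) : defect v ((n + 1) • y) ≤ (n + 1) * defect v y := by
  induction n with
  | zero => simp
  | succ n ih =>
    rw [succ_nsmul]
    have := defect_add_le hm hv ((n + 1) • y) y
    push_cast
    linarith

theorem proj_nsmul (n : ℕ) (z : Euc d) : proj (n • z) = n • proj z := by
  induction n with
  | zero => simp
  | succ n ih => rw [succ_nsmul, succ_nsmul, proj_add, ih]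

/-- The energy controls all translation defects. -/
theorem exists_defect_le (d : ℕ) : ∃ K : ℝ, 0 < K ∧ ∀ (v : Torus d → ℝ), Measurable v →
    (∀ x, v x ∈ Set.Icc (0 : ℝ) 1) → ∀ h : ℝ, 0 < h → ∀ z : Euc d,
      defect v (proj (Real.sqrt h • z)) ≤ K * energy h v * Real.sqrt h * (1 + ‖z‖) := by
  set B : Set (Euc d) := Metric.ball 0 1 with hB
  -- A lower bound for G_1 on the ball of radius 2, which contains every a ± w with |a| ≤ 1 and |w|
  -- < 1.
  set m : ℝ := 1 / Real.sqrt (2 * Real.pi * 1) ^ d * Real.exp (-(2 : ℝ) ^ 2 / (2 * 1)) with hm_def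
  have hm0 : 0 < m := by
    have := Real.pi_pos
    positivity
  have hVpos : 0 < volume.real B :=
    ENNReal.toReal_pos (Metric.measure_ball_pos _ _ one_pos).ne' measure_ball_lt_top.ne
  set V := volume.real B
  have hgm : ∀ w : Euc d, ‖w‖ ≤ 2 → m ≤ gauss 1 w := by
    intro w hw
    unfold gauss
    rw [hm_def]
    gcongr
  refine ⟨2 / (m * V), by positivity, fun v hm hv h hh z => ?_⟩
  have hs : 0 < Real.sqrt h := Real.sqrt_pos.2 hh
  set D : Euc d → ℝ := fun z => defect v (proj (Real.sqrt h • z)) with hD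
  have hDm : Measurable D := (measurable_defect hm).comp (by fun_prop)
  have hD0 : ∀ z, 0 ≤ D z := fun z => defect_nonneg hv _
  have hD1 : ∀ z, D z ≤ 1 := fun z => defect_le_one hm hv _
  have hadd : ∀ z w, D (z + w) ≤ D z + D w := fun z w => by
    simp only [hD, smul_add, proj_add]; exact defect_add_le hm hv _ _
  have hGD : Integrable (fun w => gauss 1 w * D w) := by
    refine integrable_gauss_one.mono' (by fun_prop) (Eventually.of_forall fun w => ?_)
    rw [Real.norm_of_nonneg (mul_nonneg (gauss_nonneg _ _) (hD0 _))]
    exact mul_le_of_le_one_right (gauss_nonneg _ _) (hD1 _)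
  have hE : ∫ w, gauss 1 w * D w = Real.sqrt h * energy h v := by
    rw [energy_eq hm hv hh]; field_simp; rfl
  -- The average of D over a unit ball centred at a is controlled by the energy, since G_1 ≥ m
  -- there. The sign r allows both w and a - w as variables.
  have hball : ∀ a : Euc d, ‖a‖ ≤ 1 → ∀ r : ℝ, |r| = 1 →
      ∫ w in B, D (a + r • w) ≤ (Real.sqrt h * energy h v) / m := by
    intro a ha r hr
    rw [le_div_iff₀ hm0, ← hE, mul_comm, ← integral_const_mul]
    have hmp : MeasurePreserving (fun w : Euc d => a + r • w) := by
      have h1 : MeasurePreserving (fun w : Euc d => r • w) := by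
        rcases (abs_eq one_pos.le).1 hr with h | h
        · have h2 : (fun w : Euc d => r • w) = id := by funext w; simp [h]
          rw [h2]; exact MeasurePreserving.id _
        · subst h; simpa using Measure.measurePreserving_neg (volume : Measure (Euc d))
      exact (measurePreserving_add_left volume a).comp h1
    have hme : MeasurableEmbedding (fun w : Euc d => a + r • w) := by
      have hr0 : r ≠ 0 := by rintro rfl; simp at hr
      exact (measurableEmbedding_addLeft a).comp (measurableEmbedding_const_smul₀ hr0)
    calc ∫ w in B, m * D (a + r • w)
        ≤ ∫ w in B, gauss 1 (a + r • w) * D (a + r • w) := by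
          refine setIntegral_mono_on ?_ ?_ measurableSet_ball fun w hw => ?_
          · refine (Measure.integrableOn_of_bounded (M := m) measure_ball_lt_top.ne
              (Measurable.const_mul (hDm.comp (by fun_prop)) m).aestronglyMeasurable
              (Eventually.of_forall fun w => ?_))
            rw [Real.norm_of_nonneg (mul_nonneg hm0.le (hD0 _))]
            exact mul_le_of_le_one_right hm0.le (hD1 _)
          · exact (hmp.integrable_comp_of_integrable hGD).integrableOn
          · apply mul_le_mul_of_nonneg_right _ (hD0 _)
            apply hgm
            rw [hB, mem_ball_zero_iff] at hw
            calc ‖a + r • w‖ ≤ ‖a‖ + ‖r • w‖ := norm_add_le _ _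
              _ = ‖a‖ + ‖w‖ := by rw [norm_smul, Real.norm_eq_abs, hr, one_mul]
              _ ≤ 2 := by linarith
      _ ≤ ∫ w, gauss 1 (a + r • w) * D (a + r • w) :=
          setIntegral_le_integral (hmp.integrable_comp_of_integrable hGD)
            (Eventually.of_forall fun w => mul_nonneg (gauss_nonneg _ _) (hD0 _))
      _ = ∫ w, gauss 1 w * D w := hmp.integral_comp hme (fun w => gauss 1 w * D w)
  have hint : ∀ (a : Euc d) (r : ℝ), IntegrableOn (fun w => D (a + r • w)) B := fun a r =>
    Measure.integrableOn_of_bounded (M := 1) measure_ball_lt_top.ne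
      (hDm.comp (by fun_prop)).aestronglyMeasurable (Eventually.of_forall fun w => by
        rw [Real.norm_of_nonneg (hD0 _)]; exact hD1 _)
  -- For |a| ≤ 1, average D(a) ≤ D(w) + D(a - w) over w in the unit ball. The two terms give the
  -- factor 2 in K = 2/(mV).
  have hsmall : ∀ a : Euc d, ‖a‖ ≤ 1 → D a ≤ 2 / (m * V) * energy h v * Real.sqrt h := by
    intro a ha
    have h1 : V * D a ≤ ∫ w in B, (D (0 + (1 : ℝ) • w) + D (a + (-1 : ℝ) • w)) := by
      have : V * D a = ∫ _ in B, D a := by simp [V]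
      rw [this]
      refine setIntegral_mono_on (integrableOn_const measure_ball_lt_top.ne)
        ((hint _ _).add (hint _ _)) measurableSet_ball fun w _ => ?_
      have := hadd w (a - w)
      simpa [sub_eq_add_neg] using this
    rw [integral_add (hint _ _) (hint _ _)] at h1
    have h2 := hball 0 (by simp) 1 (by simp)
    have h3 := hball a ha (-1) (by simp)
    have h4 : V * D a ≤ 2 * (Real.sqrt h * energy h v / m) := by linarith
    rw [← le_div_iff₀' hVpos] at h4
    refine h4.trans (le_of_eq ?_)
    field_simp
  have hE0 : 0 ≤ Real.sqrt h * energy h v := by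
    rw [← hE]
    exact integral_nonneg fun w => mul_nonneg (gauss_nonneg _ _) (hD0 _)
  -- A general z is the sum of n + 1 ≤ 1 + |z| equal vectors of norm at most 1; subadditivity gives
  -- the linear growth.
  set n := ⌊‖z‖⌋₊
  have hn : ((n : ℝ) + 1) • (((n : ℝ) + 1)⁻¹ • z) = z := smul_inv_smul₀ (by positivity) z
  have hz1 : ‖((n : ℝ) + 1)⁻¹ • z‖ ≤ 1 := by
    rw [norm_smul, Real.norm_of_nonneg (by positivity), inv_mul_le_iff₀ (by positivity), mul_one]
    exact (Nat.lt_floor_add_one _).le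
  have hz2 : D z ≤ (n + 1) * D (((n : ℝ) + 1)⁻¹ • z) := by
    have h1 := defect_nsmul_le hm hv (proj (Real.sqrt h • (((n : ℝ) + 1)⁻¹ • z))) n
    rw [← proj_nsmul] at h1
    have h2 : (n + 1) • (Real.sqrt h • (((n : ℝ) + 1)⁻¹ • z)) = Real.sqrt h • z := by
      rw [← Nat.cast_smul_eq_nsmul ℝ, smul_comm]
      push_cast
      rw [hn]
    rw [h2] at h1
    exact h1
  have hn2 : (n : ℝ) ≤ ‖z‖ := Nat.floor_le (norm_nonneg z)
  calc D z ≤ (n + 1) * D (((n : ℝ) + 1)⁻¹ • z) := hz2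
    _ ≤ (n + 1) * (2 / (m * V) * energy h v * Real.sqrt h) := by
        gcongr; exact hsmall _ hz1
    _ = (2 / (m * V)) * (Real.sqrt h * energy h v) * (n + 1) := by ring
    _ ≤ (2 / (m * V)) * (Real.sqrt h * energy h v) * (1 + ‖z‖) := by
        gcongr (2 / (m * V)) * (Real.sqrt h * energy h v) * ?_
        linarith
    _ = _ := by ring

end Defect

end

section

/-! ### Vague limits of measures of bounded mass. -/

section Limits

variable {X : Type*} [TopologicalSpace X] [T2Space X] [LocallyCompactSpace X] [MeasurableSpace X]
  [BorelSpace X]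

theorem exists_ultrafilter_lim {ι : Type*} (U : Ultrafilter ι) {f : ι → ℝ} {M : ℝ}
    (h : ∀ᶠ k in (U : Filter ι), |f k| ≤ M) : ∃ l, Tendsto f U (𝓝 l) := by
  have h1 : (U.map f : Filter ℝ) ≤ 𝓟 (Set.Icc (-M) M) := by
    rw [Ultrafilter.coe_map]
    exact tendsto_principal.2 (h.mono fun k hk => abs_le.1 hk)
  obtain ⟨l, -, hl⟩ := isCompact_Icc.ultrafilter_le_nhds (U.map f) h1
  exact ⟨l, hl⟩

/-- Measures of uniformly bounded mass have vague limits along ultrafilters. -/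
theorem exists_vague_limit {ι : Type*} (U : Ultrafilter ι) (m : ι → Measure X)
    [∀ k, IsFiniteMeasure (m k)] {M : ℝ} (hM : ∀ᶠ k in (U : Filter ι), (m k).real Set.univ ≤ M) :
    ∃ α : Measure X, α.Regular ∧ ∀ η : X → ℝ, Continuous η → HasCompactSupport η →
      Tendsto (fun k => ∫ x, η x ∂(m k)) U (𝓝 (∫ x, η x ∂α)) := by
  have hlim : ∀ η : CompactlySupportedContinuousMap X ℝ,
      ∃ l, Tendsto (fun k => ∫ x, η x ∂(m k)) U (𝓝 l) := by
    intro η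
    obtain ⟨B, hB⟩ := η.hasCompactSupport.exists_bound_of_continuous η.continuous
    have hB0 : 0 ≤ |B| := abs_nonneg B
    refine exists_ultrafilter_lim U (M := |B| * M) ?_
    filter_upwards [hM] with k hk
    rw [← Real.norm_eq_abs]
    calc ‖∫ x, η x ∂(m k)‖ ≤ |B| * (m k).real Set.univ :=
          norm_integral_le_of_norm_le_const
            (Eventually.of_forall fun x => (hB x).trans (le_abs_self B))
      _ ≤ |B| * M := by gcongr
  choose l hl using hlim
  let Λ : CompactlySupportedContinuousMap X ℝ →ₚ[ℝ] ℝ :=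
    { toFun := l
      map_add' := fun f g => by
        refine tendsto_nhds_unique (hl (f + g)) (((hl f).add (hl g)).congr fun k => ?_)
        rw [← integral_add f.integrable g.integrable]; rfl
      map_smul' := fun c f => by
        refine tendsto_nhds_unique (hl (c • f)) (((hl f).const_mul c).congr fun k => ?_)
        rw [← integral_const_mul]; rfl
      monotone' := fun f g hfg =>
        le_of_tendsto_of_tendsto' (hl f) (hl g) fun k =>
          integral_mono f.integrable g.integrable hfg }
  refine ⟨RealRMK.rieszMeasure Λ, inferInstance, fun η hη hc => ?_⟩
  have := hl ⟨⟨η, hη⟩, hc⟩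
  have h2 := RealRMK.integral_rieszMeasure Λ ⟨⟨η, hη⟩, hc⟩
  rw [show (∫ x, η x ∂(RealRMK.rieszMeasure Λ)) = l ⟨⟨η, hη⟩, hc⟩ from h2]
  exact this

/-- Vague limits do not increase the mass of open sets. -/
theorem vague_limit_open_le {ι : Type*} {U : Filter ι} [U.NeBot] {m : ι → Measure X}
    [∀ k, IsFiniteMeasure (m k)] {α : Measure X} [α.Regular]
    (h : ∀ η : X → ℝ, Continuous η → HasCompactSupport η →
      Tendsto (fun k => ∫ x, η x ∂(m k)) U (𝓝 (∫ x, η x ∂α)))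
    {O : Set X} (hO : IsOpen O) {M : ℝ} (hM : ∀ᶠ k in U, (m k).real O ≤ M) :
    α O ≤ ENNReal.ofReal M := by
  rw [hO.measure_eq_iSup_isCompact]
  refine iSup₂_le fun K hK => iSup_le fun hKc => ?_
  obtain ⟨f, f1, f0, fc, f01⟩ := exists_continuous_one_zero_of_isCompact hKc hO.isClosed_compl
    (Set.disjoint_compl_right_iff_subset.2 hK)
  have h1 : (∫ x, f x ∂α) ≤ M := by
    refine le_of_tendsto (h f f.continuous fc) ?_
    filter_upwards [hM] with k hk
    refine le_trans ?_ hk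
    rw [← integral_indicator_one hO.measurableSet]
    refine integral_mono (f.continuous.integrable_of_hasCompactSupport fc)
      ((integrable_const (1 : ℝ)).indicator hO.measurableSet) fun x => ?_
    by_cases hx : x ∈ O
    · simpa [hx] using (f01 x).2
    · simpa [hx] using (f0 hx).le
  have h2 : α.real K ≤ M := by
    refine le_trans ?_ h1
    rw [← integral_indicator_one hKc.measurableSet]
    refine integral_mono ((continuousOn_const.integrableOn_compact hKc).integrable_indicator
      hKc.measurableSet) (f.continuous.integrable_of_hasCompactSupport fc) fun x => ?_
    by_cases hx : x ∈ K
    · simpa [hx] using (f1 hx).ge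
    · simpa [hx] using (f01 x).1
  rw [← ENNReal.ofReal_toReal hKc.measure_lt_top.ne]
  exact ENNReal.ofReal_le_ofReal h2

end Limits

/-! ### Polar decomposition of a vector measure. -/

section Polar

variable {X : Type*} [MeasurableSpace X] {d : ℕ}

/-- Polar factorization of the vector measure with components `a i - b i`. -/
theorem exists_polar (a b : Fin d → Measure X) [∀ i, IsFiniteMeasure (a i)]
    [∀ i, IsFiniteMeasure (b i)] :
    ∃ (μ : Measure X) (ν : X → Euc d), (∀ A, MeasurableSet A → μ A ≤ ∑ i, (a i A + b i A)) ∧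
      Measurable ν ∧ (∀ᵐ p ∂μ, ‖ν p‖ = 1) ∧
      ∀ F : Fin d → X → ℝ, (∀ i, Measurable (F i)) → (∀ i, ∃ C, ∀ x, |F i x| ≤ C) →
        ∫ x, ∑ i, F i x * ν x i ∂μ = ∑ i, (∫ x, F i x ∂(a i) - ∫ x, F i x ∂(b i)) := by
  -- A common dominating finite measure; the vector measure becomes v μ₀ with v built from
  -- Radon-Nikodym densities.
  set μ₀ : Measure X := Measure.sum fun i => a i + b i with hμ₀
  have : IsFiniteMeasure μ₀ := by rw [hμ₀]; infer_instance
  have hle : ∀ i, a i + b i ≤ μ₀ := fun i => Measure.le_sum _ i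
  have ha : ∀ i, a i ≪ μ₀ := fun i =>
    (Measure.absolutelyContinuous_of_le (Measure.le_add_right le_rfl)).trans
      (Measure.absolutelyContinuous_of_le (hle i))
  have hb : ∀ i, b i ≪ μ₀ := fun i =>
    (Measure.absolutelyContinuous_of_le (Measure.le_add_left le_rfl)).trans
      (Measure.absolutelyContinuous_of_le (hle i))
  set α : Fin d → X → ℝ≥0∞ := fun i => (a i).rnDeriv μ₀ with hα
  set β : Fin d → X → ℝ≥0∞ := fun i => (b i).rnDeriv μ₀ with hβ
  have hαm : ∀ i, Measurable (α i) := fun i => Measure.measurable_rnDeriv _ _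
  have hβm : ∀ i, Measurable (β i) := fun i => Measure.measurable_rnDeriv _ _
  set v : X → Euc d := fun x => WithLp.toLp 2 fun i => (α i x).toReal - (β i x).toReal with hv
  have hvm : Measurable v := by
    apply (WithLp.measurable_toLp 2 (Fin d → ℝ)).comp
    exact measurable_pi_lambda _ fun i => (hαm i).ennreal_toReal.sub (hβm i).ennreal_toReal
  have hvn : ∀ x, ENNReal.ofReal ‖v x‖ ≤ ∑ i, (α i x + β i x) := by
    intro x
    have h1 : ‖v x‖ ≤ ∑ i, ((α i x).toReal + (β i x).toReal) := by
      rw [EuclideanSpace.norm_eq]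
      refine (Real.sqrt_le_left (Finset.sum_nonneg fun i _ => by positivity)).2 ?_
      calc ∑ i, ‖v x i‖ ^ 2 ≤ (∑ i, ‖v x i‖) ^ 2 :=
            Finset.sum_sq_le_sq_sum_of_nonneg fun i _ => norm_nonneg _
        _ ≤ _ := by
            gcongr with i
            refine (norm_sub_le _ _).trans ?_
            rw [Real.norm_of_nonneg ENNReal.toReal_nonneg,
              Real.norm_of_nonneg ENNReal.toReal_nonneg]
    refine (ENNReal.ofReal_le_ofReal h1).trans ?_
    rw [ENNReal.ofReal_sum_of_nonneg fun i _ => by positivity]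
    gcongr with i
    rw [ENNReal.ofReal_add ENNReal.toReal_nonneg ENNReal.toReal_nonneg]
    gcongr <;> exact ENNReal.ofReal_toReal_le
  have hvnm : Measurable fun x => ENNReal.ofReal ‖v x‖ := hvm.norm.ennreal_ofReal
  -- Where v = 0 the normal takes the value 0 instead of being a unit vector, but these points carry
  -- no mass for the density |v|.
  refine ⟨μ₀.withDensity fun x => ENNReal.ofReal ‖v x‖, fun x => ‖v x‖⁻¹ • v x, ?_,
    hvm.norm.inv.smul hvm, ?_, ?_⟩
  · intro A hA
    rw [withDensity_apply _ hA]
    calc ∫⁻ x in A, ENNReal.ofReal ‖v x‖ ∂μ₀ ≤ ∫⁻ x in A, ∑ i, (α i x + β i x) ∂μ₀ :=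
          lintegral_mono fun x => hvn x
      _ = ∑ i, (∫⁻ x in A, α i x ∂μ₀ + ∫⁻ x in A, β i x ∂μ₀) := by
          rw [lintegral_finsetSum (f := fun i x => α i x + β i x) _
            fun i _ => (hαm i).add (hβm i)]
          simp_rw [fun i => lintegral_add_left (μ := μ₀.restrict A) (hαm i) (β i)]
      _ ≤ _ := by
          gcongr <;> exact Measure.setLIntegral_rnDeriv_le _
  · rw [ae_withDensity_iff hvnm]
    refine Eventually.of_forall fun x hx => ?_
    have : ‖v x‖ ≠ 0 := fun h => hx (by simp [h])
    rw [norm_smul, norm_inv, norm_norm, inv_mul_cancel₀ this]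
  · intro F hF hC
    rw [integral_withDensity_eq_integral_toReal_smul hvnm (by simp)]
    have h1 : ∀ x, (ENNReal.ofReal ‖v x‖).toReal • ∑ i, F i x * (‖v x‖⁻¹ • v x) i
        = ∑ i, ((α i x).toReal • F i x - (β i x).toReal • F i x) := by
      intro x
      rw [ENNReal.toReal_ofReal (norm_nonneg _), smul_eq_mul, Finset.mul_sum]
      refine Finset.sum_congr rfl fun i _ => ?_
      rw [← sub_smul, smul_eq_mul, PiLp.smul_apply, smul_eq_mul]
      have h2 : v x i = (α i x).toReal - (β i x).toReal := rfl
      rw [h2]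
      by_cases h0 : ‖v x‖ = 0
      · have : v x = 0 := norm_eq_zero.1 h0
        have h3 : v x i = 0 := by simp [this]
        rw [h2] at h3
        simp [h3]
      · field_simp
    have hi : ∀ (c : Fin d → Measure X) [∀ i, IsFiniteMeasure (c i)] (i : Fin d), c i ≪ μ₀ →
        Integrable (fun x => ((c i).rnDeriv μ₀ x).toReal • F i x) μ₀ := by
      intro c _ i hc
      obtain ⟨C, hC⟩ := hC i
      rw [integrable_rnDeriv_smul_iff hc]
      exact Integrable.of_bound (hF i).aestronglyMeasurable C (Eventually.of_forall hC)
    simp_rw [h1]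
    rw [integral_finsetSum (f := fun i x => (α i x).toReal • F i x - (β i x).toReal • F i x) _
      fun i _ => (hi a i (ha i)).sub (hi b i (hb i))]
    refine Finset.sum_congr rfl fun i _ => ?_
    rw [integral_sub (hi a i (ha i)) (hi b i (hb i)), integral_rnDeriv_smul (ha i),
      integral_rnDeriv_smul (hb i)]

end Polar

/-! ### Lower semicontinuity of positive parts. -/

section Lsc

variable {X : Type*} [MetricSpace X] [LocallyCompactSpace X] [SecondCountableTopology X]
  [MeasurableSpace X] [BorelSpace X]

/-- The positive part of a signed measure is almost maximized by continuous test functions. -/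
theorem exists_test_integral_posPart_le {μ : Measure X} [IsFiniteMeasure μ] {w : X → ℝ}
    (hw : Integrable w μ) {φ : X → ℝ} (hφ : Continuous φ) (hφc : HasCompactSupport φ)
    (hφ0 : ∀ x, 0 ≤ φ x) {ε : ℝ} (hε : 0 < ε) :
    ∃ η : X → ℝ, Continuous η ∧ HasCompactSupport η ∧ (∀ x, 0 ≤ η x) ∧ (∀ x, η x ≤ φ x) ∧
      ∫ x, φ x * max (w x) 0 ∂μ ≤ ∫ x, η x * w x ∂μ + ε := by
  obtain ⟨B, hB⟩ := hφc.exists_bound_of_continuous hφ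
  set M := |B| + 1
  have hM0 : 0 < M := by positivity
  have hM : ∀ x, φ x ≤ M := fun x => by
    have := (le_abs_self _).trans ((hB x).trans (le_abs_self B)); simp only [M]; linarith
  set V := μ.real Set.univ + 2
  have hV : 0 < V := by positivity
  set δ := ε / (M * V)
  have hδ : 0 < δ := by positivity
  obtain ⟨ρ, ρc, hρ, ρcont, ρi⟩ := hw.exists_hasCompactSupport_integral_sub_le hδ
  -- A continuous substitute for the indicator of {w > 0}: w is approximated in L¹ by a continuous
  -- ρ, and ρ₊/(ρ₊ + δ) multiplies ρ to ρ₊ up to an error δ.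
  set ψ : X → ℝ := fun x => max (ρ x) 0 / (max (ρ x) 0 + δ)
  have hden : ∀ x, 0 < max (ρ x) 0 + δ := fun x => by positivity
  have hψc : Continuous ψ :=
    Continuous.div (by fun_prop) (by fun_prop) fun x => (hden x).ne'
  have hψ0 : ∀ x, 0 ≤ ψ x := fun x => by positivity
  have hψ1 : ∀ x, ψ x ≤ 1 := fun x => by
    rw [div_le_one (hden x)]; linarith
  have hψρ : ∀ x, max (ρ x) 0 - δ ≤ ψ x * ρ x := by
    intro x
    rcases le_total (ρ x) 0 with h | h
    · simp [ψ, max_eq_right h, hδ.le]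
    · simp only [ψ, max_eq_left h]
      rw [div_mul_eq_mul_div, le_div_iff₀ (by positivity)]
      nlinarith
  have hwm : Integrable (fun x => φ x * max (w x) 0) μ :=
    (hw.sup (integrable_zero _ _ _)).bdd_mul (c := |B|) hφ.aestronglyMeasurable
      (Eventually.of_forall fun x => (hB x).trans (le_abs_self B))
  have hηw : Integrable (fun x => φ x * ψ x * w x) μ :=
    hw.bdd_mul (c := M) (hφ.mul hψc).aestronglyMeasurable (Eventually.of_forall fun x => by
      rw [Real.norm_of_nonneg (mul_nonneg (hφ0 x) (hψ0 x))]
      exact (mul_le_of_le_one_right (hφ0 x) (hψ1 x)).trans (hM x))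
  refine ⟨fun x => φ x * ψ x, hφ.mul hψc, hφc.mul_right, fun x => mul_nonneg (hφ0 x) (hψ0 x),
    fun x => mul_le_of_le_one_right (hφ0 x) (hψ1 x), ?_⟩
  -- The error |w - ρ| enters twice, in replacing w₊ by ρ₊ and ψρ by ψw; the term δ comes from the
  -- regularized indicator.
  have hpt : ∀ x, φ x * max (w x) 0 ≤ φ x * ψ x * w x + (M * (2 * ‖w x - ρ x‖) + M * δ) := by
    intro x
    have h1 : max (w x) 0 ≤ max (ρ x) 0 + ‖w x - ρ x‖ := by
      rcases le_total (w x) 0 with h | h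
      · rw [max_eq_right h]; positivity
      · rw [max_eq_left h]
        have := le_abs_self (w x - ρ x)
        have := le_max_left (ρ x) 0
        rw [Real.norm_eq_abs]; linarith
    have h2 : ψ x * ρ x ≤ ψ x * w x + ‖w x - ρ x‖ := by
      have h3 : ψ x * (ρ x - w x) ≤ ψ x * ‖w x - ρ x‖ := by
        apply mul_le_mul_of_nonneg_left _ (hψ0 x)
        rw [norm_sub_rev]; exact le_abs_self _
      have h4 : ψ x * ‖w x - ρ x‖ ≤ ‖w x - ρ x‖ :=
        mul_le_of_le_one_left (norm_nonneg _) (hψ1 x)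
      linarith
    have h5 : max (w x) 0 - ψ x * w x ≤ 2 * ‖w x - ρ x‖ + δ := by linarith [hψρ x]
    have h6 : φ x * (max (w x) 0 - ψ x * w x) ≤ φ x * (2 * ‖w x - ρ x‖ + δ) :=
      mul_le_mul_of_nonneg_left h5 (hφ0 x)
    have h7 : φ x * (2 * ‖w x - ρ x‖ + δ) ≤ M * (2 * ‖w x - ρ x‖ + δ) :=
      mul_le_mul_of_nonneg_right (hM x) (by positivity)
    linarith
  have hsub : Integrable (fun x => M * (2 * ‖w x - ρ x‖)) μ :=
    ((hw.sub ρi).norm.const_mul 2).const_mul M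
  have h8 := integral_mono hwm (hηw.add (hsub.add (integrable_const (M * δ)))) hpt
  have h9 := integral_add hηw (hsub.add (integrable_const (M * δ)))
  have h10 := integral_add hsub (integrable_const (μ := μ) (M * δ))
  simp only [Pi.add_apply] at h8 h9 h10
  rw [h9, h10, integral_const_mul, integral_const_mul, integral_const, smul_eq_mul] at h8
  refine h8.trans ?_
  gcongr
  calc M * (2 * ∫ x, ‖w x - ρ x‖ ∂μ) + μ.real Set.univ * (M * δ)
      ≤ M * (2 * δ) + μ.real Set.univ * (M * δ) := by gcongr
    _ = M * V * δ := by simp only [V]; ring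
    _ = ε := by simp only [δ]; field_simp

/-- Lower semicontinuity for densities `f k` dominating densities `g k` that converge weakly. -/
theorem lintegral_posPart_le_liminf_of_hasCompactSupport {S μ : Measure X} [IsFiniteMeasure S]
    [IsFiniteMeasure μ] {f g : ℕ → X → ℝ} (hg : ∀ k, Integrable (g k) S)
    (hf : ∀ k, Integrable (f k) S) (hf0 : ∀ k x, 0 ≤ f k x) (hgf : ∀ k x, g k x ≤ f k x)
    {w : X → ℝ} (hw : Integrable w μ)
    (hlim : ∀ η : X → ℝ, Continuous η → HasCompactSupport η →
      Tendsto (fun k => ∫ x, η x * g k x ∂S) atTop (𝓝 (∫ x, η x * w x ∂μ)))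
    {φ : X → ℝ} (hφ : Continuous φ) (hφc : HasCompactSupport φ) (hφ0 : ∀ x, 0 ≤ φ x) :
    ∫⁻ x, ENNReal.ofReal (φ x * max (w x) 0) ∂μ ≤
      liminf (fun k => ∫⁻ x, ENNReal.ofReal (φ x * f k x) ∂S) atTop := by
  obtain ⟨B, hB⟩ := hφc.exists_bound_of_continuous hφ
  have hint : ∀ (m : Measure X) {F : X → ℝ}, Integrable F m →
      Integrable (fun x => φ x * F x) m := fun m F hF =>
    hF.bdd_mul (c := B) hφ.aestronglyMeasurable (Eventually.of_forall hB)
  have e1 : ∫⁻ x, ENNReal.ofReal (φ x * max (w x) 0) ∂μ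
      = ENNReal.ofReal (∫ x, φ x * max (w x) 0 ∂μ) :=
    (ofReal_integral_eq_lintegral_ofReal (hint μ (hw.sup (integrable_zero _ _ _)))
      (Eventually.of_forall fun x => mul_nonneg (hφ0 x) (le_max_right _ _))).symm
  have e2 : ∀ k, ∫⁻ x, ENNReal.ofReal (φ x * f k x) ∂S = ENNReal.ofReal (∫ x, φ x * f k x ∂S) :=
    fun k => (ofReal_integral_eq_lintegral_ofReal (hint S (hf k))
      (Eventually.of_forall fun x => mul_nonneg (hφ0 x) (hf0 k x))).symm
  simp_rw [e1, e2]
  refine ENNReal.le_of_forall_pos_le_add fun ε hε _ => ?_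
  obtain ⟨η, ηc, ηs, η0, ηφ, hη⟩ := exists_test_integral_posPart_le hw hφ hφc hφ0
    (NNReal.coe_pos.2 hε)
  refine (ENNReal.ofReal_le_ofReal hη).trans (ENNReal.ofReal_add_le.trans ?_)
  rw [ENNReal.ofReal_coe_nnreal]
  gcongr
  -- Since 0 ≤ η ≤ φ and g ≤ f with f ≥ 0, one has η g ≤ φ f, and the left side converges by
  -- hypothesis.
  rw [← ((ENNReal.continuous_ofReal.tendsto _).comp (hlim η ηc ηs)).liminf_eq]
  refine liminf_le_liminf (Eventually.of_forall fun k => ?_)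
  refine ENNReal.ofReal_le_ofReal (integral_mono ?_ (hint S (hf k)) fun x => ?_)
  · obtain ⟨B', hB'⟩ := ηs.exists_bound_of_continuous ηc
    exact (hg k).bdd_mul (c := B') ηc.aestronglyMeasurable (Eventually.of_forall hB')
  · exact (mul_le_mul_of_nonneg_left (hgf k x) (η0 x)).trans
      (mul_le_mul_of_nonneg_right (ηφ x) (hf0 k x))

/-- As `lintegral_posPart_le_liminf_of_hasCompactSupport`, for functions `φ` that are increasing
limits of compactly supported ones. -/
theorem lintegral_posPart_le_liminf {S μ : Measure X} [IsFiniteMeasure S]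
    [IsFiniteMeasure μ] {f g : ℕ → X → ℝ} (hg : ∀ k, Integrable (g k) S)
    (hf : ∀ k, Integrable (f k) S) (hf0 : ∀ k x, 0 ≤ f k x) (hgf : ∀ k x, g k x ≤ f k x)
    {w : X → ℝ} (hw : Integrable w μ)
    (hlim : ∀ η : X → ℝ, Continuous η → HasCompactSupport η →
      Tendsto (fun k => ∫ x, η x * g k x ∂S) atTop (𝓝 (∫ x, η x * w x ∂μ)))
    {φ : X → ℝ} (hφ0 : ∀ x, 0 ≤ φ x) {θ : ℕ → X → ℝ} (hθ0 : ∀ n x, 0 ≤ θ n x)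
    (hθ1 : ∀ n x, θ n x ≤ 1) (hθ : ∀ n, Continuous fun x => θ n x * φ x)
    (hθc : ∀ n, HasCompactSupport fun x => θ n x * φ x)
    (hθlim : ∀ᵐ x ∂μ, Tendsto (fun n => θ n x) atTop (𝓝 1)) :
    ∫⁻ x, ENNReal.ofReal (φ x * max (w x) 0) ∂μ ≤
      liminf (fun k => ∫⁻ x, ENNReal.ofReal (φ x * f k x) ∂S) atTop := by
  have h1 : ∀ n, ∫⁻ x, ENNReal.ofReal (θ n x * φ x * max (w x) 0) ∂μ ≤
      liminf (fun k => ∫⁻ x, ENNReal.ofReal (φ x * f k x) ∂S) atTop := fun n => by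
    refine (lintegral_posPart_le_liminf_of_hasCompactSupport hg hf hf0 hgf hw hlim (hθ n) (hθc n)
      fun x => mul_nonneg (hθ0 n x) (hφ0 x)).trans ?_
    refine liminf_le_liminf (Eventually.of_forall fun k => lintegral_mono fun x => ?_)
    apply ENNReal.ofReal_le_ofReal
    exact mul_le_mul_of_nonneg_right (mul_le_of_le_one_left (hφ0 x) (hθ1 n x)) (hf0 k x)
  calc ∫⁻ x, ENNReal.ofReal (φ x * max (w x) 0) ∂μ
      = ∫⁻ x, liminf (fun n => ENNReal.ofReal (θ n x * φ x * max (w x) 0)) atTop ∂μ := by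
        refine lintegral_congr_ae ?_
        filter_upwards [hθlim] with x hx
        refine (Tendsto.liminf_eq ?_).symm
        refine (ENNReal.continuous_ofReal.tendsto _).comp ?_
        simpa using (hx.mul_const (φ x)).mul_const (max (w x) 0)
    _ ≤ liminf (fun n => ∫⁻ x, ENNReal.ofReal (θ n x * φ x * max (w x) 0) ∂μ) atTop := by
        refine lintegral_liminf_le' fun n => ?_
        have := (hθ n).aestronglyMeasurable (μ := μ)
        have h2 : AEMeasurable (fun x => max (w x) 0) μ := hw.aemeasurable.max aemeasurable_const
        exact (this.aemeasurable.mul h2).ennreal_ofReal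
    _ ≤ _ := by
        refine liminf_le_of_frequently_le' (Eventually.of_forall h1).frequently

end Lsc

end

section

variable {d : ℕ}

/-! ### Smooth functions on the space-time torus, via periodic lifts. -/

section Smooth

/-- Smoothness of a function on `ℝ × (ℝ/ℤ)^d`, through its periodic lift. -/
def IsSmooth (η : ℝ × Torus d → ℝ) : Prop :=
  ContDiff ℝ ∞ (fun q : ℝ × Euc d => η (q.1, proj q.2))

theorem isOpenQuotientMap_prodMap_proj :
    IsOpenQuotientMap (Prod.map id proj : ℝ × Euc d → ℝ × Torus d) :=
  IsOpenQuotientMap.id.prodMap isOpenQuotientMap_proj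

theorem continuous_of_lift {Y : Type*} [TopologicalSpace Y] {η : ℝ × Torus d → Y}
    (h : Continuous fun q : ℝ × Euc d => η (q.1, proj q.2)) : Continuous η :=
  isOpenQuotientMap_prodMap_proj.isQuotientMap.continuous_iff.2 h

theorem IsSmooth.continuous {η : ℝ × Torus d → ℝ} (h : IsSmooth η) : Continuous η :=
  continuous_of_lift (ContDiff.continuous h)

theorem proj_surjective : Function.Surjective (proj : Euc d → Torus d) :=
  isOpenQuotientMap_proj.surjective

/-- The partial derivative `∂ᵢη` in space. -/
def spaceDeriv (η : ℝ × Torus d → ℝ) (i : Fin d) (p : ℝ × Torus d) : ℝ :=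
  deriv (fun s : ℝ => η (p.1, p.2 + proj (EuclideanSpace.single i s))) 0

theorem euc_eq_sum (z : Euc d) : z = ∑ i, z i • EuclideanSpace.single i (1 : ℝ) := by
  ext j
  simp [Finset.sum_apply, Pi.single_apply]

theorem IsSmooth.hasDerivAt_fderiv {η : ℝ × Torus d → ℝ} (h : IsSmooth η) (t : ℝ) (y z : Euc d) :
    HasDerivAt (fun s : ℝ => η (t, proj y + proj (s • z)))
      (fderiv ℝ (fun q : ℝ × Euc d => η (q.1, proj q.2)) (t, y) (0, z)) 0 := by
  have h1 : HasFDerivAt (fun q : ℝ × Euc d => η (q.1, proj q.2))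
      (fderiv ℝ (fun q : ℝ × Euc d => η (q.1, proj q.2)) (t, y)) ((t, y) + (0 : ℝ) • (0, z)) := by
    simpa using ((ContDiff.differentiable h (by simp)) (t, y)).hasFDerivAt
  have h2 : HasDerivAt (fun s : ℝ => ((t, y) : ℝ × Euc d) + s • ((0, z) : ℝ × Euc d)) (0, z) 0 := by
    simpa using ((hasDerivAt_id (0 : ℝ)).smul_const ((0, z) : ℝ × Euc d)).const_add (t, y)
  refine (h1.comp_hasDerivAt (0 : ℝ) h2).congr_of_eventuallyEq (Eventually.of_forall fun s => ?_)
  simp [proj_add]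

theorem IsSmooth.spaceDeriv_eq {η : ℝ × Torus d → ℝ} (h : IsSmooth η) (i : Fin d) (t : ℝ)
    (y : Euc d) : spaceDeriv η i (t, proj y) =
      fderiv ℝ (fun q : ℝ × Euc d => η (q.1, proj q.2)) (t, y) (0, EuclideanSpace.single i 1) := by
  rw [← (h.hasDerivAt_fderiv t y (EuclideanSpace.single i 1)).deriv]
  unfold spaceDeriv
  congr 1
  funext s
  congr 4
  ext j
  simp

theorem IsSmooth.hasDerivAt {η : ℝ × Torus d → ℝ} (h : IsSmooth η) (z : Euc d) (t : ℝ)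
    (x : Torus d) : HasDerivAt (fun s : ℝ => η (t, x + proj (s • z)))
      (∑ i, z i * spaceDeriv η i (t, x)) 0 := by
  obtain ⟨y, rfl⟩ := proj_surjective x
  convert h.hasDerivAt_fderiv t y z using 1
  simp_rw [h.spaceDeriv_eq]
  set L := fderiv ℝ (fun q : ℝ × Euc d => η (q.1, proj q.2)) (t, y)
  have : L (0, z) = (L.comp (ContinuousLinearMap.inr ℝ ℝ (Euc d))) z := rfl
  rw [this]
  conv_rhs => rw [euc_eq_sum z, map_sum]
  simp

theorem IsSmooth.continuous_spaceDeriv {η : ℝ × Torus d → ℝ} (h : IsSmooth η) (i : Fin d) :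
    Continuous (spaceDeriv η i) := by
  apply continuous_of_lift
  simp_rw [h.spaceDeriv_eq]
  exact (ContDiff.continuous_fderiv h (by simp)).clm_apply continuous_const

theorem hasCompactSupport_of_time {Y : Type*} [Zero Y] {η : ℝ × Torus d → Y} {K : Set ℝ}
    (hK : IsCompact K) (h : ∀ t ∉ K, ∀ x, η (t, x) = 0) : HasCompactSupport η :=
  HasCompactSupport.intro (hK.prod isCompact_univ) fun p hp => h p.1 (fun ht => hp ⟨ht, trivial⟩) p.2

theorem exists_time_support {Y : Type*} [Zero Y] {η : ℝ × Torus d → Y} (h : HasCompactSupport η) :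
    ∃ K : Set ℝ, IsCompact K ∧ ∀ t ∉ K, ∀ x, η (t, x) = 0 := by
  refine ⟨Prod.fst '' tsupport η, h.image continuous_fst, fun t ht x => ?_⟩
  by_contra hne
  exact ht ⟨(t, x), subset_tsupport η hne, rfl⟩

theorem hasCompactSupport_spaceDeriv {η : ℝ × Torus d → ℝ} (h : HasCompactSupport η) (i : Fin d) :
    HasCompactSupport (spaceDeriv η i) := by
  obtain ⟨K, hK, h0⟩ := exists_time_support h
  refine hasCompactSupport_of_time hK fun t ht x => ?_
  simp [spaceDeriv, h0 t ht]

/-- Compactly supported continuous functions are uniform limits of smooth ones. -/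
theorem exists_isSmooth_abs_sub_le {η : ℝ × Torus d → ℝ} (hη : Continuous η)
    (hc : HasCompactSupport η) {ε : ℝ} (hε : 0 < ε) :
    ∃ ψ : ℝ × Torus d → ℝ, IsSmooth ψ ∧ HasCompactSupport ψ ∧ ∀ p, |ψ p - η p| ≤ ε := by
  obtain ⟨δ, hδ, hu⟩ := Metric.uniformContinuous_iff.1 (hc.uniformContinuous_of_continuous hη) ε hε
  obtain ⟨r, hr, hrp⟩ := Metric.continuousAt_iff.1
    ((continuous_proj (d := d)).continuousAt (x := 0)) δ hδ
  -- The radius is below r and δ for uniform continuity in space and in time, and below 1 so that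
  -- mollification keeps the support in a fixed compact thickening.
  set s := min (min r δ) 1
  have hs : 0 < s := by positivity
  let φ : ContDiffBump (0 : ℝ × Euc d) := ⟨s / 2, s, half_pos hs, half_lt_self hs⟩
  let μ : Measure (ℝ × Euc d) := Measure.addHaar
  let L : ℝ × Euc d → ℝ := fun q => η (q.1, proj q.2)
  have hL : Continuous L := by fun_prop
  let ψ : ℝ × Torus d → ℝ := fun p => ∫ b, φ.normed μ b * η (p.1 - b.1, p.2 - proj b.2) ∂μ
  -- The lift of ψ is a Euclidean convolution of the lift of η with a bump, so smoothness and the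
  -- uniform error are those of ordinary mollification.
  have hψ : ∀ q : ℝ × Euc d, ψ (q.1, proj q.2) =
      convolution (φ.normed μ) L (ContinuousLinearMap.lsmul ℝ ℝ) μ q := by
    intro q
    rw [convolution_def]
    simp [ψ, L, proj_sub]
  refine ⟨ψ, ?_, ?_, ?_⟩
  · unfold IsSmooth
    simp_rw [hψ]
    exact φ.hasCompactSupport_normed.contDiff_convolution_left _ φ.contDiff_normed
      hL.locallyIntegrable
  · obtain ⟨K, hK, h0⟩ := exists_time_support hc
    refine hasCompactSupport_of_time (hK.cthickening (r := 1)) fun t ht x => ?_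
    have : ∀ b : ℝ × Euc d, φ.normed μ b * η (t - b.1, x - proj b.2) = 0 := by
      intro b
      by_cases hb : b ∈ Function.support (φ.normed μ)
      · rw [φ.support_normed_eq, mem_ball_zero_iff] at hb
        rw [h0 (t - b.1), mul_zero]
        intro hm
        refine ht (Metric.mem_cthickening_of_dist_le t (t - b.1) 1 K hm ?_)
        have h1 : ‖b.1‖ ≤ ‖b‖ := norm_fst_le b
        have h2 : s ≤ 1 := min_le_right _ _
        have h3 : ‖b‖ < s := hb
        simpa using (h1.trans (h3.le.trans h2))
      · rw [Function.notMem_support.1 hb, zero_mul]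
    simp [ψ, this]
  · rintro ⟨t, x⟩
    obtain ⟨y, rfl⟩ := proj_surjective x
    rw [hψ (t, y), ← Real.dist_eq]
    refine φ.dist_normed_convolution_le (g := L) hL.aestronglyMeasurable fun q hq => ?_
    have hq' : ‖q - (t, y)‖ < s := by rw [← dist_eq_norm]; exact hq
    refine (hu ?_).le
    rw [Prod.dist_eq, max_lt_iff]
    constructor
    · calc dist q.1 t = ‖(q - (t, y)).1‖ := by simp [dist_eq_norm]
        _ ≤ ‖q - (t, y)‖ := norm_fst_le _
        _ < δ := hq'.trans_le ((min_le_left _ _).trans (min_le_right _ _))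
    · have h1 : ‖q.2 - y‖ ≤ ‖q - (t, y)‖ := norm_snd_le (q - (t, y))
      have h2 : dist (q.2 - y) 0 < r := by
        rw [dist_zero_right]
        exact (h1.trans_lt hq').trans_le ((min_le_left _ _).trans (min_le_left _ _))
      have h3 := hrp h2
      rwa [proj_sub, proj_zero, dist_zero_right, ← dist_eq_norm] at h3

end Smooth

/-! ### Jump densities and the limit of difference quotients. -/

section Jump

/-- The density `h^{-1/2} u(t,x) (1 - u(t,x - √h z))`. -/
def outJump (h : ℝ) (u : ℝ × Torus d → ℝ) (z : Euc d) (p : ℝ × Torus d) : ℝ :=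
  1 / Real.sqrt h * (u p * (1 - u (p.1, p.2 - proj (Real.sqrt h • z))))

/-- The density `h^{-1/2} (1 - u(t,x)) u(t,x - √h z)`. -/
def inJump (h : ℝ) (u : ℝ × Torus d → ℝ) (z : Euc d) (p : ℝ × Torus d) : ℝ :=
  1 / Real.sqrt h * ((1 - u p) * u (p.1, p.2 - proj (Real.sqrt h • z)))

variable {u : ℝ × Torus d → ℝ} {h : ℝ} {T : ℝ}

theorem outJump_sub_inJump (z : Euc d) (p : ℝ × Torus d) : outJump h u z p - inJump h u z p =
    1 / Real.sqrt h * (u p - u (p.1, p.2 - proj (Real.sqrt h • z))) := by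
  unfold outJump inJump; ring

theorem measurable_uncurry_outJump (hm : Measurable u) :
    Measurable (fun q : Euc d × (ℝ × Torus d) => outJump h u q.1 q.2) := by
  unfold outJump; fun_prop

theorem measurable_uncurry_inJump (hm : Measurable u) :
    Measurable (fun q : Euc d × (ℝ × Torus d) => inJump h u q.1 q.2) := by
  unfold inJump; fun_prop

theorem measurable_outJump (hm : Measurable u) (z : Euc d) : Measurable (outJump h u z) :=
  (measurable_uncurry_outJump hm).comp measurable_prodMk_left

theorem measurable_inJump (hm : Measurable u) (z : Euc d) : Measurable (inJump h u z) :=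
  (measurable_uncurry_inJump hm).comp measurable_prodMk_left

theorem outJump_nonneg (h01 : ∀ p, u p ∈ Set.Icc (0 : ℝ) 1) (z : Euc d) (p : ℝ × Torus d) :
    0 ≤ outJump h u z p :=
  mul_nonneg (by positivity) (mul_mem_Icc (h01 _) (one_sub_mem_Icc (h01 _))).1

theorem inJump_nonneg (h01 : ∀ p, u p ∈ Set.Icc (0 : ℝ) 1) (z : Euc d) (p : ℝ × Torus d) :
    0 ≤ inJump h u z p :=
  mul_nonneg (by positivity) (mul_mem_Icc (one_sub_mem_Icc (h01 _)) (h01 _)).1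

theorem integrable_outJump (hm : Measurable u) (h01 : ∀ p, u p ∈ Set.Icc (0 : ℝ) 1)
    {S : Measure (ℝ × Torus d)} [IsFiniteMeasure S] (z : Euc d) : Integrable (outJump h u z) S :=
  (integrable_of_mem_Icc (f := fun p => u p * (1 - u (p.1, p.2 - proj (Real.sqrt h • z))))
    (by fun_prop) fun _ => mul_mem_Icc (h01 _) (one_sub_mem_Icc (h01 _))).const_mul _

theorem integrable_inJump (hm : Measurable u) (h01 : ∀ p, u p ∈ Set.Icc (0 : ℝ) 1)
    {S : Measure (ℝ × Torus d)} [IsFiniteMeasure S] (z : Euc d) : Integrable (inJump h u z) S :=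
  (integrable_of_mem_Icc (f := fun p => (1 - u p) * u (p.1, p.2 - proj (Real.sqrt h • z)))
    (by fun_prop) fun _ => mul_mem_Icc (one_sub_mem_Icc (h01 _)) (h01 _)).const_mul _

theorem setIntegral_outJump (hm : Measurable u) (h01 : ∀ p, u p ∈ Set.Icc (0 : ℝ) 1) (z : Euc d)
    (A : Set ℝ) : ∫ p in A ×ˢ Set.univ, outJump h u z p ∂(spaceTime d T) =
      ∫ t in A, 1 / Real.sqrt h * defect (fun x => u (t, x)) (proj (Real.sqrt h • z))
        ∂(volume.restrict (Set.Ioo 0 T)) := by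
  have hi : IntegrableOn (outJump h u z) (A ×ˢ Set.univ) (spaceTime d T) :=
    (integrable_outJump hm h01 z).integrableOn
  unfold spaceTime at hi ⊢
  rw [setIntegral_prod _ hi, Measure.restrict_univ]
  simp only [outJump, integral_const_mul, defect]

theorem setIntegral_inJump (hm : Measurable u) (h01 : ∀ p, u p ∈ Set.Icc (0 : ℝ) 1) (z : Euc d)
    (A : Set ℝ) : ∫ p in A ×ˢ Set.univ, inJump h u z p ∂(spaceTime d T) =
      ∫ t in A, 1 / Real.sqrt h * defect (fun x => u (t, x)) (proj (Real.sqrt h • z))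
        ∂(volume.restrict (Set.Ioo 0 T)) := by
  have hi : IntegrableOn (inJump h u z) (A ×ˢ Set.univ) (spaceTime d T) :=
    (integrable_inJump hm h01 z).integrableOn
  unfold spaceTime at hi ⊢
  rw [setIntegral_prod _ hi, Measure.restrict_univ]
  simp only [inJump, integral_const_mul]
  congr 2; funext t
  rw [defect_eq (v := fun x => u (t, x)) (by fun_prop) fun x => h01 _]

theorem integral_outJump_eq (hm : Measurable u) (h01 : ∀ p, u p ∈ Set.Icc (0 : ℝ) 1) (z : Euc d) :
    ∫ p, outJump h u z p ∂(spaceTime d T) = ∫ p, inJump h u z p ∂(spaceTime d T) := by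
  have h1 := setIntegral_outJump (T := T) (h := h) hm h01 z Set.univ
  have h2 := setIntegral_inJump (T := T) (h := h) hm h01 z Set.univ
  simp only [Set.univ_prod_univ, Measure.restrict_univ] at h1 h2
  rw [h1, h2]

theorem measurable_slice_defect (hm : Measurable u) (y : Torus d) :
    Measurable (fun t => defect (fun x => u (t, x)) y) := by
  have : Measurable (Function.uncurry fun (t : ℝ) (x : Torus d) =>
      u (t, x) * (1 - u (t, x - y))) := by
    unfold Function.uncurry; fun_prop
  exact (this.stronglyMeasurable.integral_prod_right' (ν := (volume : Measure (Torus d)))).measurable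

/-- The defect bound is applied on each time slice, where its √h cancels the prefactor 1/√h.
Linearity in the measure of A is the source of equi-integrability in time. -/
theorem setIntegral_outJump_le {K C : ℝ} (hK0 : 0 < K)
    (hK : ∀ (v : Torus d → ℝ), Measurable v →
      (∀ x, v x ∈ Set.Icc (0 : ℝ) 1) → ∀ h : ℝ, 0 < h → ∀ z : Euc d,
        defect v (proj (Real.sqrt h • z)) ≤ K * energy h v * Real.sqrt h * (1 + ‖z‖))
    (hm : Measurable u) (h01 : ∀ p, u p ∈ Set.Icc (0 : ℝ) 1) (hh : 0 < h)
    (hE : ∀ᵐ t ∂(volume.restrict (Set.Ioo 0 T)), energy h (fun x => u (t, x)) ≤ C) (z : Euc d)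
    (A : Set ℝ) : ∫ p in A ×ˢ Set.univ, outJump h u z p ∂(spaceTime d T) ≤
      K * C * (1 + ‖z‖) * (volume.restrict (Set.Ioo 0 T)).real A := by
  rw [setIntegral_outJump hm h01]
  have hs : 0 < Real.sqrt h := Real.sqrt_pos.2 hh
  have h1 : ∫ t in A, 1 / Real.sqrt h * defect (fun x => u (t, x)) (proj (Real.sqrt h • z))
        ∂(volume.restrict (Set.Ioo 0 T)) ≤ ∫ t in A, K * C * (1 + ‖z‖)
        ∂(volume.restrict (Set.Ioo 0 T)) := by
    refine integral_mono_ae ?_ (integrable_const _) ?_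
    · refine Integrable.const_mul (integrable_of_mem_Icc (measurable_slice_defect hm _) fun t => ?_) _
      have hmt : Measurable fun x => u (t, x) := by fun_prop
      exact ⟨defect_nonneg (fun x => h01 _) _, defect_le_one hmt (fun x => h01 _) _⟩
    · filter_upwards [ae_restrict_of_ae hE] with t ht
      have hmt : Measurable fun x => u (t, x) := by fun_prop
      have h2 := hK (fun x => u (t, x)) hmt (fun x => h01 _) h hh z
      rw [one_div, inv_mul_le_iff₀ hs]
      refine h2.trans ?_
      have h3 : K * energy h (fun x => u (t, x)) * Real.sqrt h * (1 + ‖z‖) ≤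
          K * C * Real.sqrt h * (1 + ‖z‖) := by gcongr
      linarith
  refine h1.trans (le_of_eq ?_)
  rw [integral_const, smul_eq_mul, mul_comm]
  simp [Measure.real]

theorem setIntegral_inJump_eq_outJump (hm : Measurable u) (h01 : ∀ p, u p ∈ Set.Icc (0 : ℝ) 1)
    (z : Euc d) (A : Set ℝ) : ∫ p in A ×ˢ Set.univ, inJump h u z p ∂(spaceTime d T) =
      ∫ p in A ×ˢ Set.univ, outJump h u z p ∂(spaceTime d T) := by
  rw [setIntegral_inJump hm h01, setIntegral_outJump hm h01]

/-- Discrete integration by parts. -/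
theorem integral_mul_jump_diff (hm : Measurable u) (h01 : ∀ p, u p ∈ Set.Icc (0 : ℝ) 1)
    {η : ℝ × Torus d → ℝ} (hη : Continuous η) (hc : HasCompactSupport η) (z : Euc d) :
    ∫ p, η p * (outJump h u z p - inJump h u z p) ∂(spaceTime d T) =
      -∫ p, u p * (1 / Real.sqrt h * (η (p.1, p.2 + proj (Real.sqrt h • z)) - η p))
        ∂(spaceTime d T) := by
  obtain ⟨B, hB⟩ := hc.exists_bound_of_continuous hη
  set y := proj (Real.sqrt h • z) with hy
  have i1 : Integrable (fun p => η p * u p) (spaceTime d T) :=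
    (integrable_of_mem_Icc hm h01).bdd_mul hη.aestronglyMeasurable (Eventually.of_forall hB)
  have i2 : Integrable (fun p : ℝ × Torus d => η p * u (p.1, p.2 - y)) (spaceTime d T) :=
    (integrable_of_mem_Icc (f := fun p : ℝ × Torus d => u (p.1, p.2 - y)) (by fun_prop)
      fun p => h01 _).bdd_mul hη.aestronglyMeasurable (Eventually.of_forall hB)
  have hmp := measurePreserving_spaceTime_add (d := d) T y
  have i3 : Integrable (fun p : ℝ × Torus d => η (p.1, p.2 + y) * u p) (spaceTime d T) := by
    have := hmp.integrable_comp_of_integrable i2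
    simpa [Function.comp_def] using this
  have e : ∫ p : ℝ × Torus d, η p * u (p.1, p.2 - y) ∂(spaceTime d T) =
      ∫ p : ℝ × Torus d, η (p.1, p.2 + y) * u p ∂(spaceTime d T) := by
    have hme : MeasurableEmbedding (fun p : ℝ × Torus d => (p.1, p.2 + y)) :=
      MeasurableEmbedding.id.prodMap (measurableEmbedding_addRight y)
    have := hmp.integral_comp hme (fun p : ℝ × Torus d => η p * u (p.1, p.2 - y))
    simpa using this.symm
  simp only [outJump_sub_inJump, ← hy]
  have e1 : ∀ p : ℝ × Torus d, η p * (1 / Real.sqrt h * (u p - u (p.1, p.2 - y))) =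
      1 / Real.sqrt h * (η p * u p - η p * u (p.1, p.2 - y)) := fun p => by ring
  have e2 : ∀ p : ℝ × Torus d, u p * (1 / Real.sqrt h * (η (p.1, p.2 + y) - η p)) =
      1 / Real.sqrt h * (η (p.1, p.2 + y) * u p - η p * u p) := fun p => by ring
  simp_rw [e1, e2, integral_const_mul]
  rw [integral_sub i1 i2, integral_sub i3 i1, e]
  ring

/-- Difference quotients of smooth compactly supported functions converge uniformly. -/
theorem exists_forall_abs_diffQuot_sub_le {η : ℝ × Torus d → ℝ} (hη : IsSmooth η)
    (hc : HasCompactSupport η) (z : Euc d) {ε : ℝ} (hε : 0 < ε) :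
    ∃ δ > 0, ∀ r : ℝ, 0 < r → r < δ → ∀ p : ℝ × Torus d,
      |1 / r * (η (p.1, p.2 + proj (r • z)) - η p) - ∑ i, z i * spaceDeriv η i p| ≤ ε := by
  set D : ℝ × Torus d → ℝ := fun p => ∑ i, z i * spaceDeriv η i p with hD
  have hDc : Continuous D := by
    have := fun i => hη.continuous_spaceDeriv i
    fun_prop
  have hDs : HasCompactSupport D := by
    obtain ⟨K, hK, h0⟩ := exists_time_support hc
    refine hasCompactSupport_of_time hK fun t ht x => ?_
    simp [hD, spaceDeriv, h0 t ht]
  obtain ⟨δ₁, hδ₁, hu⟩ := Metric.uniformContinuous_iff.1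
    (hDs.uniformContinuous_of_continuous hDc) ε hε
  have hcont : Continuous (fun s : ℝ => proj (s • z)) := by fun_prop
  obtain ⟨δ, hδ, hpr⟩ := Metric.continuousAt_iff.1 (hcont.continuousAt (x := 0)) δ₁ hδ₁
  refine ⟨δ, hδ, fun r hr hrδ p => ?_⟩
  have hder : ∀ s : ℝ, HasDerivAt (fun s : ℝ => η (p.1, p.2 + proj (s • z)))
      (D (p.1, p.2 + proj (s • z))) s := by
    intro s
    have h1 := hη.hasDerivAt z p.1 (p.2 + proj (s • z))
    have h2 : HasDerivAt (fun s' : ℝ => s' - s) 1 s := (hasDerivAt_id s).sub_const s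
    have h3 : HasDerivAt (fun s : ℝ => η (p.1, p.2 + proj (s • z))) _ s :=
      (HasDerivAt.comp_of_eq s h1 h2 (sub_self s).symm).congr_of_eventuallyEq
        (Eventually.of_forall fun s' => by
          simp only [Function.comp]
          rw [add_assoc, ← proj_add, ← add_smul, add_sub_cancel])
    simpa using h3
  -- By the mean value theorem the quotient is the directional derivative D at a point within the
  -- shift r z; the uniform continuity of D concludes.
  obtain ⟨c, ⟨hc0, hcr⟩, hceq⟩ := exists_hasDerivAt_eq_slope _ _ hr
    (fun s _ => (hder s).continuousAt.continuousWithinAt) (fun s _ => hder s)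
  have h4 : 1 / r * (η (p.1, p.2 + proj (r • z)) - η p) = D (p.1, p.2 + proj (c • z)) := by
    rw [hceq]; simp only [zero_smul, proj_zero, add_zero, sub_zero]; ring
  rw [h4, ← Real.dist_eq]
  refine (hu ?_).le
  rw [Prod.dist_eq, max_lt_iff]
  refine ⟨by simpa using hδ₁, ?_⟩
  have h5 := @hpr c (by rw [dist_zero_right, Real.norm_of_nonneg hc0.le]; linarith)
  simpa using h5

/-- After discrete integration by parts the difference quotient falls on η, where it converges
uniformly; since |u_k| ≤ 1, it may be replaced by its limit, against which weak convergence applies.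
-/
theorem integral_jump_tendsto {h : ℕ → ℝ} (hpos : ∀ k, 0 < h k) (hlim : Tendsto h atTop (𝓝 0))
    {u : ℕ → ℝ × Torus d → ℝ} (hm : ∀ k, Measurable (u k))
    (h01 : ∀ k p, u k p ∈ Set.Icc (0 : ℝ) 1) {χ : ℝ × Torus d → ℝ}
    (hw : ∀ g : ℝ × Torus d → ℝ, MemLp g ∞ (spaceTime d T) →
      Tendsto (fun k => ∫ p, u k p * g p ∂(spaceTime d T)) atTop
        (𝓝 (∫ p, χ p * g p ∂(spaceTime d T))))
    {η : ℝ × Torus d → ℝ} (hη : IsSmooth η) (hc : HasCompactSupport η) (z : Euc d) :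
    Tendsto (fun k => ∫ p, η p * (outJump (h k) (u k) z p - inJump (h k) (u k) z p)
      ∂(spaceTime d T)) atTop
      (𝓝 (-∫ p, χ p * ∑ i, z i * spaceDeriv η i p ∂(spaceTime d T))) := by
  set S := spaceTime d T
  set D : ℝ × Torus d → ℝ := fun p => ∑ i, z i * spaceDeriv η i p with hD
  have hDc : Continuous D := by
    have := fun i => hη.continuous_spaceDeriv i
    fun_prop
  have hDs : HasCompactSupport D := by
    obtain ⟨K, hK, h0⟩ := exists_time_support hc
    refine hasCompactSupport_of_time hK fun t ht x => ?_
    simp [hD, spaceDeriv, h0 t ht]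
  obtain ⟨B, hB⟩ := hDs.exists_bound_of_continuous hDc
  obtain ⟨B', hB'⟩ := hc.exists_bound_of_continuous hη.continuous
  have hDm : MemLp D ∞ S := memLp_top_of_bound hDc.aestronglyMeasurable B (Eventually.of_forall hB)
  have h1 := (hw D hDm).neg
  refine h1.congr_dist ?_
  have hsq : Tendsto (fun k => Real.sqrt (h k)) atTop (𝓝 0) := by
    have := (Real.continuous_sqrt.tendsto 0).comp hlim
    rwa [Real.sqrt_zero] at this
  rw [Metric.tendsto_atTop']
  intro ε hε
  set V := S.real Set.univ + 1
  have hV : 0 < V := by positivity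
  obtain ⟨δ, hδ, hq⟩ := exists_forall_abs_diffQuot_sub_le hη hc z (ε := ε / V / 2) (by positivity)
  obtain ⟨N, hN⟩ := (Metric.tendsto_atTop.1 hsq) δ hδ
  refine ⟨N, fun k hk => ?_⟩
  have hsk : Real.sqrt (h k) < δ := by
    have := hN k hk.le
    rwa [dist_zero_right, Real.norm_of_nonneg (Real.sqrt_nonneg _)] at this
  have hqk := hq (Real.sqrt (h k)) (Real.sqrt_pos.2 (hpos k)) hsk
  rw [integral_mul_jump_diff (hm k) (h01 k) hη.continuous hc, dist_zero_right,
    Real.norm_of_nonneg dist_nonneg, dist_neg_neg, Real.dist_eq]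
  have hui : Integrable (u k) S := integrable_of_mem_Icc (hm k) (h01 k)
  have i1 : Integrable (fun p => u k p * D p) S := by
    simpa [mul_comm] using hui.bdd_mul hDc.aestronglyMeasurable (Eventually.of_forall hB)
  have hQc : Continuous (fun p : ℝ × Torus d => 1 / Real.sqrt (h k) *
      (η (p.1, p.2 + proj (Real.sqrt (h k) • z)) - η p)) := by
    have := hη.continuous
    fun_prop
  have i2 : Integrable (fun p : ℝ × Torus d => u k p * (1 / Real.sqrt (h k) *
      (η (p.1, p.2 + proj (Real.sqrt (h k) • z)) - η p))) S := by
    have := hui.bdd_mul (c := B + ε / V / 2) hQc.aestronglyMeasurable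
      (Eventually.of_forall fun p => by
        have h2 := hqk p
        have h3 := hB p
        rw [Real.norm_eq_abs] at h3 ⊢
        have := abs_add_le (1 / Real.sqrt (h k) *
          (η (p.1, p.2 + proj (Real.sqrt (h k) • z)) - η p) - D p) (D p)
        rw [sub_add_cancel] at this
        linarith)
    simpa [mul_comm] using this
  rw [← integral_sub i1 i2, ← Real.norm_eq_abs]
  have h5 : ‖∫ p, u k p * D p - u k p * (1 / Real.sqrt (h k) *
      (η (p.1, p.2 + proj (Real.sqrt (h k) • z)) - η p)) ∂S‖ ≤ ε / V / 2 * S.real Set.univ := by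
    refine norm_integral_le_of_norm_le_const (Eventually.of_forall fun p => ?_)
    rw [← mul_sub, norm_mul, Real.norm_eq_abs, Real.norm_eq_abs, abs_of_nonneg (h01 k p).1,
      abs_sub_comm]
    exact (mul_le_of_le_one_left (abs_nonneg _) (h01 k p).2).trans (hqk p)
  refine h5.trans_lt ?_
  have h6 : S.real Set.univ ≤ V := by simp [V]
  calc ε / V / 2 * S.real Set.univ ≤ ε / V / 2 * V := by gcongr
    _ = ε / 2 := by field_simp
    _ < ε := half_lt_self hε

end Jump

end

/-! ### The distributional gradient as a limit of jump densities. -/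

section

variable {d : ℕ} {T : ℝ}

theorem IsTestField.isSmooth {ξ : ℝ → Torus d → Euc d} (hξ : IsTestField T ξ) (i : Fin d) :
    IsSmooth (fun p => ξ p.1 p.2 i) :=
  (contDiff_euclidean.1 hξ.smooth) i

theorem IsTestField.hasCompactSupport {ξ : ℝ → Torus d → Euc d} (hξ : IsTestField T ξ)
    (i : Fin d) : HasCompactSupport (fun p : ℝ × Torus d => ξ p.1 p.2 i) := by
  obtain ⟨a, b, -, -, h⟩ := hξ.support
  exact hasCompactSupport_of_time (isCompact_Icc (a := a) (b := b)) fun t ht x => by simp [h t ht x]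

theorem integrable_mul_of_hasCompactSupport {X : Type*} [TopologicalSpace X] [MeasurableSpace X]
    [OpensMeasurableSpace X] [SecondCountableTopology X] {μ : Measure X}
    {f g : X → ℝ} (hf : Integrable f μ) (hg : Continuous g)
    (hc : HasCompactSupport g) : Integrable (fun x => g x * f x) μ := by
  obtain ⟨B, hB⟩ := hc.exists_bound_of_continuous hg
  exact hf.bdd_mul hg.aestronglyMeasurable (Eventually.of_forall hB)

theorem inner_eq_sum (a z : Euc d) : inner ℝ a z = ∑ i, z i * a i := by
  simp [PiLp.inner_apply]

theorem divergence_eq (ξ : ℝ → Torus d → Euc d) (t : ℝ) (x : Torus d) :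
    divergence ξ t x = ∑ i, spaceDeriv (fun p => ξ p.1 p.2 i) i (t, x) := rfl

/-- Weak limits of functions of bounded energy have a gradient which is a measure, obtained as the
limit of their difference quotients. -/
theorem exists_polarGradient {h : ℕ → ℝ} (hpos : ∀ k, 0 < h k) (hlim : Tendsto h atTop (𝓝 0))
    {u : ℕ → ℝ × Torus d → ℝ} (hm : ∀ k, Measurable (u k))
    (h01 : ∀ k p, u k p ∈ Set.Icc (0 : ℝ) 1) {χ : ℝ → Torus d → ℝ}
    (hχ : Integrable (fun p : ℝ × Torus d => χ p.1 p.2) (spaceTime d T))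
    (hw : ∀ g : ℝ × Torus d → ℝ, MemLp g ∞ (spaceTime d T) →
      Tendsto (fun k => ∫ p, u k p * g p ∂(spaceTime d T)) atTop
        (𝓝 (∫ p, χ p.1 p.2 * g p ∂(spaceTime d T))))
    {C : ℝ} (hE : ∀ᶠ k in atTop, ∀ᵐ t ∂(volume.restrict (Set.Ioo 0 T)),
      energy (h k) (fun x => u k (t, x)) ≤ C) :
    ∃ (μ : Measure (ℝ × Torus d)) (ν : ℝ × Torus d → Euc d), IsPolarGradient T χ μ ν ∧
      EquiIntegrableInTime μ ∧ ∀ (z : Euc d) (η : ℝ × Torus d → ℝ), Continuous η →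
        HasCompactSupport η → Tendsto (fun k => ∫ p, η p *
          (outJump (h k) (u k) z p - inJump (h k) (u k) z p) ∂(spaceTime d T)) atTop
          (𝓝 (∫ p, η p * inner ℝ (ν p) z ∂μ)) := by
  obtain ⟨K, hK0, hK⟩ := exists_defect_le d
  set S := spaceTime d T with hS
  set I : Measure ℝ := volume.restrict (Set.Ioo 0 T) with hI
  set e : Fin d → Euc d := fun i => EuclideanSpace.single i 1 with he
  set C' := |K * C * (1 + 1)| with hC'
  have hout : ∀ᶠ k in atTop, ∀ (z : Euc d) (A : Set ℝ),
      ∫ p in A ×ˢ Set.univ, outJump (h k) (u k) z p ∂S ≤ K * C * (1 + ‖z‖) * I.real A := by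
    filter_upwards [hE] with k hk z A
    exact setIntegral_outJump_le hK0 hK (hm k) (h01 k) (hpos k) hk z A
  have hin : ∀ᶠ k in atTop, ∀ (z : Euc d) (A : Set ℝ),
      ∫ p in A ×ˢ Set.univ, inJump (h k) (u k) z p ∂S ≤ K * C * (1 + ‖z‖) * I.real A := by
    filter_upwards [hout] with k hk z A
    rw [hS, setIntegral_inJump_eq_outJump (hm k) (h01 k)]
    exact hk z A
  -- Limits along an ultrafilter exist for all test functions and directions at once. The limit
  -- measures may depend on it, but the differences of the two limits are identified through χ
  -- below.
  set U : Ultrafilter ℕ := Filter.hyperfilter ℕ with hU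
  have hUle : (U : Filter ℕ) ≤ atTop := Nat.hyperfilter_le_atTop
  -- limits of densities of controlled mass
  have key : ∀ f : ℕ → ℝ × Torus d → ℝ, (∀ k, Integrable (f k) S) → (∀ k, Measurable (f k)) →
      (∀ k p, 0 ≤ f k p) → (∀ᶠ k in atTop, ∀ A : Set ℝ,
        ∫ p in A ×ˢ Set.univ, f k p ∂S ≤ C' * I.real A) →
      ∃ α : Measure (ℝ × Torus d), (∀ η : ℝ × Torus d → ℝ, Continuous η → HasCompactSupport η →
        Tendsto (fun k => ∫ p, η p * f k p ∂S) U (𝓝 (∫ p, η p ∂α))) ∧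
        ∀ A : Set ℝ, IsOpen A → α (A ×ˢ Set.univ) ≤ ENNReal.ofReal (C' * I.real A) := by
    intro f hfi hfm hf0 hfb
    set m : ℕ → Measure (ℝ × Torus d) := fun k => S.withDensity fun p => ENNReal.ofReal (f k p)
      with hmdef
    have hmfin : ∀ k, IsFiniteMeasure (m k) := fun k =>
      isFiniteMeasure_withDensity_ofReal (hfi k).2
    have hmreal : ∀ k (A : Set ℝ), MeasurableSet A →
        (m k).real (A ×ˢ Set.univ) = ∫ p in A ×ˢ Set.univ, f k p ∂S := by
      intro k A hA
      rw [Measure.real, withDensity_apply _ (hA.prod MeasurableSet.univ),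
        integral_eq_lintegral_of_nonneg_ae (Eventually.of_forall (hf0 k))
          (hfm k).aestronglyMeasurable]
    have hmb : ∀ᶠ k in (U : Filter ℕ), ∀ (A : Set ℝ), MeasurableSet A →
        (m k).real (A ×ˢ Set.univ) ≤ C' * I.real A := by
      filter_upwards [hUle hfb] with k hk A hA
      rw [hmreal k A hA]; exact hk A
    obtain ⟨α, hαr, hα⟩ := exists_vague_limit U m (M := C' * I.real Set.univ) (by
      filter_upwards [hmb] with k hk
      simpa using hk Set.univ MeasurableSet.univ)
    refine ⟨α, fun η hη hc => ?_, fun A hA => ?_⟩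
    · refine (hα η hη hc).congr fun k => ?_
      rw [integral_withDensity_eq_integral_toReal_smul (hfm k).ennreal_ofReal (by simp)]
      congr 1; funext p
      rw [ENNReal.toReal_ofReal (hf0 k p), smul_eq_mul, mul_comm]
    · refine vague_limit_open_le hα (hA.prod isOpen_univ) ?_
      filter_upwards [hmb] with k hk using hk A hA.measurableSet
  have hei : ∀ i, ‖e i‖ = 1 := fun i => by simp [he]
  have hCC : ∀ i (A : Set ℝ), K * C * (1 + ‖e i‖) * I.real A ≤ C' * I.real A := fun i A => by
    rw [hei]; gcongr; exact le_abs_self _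
  have hA := fun i => key (fun k => outJump (h k) (u k) (e i))
    (fun k => integrable_outJump (hm k) (h01 k) _) (fun k => measurable_outJump (hm k) _)
    (fun k => outJump_nonneg (h01 k) _)
    (hout.mono fun k hk A => (hk (e i) A).trans (hCC i A))
  have hB := fun i => key (fun k => inJump (h k) (u k) (e i))
    (fun k => integrable_inJump (hm k) (h01 k) _) (fun k => measurable_inJump (hm k) _)
    (fun k => inJump_nonneg (h01 k) _)
    (hin.mono fun k hk A => (hk (e i) A).trans (hCC i A))
  choose a haη haA using hA
  choose b hbη hbA using hB
  have hafin : ∀ i, IsFiniteMeasure (a i) := fun i => ⟨by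
    rw [← Set.univ_prod_univ]; exact (haA i _ isOpen_univ).trans_lt ENNReal.ofReal_lt_top⟩
  have hbfin : ∀ i, IsFiniteMeasure (b i) := fun i => ⟨by
    rw [← Set.univ_prod_univ]; exact (hbA i _ isOpen_univ).trans_lt ENNReal.ofReal_lt_top⟩
  obtain ⟨μ, ν, hμle, hνm, hν1, hFν⟩ := exists_polar a b
  -- bound of the time marginal
  set c : ℝ≥0∞ := ∑ _i : Fin d, (ENNReal.ofReal C' + ENNReal.ofReal C') with hc
  have hctop : c ≠ ⊤ := by
    rw [hc]; exact ENNReal.sum_ne_top.2 fun i _ => by finiteness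
  have hμopen : ∀ A : Set ℝ, IsOpen A → μ (A ×ˢ Set.univ) ≤ c * I A := by
    intro A hAo
    refine (hμle _ (hAo.measurableSet.prod MeasurableSet.univ)).trans ?_
    rw [hc, Finset.sum_mul]
    gcongr with i
    rw [add_mul]
    have : ENNReal.ofReal (C' * I.real A) = ENNReal.ofReal C' * I A := by
      rw [ENNReal.ofReal_mul (abs_nonneg _), ofReal_measureReal]
    rw [← this]
    exact add_le_add (haA i A hAo) (hbA i A hAo)
  -- Vague limits only bound the mass of open sets; outer regularity of Lebesgue measure on (0,T)
  -- extends the bound to all sets of times.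
  have hμA : ∀ A : Set ℝ, μ (A ×ˢ Set.univ) ≤ c * I A := by
    intro A
    rw [Set.measure_eq_iInf_isOpen A I]
    by_cases hc0 : c = 0
    · have := hμopen Set.univ isOpen_univ
      rw [hc0, zero_mul] at this ⊢
      exact (measure_mono (Set.prod_mono (Set.subset_univ _) le_rfl)).trans this
    · rw [ENNReal.mul_iInf_of_ne hc0 hctop]
      refine le_iInf fun V => ?_
      rw [ENNReal.mul_iInf_of_ne hc0 hctop]
      refine le_iInf fun hAV => ?_
      rw [ENNReal.mul_iInf_of_ne hc0 hctop]
      refine le_iInf fun hV => ?_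
      exact (measure_mono (Set.prod_mono hAV le_rfl)).trans (hμopen V hV)
  have hμfin : IsFiniteMeasure μ := ⟨by
    rw [← Set.univ_prod_univ]
    exact (hμA Set.univ).trans_lt (ENNReal.mul_lt_top hctop.lt_top (measure_lt_top _ _))⟩
  -- the limit of difference quotients of smooth functions
  have hsm : ∀ i (η : ℝ × Torus d → ℝ), IsSmooth η → HasCompactSupport η →
      ∫ p, η p ∂(a i) - ∫ p, η p ∂(b i) = -∫ p, χ p.1 p.2 * spaceDeriv η i p ∂S := by
    intro i η hη hηc
    have h1 := ((haη i η hη.continuous hηc).sub (hbη i η hη.continuous hηc))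
    have h2 := (integral_jump_tendsto hpos hlim hm h01 hw hη hηc (e i)).mono_left hUle
    have h3 : ∀ p, ∑ j, (e i) j * spaceDeriv η j p = spaceDeriv η i p := fun p => by
      simp [he]
    simp only [h3] at h2
    refine tendsto_nhds_unique h1 (h2.congr fun k => ?_)
    rw [← integral_sub
      (integrable_mul_of_hasCompactSupport (integrable_outJump (hm k) (h01 k) _) hη.continuous hηc)
      (integrable_mul_of_hasCompactSupport (integrable_inJump (hm k) (h01 k) _) hη.continuous hηc)]
    congr 1; funext p; ring
  have hχD : ∀ i (η : ℝ × Torus d → ℝ), IsSmooth η → HasCompactSupport η →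
      Integrable (fun p : ℝ × Torus d => χ p.1 p.2 * spaceDeriv η i p) S := by
    intro i η hη hηc
    simpa [mul_comm] using integrable_mul_of_hasCompactSupport hχ (hη.continuous_spaceDeriv i)
      (hasCompactSupport_spaceDeriv hηc i)
  have hbdd : ∀ (η : ℝ × Torus d → ℝ), Continuous η → HasCompactSupport η →
      ∃ B, ∀ p, |η p| ≤ B := fun η hη hηc => hηc.exists_bound_of_continuous hη
  -- Only the coordinate directions were used to construct μ and ν; a general direction z follows by
  -- linearity.
  have hinner : ∀ (z : Euc d) (η : ℝ × Torus d → ℝ), IsSmooth η → HasCompactSupport η →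
      -∫ p, χ p.1 p.2 * ∑ i, z i * spaceDeriv η i p ∂S = ∫ p, η p * inner ℝ (ν p) z ∂μ := by
    intro z η hη hηc
    have h1 := hFν (fun i p => z i * η p) (fun i => hη.continuous.measurable.const_mul _)
      (fun i => by
        obtain ⟨B, hB⟩ := hbdd η hη.continuous hηc
        refine ⟨|z i| * B, fun p => ?_⟩
        rw [abs_mul]
        exact mul_le_mul_of_nonneg_left (hB p) (abs_nonneg _))
    have h2 : ∀ p, η p * inner ℝ (ν p) z = ∑ i, z i * η p * ν p i := fun p => by
      rw [inner_eq_sum, Finset.mul_sum]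
      exact Finset.sum_congr rfl fun i _ => by ring
    simp_rw [h2]
    rw [h1]
    simp_rw [integral_const_mul, ← mul_sub, hsm _ η hη hηc, Finset.mul_sum]
    rw [integral_finsetSum, ← Finset.sum_neg_distrib]
    · refine Finset.sum_congr rfl fun i _ => ?_
      rw [mul_neg, ← integral_const_mul]
      congr 2; funext p; ring
    · intro i _
      refine ((hχD i η hη hηc).const_mul (z i)).congr (Eventually.of_forall fun p => ?_)
      simp only; ring
  refine ⟨μ, ν, ⟨hμfin, ?_, hνm, hν1, ?_⟩, ?_, ?_⟩
  · have h1 : (Set.Ioo 0 T ×ˢ (Set.univ : Set (Torus d)))ᶜ = (Set.Ioo 0 T)ᶜ ×ˢ Set.univ := by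
      ext p; simp
    rw [h1]
    refine le_antisymm ((hμA _).trans ?_) zero_le
    have : I (Set.Ioo 0 T)ᶜ = 0 := by
      rw [hI, Measure.restrict_apply measurableSet_Ioo.compl]; simp
    rw [this, mul_zero]
  · intro ξ hξ
    have h1 := hFν (fun i p => ξ p.1 p.2 i) (fun i => (hξ.isSmooth i).continuous.measurable)
      (fun i => hbdd _ (hξ.isSmooth i).continuous (hξ.hasCompactSupport i))
    have h2 : ∀ p : ℝ × Torus d, inner ℝ (ξ p.1 p.2) (ν p) = ∑ i, ξ p.1 p.2 i * ν p i :=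
      fun p => by
        rw [inner_eq_sum]; exact Finset.sum_congr rfl fun i _ => mul_comm _ _
    simp_rw [h2]
    rw [h1]
    simp_rw [hsm _ _ (hξ.isSmooth _) (hξ.hasCompactSupport _), divergence_eq, Finset.mul_sum]
    rw [integral_finsetSum, Finset.sum_neg_distrib, neg_neg]
    intro i _
    exact hχD i _ (hξ.isSmooth i) (hξ.hasCompactSupport i)
  · intro ε hε
    rcases eq_or_ne ε ⊤ with rfl | hεt
    · exact ⟨1, one_pos, fun A _ _ => measure_lt_top _ _⟩
    refine ⟨ε / (c + 1), ENNReal.div_pos hε.ne' (by finiteness), fun A hA hAδ => ?_⟩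
    calc μ (A ×ˢ Set.univ) ≤ c * I A := hμA A
      _ ≤ (c + 1) * volume A := by
          gcongr
          · exact le_self_add
          · exact Measure.restrict_le_self
      _ < ε := by
          rw [mul_comm]
          exact (ENNReal.lt_div_iff_mul_lt (Or.inl (by simp)) (Or.inl (by finiteness))).1 hAδ
  · intro z η hη hηc
    set Q : ℕ → ℝ × Torus d → ℝ := fun k p => outJump (h k) (u k) z p - inJump (h k) (u k) z p
      with hQ
    have hQi : ∀ k, Integrable (Q k) S := fun k =>
      (integrable_outJump (hm k) (h01 k) z).sub (integrable_inJump (hm k) (h01 k) z)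
    -- The L¹ norms of the difference quotients are bounded uniformly in large k, which permits
    -- passing from smooth to continuous η by uniform approximation. This gives convergence along
    -- the full sequence.
    set M := |K * C * (1 + ‖z‖) * I.real Set.univ| * 2 with hM
    have hQb : ∀ᶠ k in atTop, ∫ p, |Q k p| ∂S ≤ M := by
      filter_upwards [hout, hin] with k h1 h2
      have h3 := h1 z Set.univ
      have h4 := h2 z Set.univ
      simp only [Set.univ_prod_univ, Measure.restrict_univ] at h3 h4
      calc ∫ p, |Q k p| ∂S ≤ ∫ p, (outJump (h k) (u k) z p + inJump (h k) (u k) z p) ∂S := by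
            refine integral_mono (hQi k).abs ((integrable_outJump (hm k) (h01 k) z).add
              (integrable_inJump (hm k) (h01 k) z)) fun p => ?_
            have h5 := outJump_nonneg (h := h k) (h01 k) z p
            have h6 := inJump_nonneg (h := h k) (h01 k) z p
            simp only [hQ]
            rw [abs_le]; constructor <;> linarith
        _ ≤ M := by
            rw [integral_add (integrable_outJump (hm k) (h01 k) z)
              (integrable_inJump (hm k) (h01 k) z)]
            have := le_abs_self (K * C * (1 + ‖z‖) * I.real Set.univ)
            linarith
    have hwi : Integrable (fun p => inner ℝ (ν p) z) μ := by
      refine Integrable.of_bound (hνm.inner_const).aestronglyMeasurable ‖z‖ ?_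
      filter_upwards [hν1] with p hp
      simpa [hp] using norm_inner_le_norm (𝕜 := ℝ) (ν p) z
    set M' := ∫ p, |inner ℝ (ν p) z| ∂μ with hM'
    have hM0 : 0 ≤ M := by positivity
    have hM0' : 0 ≤ M' := integral_nonneg fun p => abs_nonneg _
    rw [Metric.tendsto_atTop']
    intro ε hε
    set δ := ε / 3 / (M + M' + 1) with hδ
    have hδ0 : 0 < δ := by positivity
    obtain ⟨ψ, hψs, hψc, hψ⟩ := exists_isSmooth_abs_sub_le hη hηc hδ0
    have hlimψ := integral_jump_tendsto hpos hlim hm h01 hw hψs hψc z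
    rw [hinner z ψ hψs hψc] at hlimψ
    obtain ⟨N, hN⟩ := eventually_atTop.1
      (hQb.and (Metric.tendsto_nhds.1 hlimψ (ε / 3) (by positivity)))
    have hdiff : ∀ (m : Measure (ℝ × Torus d)) (f : ℝ × Torus d → ℝ), Integrable f m →
        |∫ p, ψ p * f p ∂m - ∫ p, η p * f p ∂m| ≤ δ * ∫ p, |f p| ∂m := by
      intro m f hf
      rw [← integral_sub (integrable_mul_of_hasCompactSupport hf hψs.continuous hψc)
        (integrable_mul_of_hasCompactSupport hf hη hηc), ← integral_const_mul]
      refine (abs_integral_le_integral_abs).trans ?_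
      refine integral_mono ?_ (hf.abs.const_mul δ) fun p => ?_
      · exact ((integrable_mul_of_hasCompactSupport hf hψs.continuous hψc).sub
          (integrable_mul_of_hasCompactSupport hf hη hηc)).abs
      · simp only
        rw [← sub_mul, abs_mul]
        exact mul_le_mul_of_nonneg_right (hψ p) (abs_nonneg _)
    refine ⟨N, fun k hk => ?_⟩
    obtain ⟨hk1, hk2⟩ := hN k hk.le
    have h1 := hdiff S (Q k) (hQi k)
    have h2 := hdiff μ _ hwi
    rw [Real.dist_eq] at hk2 ⊢
    have h3 : δ * ∫ p, |Q k p| ∂S ≤ δ * M := by gcongr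
    have h4 : δ * (M + M') < ε / 3 := by
      have : δ * (M + M' + 1) = ε / 3 := by rw [hδ]; field_simp
      nlinarith
    rw [abs_lt] at hk2 ⊢
    rw [abs_le] at h1 h2
    constructor <;> linarith [h1.1, h1.2, h2.1, h2.2, hk2.1, hk2.2]

end

section

variable {d : ℕ} {T : ℝ}

/-! ### The constant c₀ as a half moment of the Gaussian. -/

section HalfMoment

theorem gauss_one_eq_prod (z : Euc d) :
    gauss 1 z = ∏ i, (c₀ * Real.exp (-(1 / 2) * z i ^ 2)) := by
  unfold gauss c₀
  rw [Finset.prod_mul_distrib, ← Real.exp_sum, Finset.prod_const, Finset.card_univ,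
    Fintype.card_fin, EuclideanSpace.real_norm_sq_eq, ← Finset.mul_sum, one_div_pow]
  congr 2
  · simp
  · ring

theorem integral_mul_exp_neg_sq_half :
    ∫ x : ℝ, c₀ * Real.exp (-(1 / 2) * x ^ 2) * max x 0 = c₀ := by
  have h1 : ∫ x in Set.Ioi (0 : ℝ), x * Real.exp (-(1 / 2) * x ^ 2) = 1 := by
    have := integral_rpow_mul_exp_neg_mul_rpow (p := 2) (q := 1) (b := 1 / 2) (by norm_num)
      (by norm_num) (by norm_num)
    have e : ∫ x in Set.Ioi (0 : ℝ), x * Real.exp (-(1 / 2) * x ^ 2) =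
        ∫ x in Set.Ioi (0 : ℝ), x ^ (1 : ℝ) * Real.exp (-(1 / 2) * x ^ (2 : ℝ)) :=
      setIntegral_congr_fun measurableSet_Ioi fun x _ => by
        simp only [Real.rpow_one, Real.rpow_two]
    rw [e, this]
    have h2 : -((1 : ℝ) + 1) / 2 = -1 := by norm_num
    have h3 : ((1 : ℝ) + 1) / 2 = 1 := by norm_num
    rw [h2, h3, Real.rpow_neg_one, Real.Gamma_one]
    norm_num
  have h2 : ∀ x : ℝ, c₀ * Real.exp (-(1 / 2) * x ^ 2) * max x 0 =
      c₀ * Set.indicator (Set.Ioi 0) (fun x => x * Real.exp (-(1 / 2) * x ^ 2)) x := by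
    intro x
    by_cases hx : 0 < x
    · rw [Set.indicator_of_mem (show x ∈ Set.Ioi 0 from hx), max_eq_left hx.le]; ring
    · rw [Set.indicator_of_notMem (show x ∉ Set.Ioi 0 from hx), max_eq_right (not_lt.1 hx)]; ring
  simp_rw [h2]
  rw [integral_const_mul, integral_indicator measurableSet_Ioi, h1, mul_one]

theorem integral_exp_neg_sq_half : ∫ x : ℝ, c₀ * Real.exp (-(1 / 2) * x ^ 2) = 1 := by
  rw [integral_const_mul, integral_gaussian]
  unfold c₀
  have h : Real.pi / (1 / 2) = 2 * Real.pi := by ring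
  have := Real.pi_pos
  rw [h, one_div, inv_mul_cancel₀ (by positivity)]

/-- The Gaussian factorizes over coordinates: the chosen one contributes c₀, since ∫₀^∞ x exp(-x²/2)
dx = 1, and every other one contributes 1. -/
theorem integral_gauss_mul_coord (i₀ : Fin d) : ∫ z : Euc d, gauss 1 z * max (z i₀) 0 = c₀ := by
  have h1 := (EuclideanSpace.volume_preserving_symm_measurableEquiv_toLp (Fin d)).integral_comp'
    (fun y : Fin d → ℝ => gauss 1 (WithLp.toLp 2 y) * max (y i₀) 0)
  have h2 : ∫ z : Euc d, gauss 1 z * max (z i₀) 0 =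
      ∫ y : Fin d → ℝ, gauss 1 (WithLp.toLp 2 y) * max (y i₀) 0 := h1
  rw [h2]
  have h3 : ∀ y : Fin d → ℝ, gauss 1 (WithLp.toLp 2 y) * max (y i₀) 0 =
      ∏ i, (c₀ * Real.exp (-(1 / 2) * y i ^ 2) * if i = i₀ then max (y i) 0 else 1) := by
    intro y
    rw [gauss_one_eq_prod, Finset.prod_mul_distrib (g := fun i => if i = i₀ then max (y i) 0 else 1),
      Finset.prod_ite_eq' Finset.univ i₀]
    simp
  simp_rw [h3]
  rw [integral_fintype_prod_volume_eq_prod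
    (fun i (x : ℝ) => c₀ * Real.exp (-(1 / 2) * x ^ 2) * if i = i₀ then max x 0 else 1),
    Finset.prod_eq_single i₀]
  · simpa using integral_mul_exp_neg_sq_half
  · intro j _ hj
    simpa [hj] using integral_exp_neg_sq_half
  · simp

/-- The Gaussian is rotation invariant: completing e to an orthonormal basis reduces the claim to a
coordinate direction. This is why the limiting energy is isotropic. -/
theorem integral_gauss_mul_inner {e : Euc d} (he : ‖e‖ = 1) :
    ∫ z : Euc d, gauss 1 z * max (inner ℝ e z) 0 = c₀ := by
  -- Dimension 0 has no unit vector.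
  have hne : Nonempty (Fin d) := by
    by_contra hc
    rw [not_nonempty_iff] at hc
    have : e = 0 := Subsingleton.elim _ _
    simp [this] at he
  obtain ⟨i₀⟩ := hne
  have ho : Orthonormal ℝ (Set.domRestrict {i₀} fun _ : Fin d => e) := by
    constructor
    · intro i; exact he
    · rintro ⟨i, hi⟩ ⟨j, hj⟩ hij
      rw [Set.mem_singleton_iff] at hi hj
      exact absurd (Subtype.ext (hi.trans hj.symm)) hij
  obtain ⟨b, hb⟩ := ho.exists_orthonormalBasis_extension_of_card_eq (by simp)
  have hb0 : b i₀ = e := hb i₀ rfl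
  have hmp := b.measurePreserving_repr
  have hme : MeasurableEmbedding b.repr := b.repr.toHomeomorph.measurableEmbedding
  have hcomp := hmp.integral_comp hme (fun w => gauss 1 w * max (w i₀) 0)
  rw [← integral_gauss_mul_coord i₀, ← hcomp]
  congr 1; funext z
  rw [b.repr_apply_apply, hb0]
  congr 1
  unfold gauss
  rw [b.repr.norm_map]

theorem integrable_gauss_mul_posPart {f : Euc d → ℝ} (hf : Measurable f) (hb : ∀ z, |f z| ≤ ‖z‖) :
    Integrable (fun z : Euc d => gauss 1 z * max (f z) 0) := by
  refine (integrable_pow_mul_gauss (d := d) 1).mono' (by fun_prop) (Eventually.of_forall fun z => ?_)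
  rw [Real.norm_of_nonneg (mul_nonneg (gauss_nonneg _ _) (le_max_right _ _)), pow_one, mul_comm]
  apply mul_le_mul_of_nonneg_right _ (gauss_nonneg _ _)
  have h1 := hb z
  have h2 := le_abs_self (f z)
  have h3 := norm_nonneg z
  exact max_le (by linarith) (by linarith)

theorem lintegral_gauss_mul_inner {e : Euc d} (he : ‖e‖ = 1) :
    ∫⁻ z : Euc d, ENNReal.ofReal (gauss 1 z * max (inner ℝ e z) 0) = ENNReal.ofReal c₀ := by
  rw [← integral_gauss_mul_inner he, ofReal_integral_eq_lintegral_ofReal]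
  · refine integrable_gauss_mul_posPart (by fun_prop) fun z => ?_
    simpa [he] using abs_real_inner_le_norm e z
  · exact Eventually.of_forall fun z => mul_nonneg (gauss_nonneg _ _) (le_max_right _ _)

end HalfMoment

/-! ### Cutoffs in time. -/

section TimeCutoff

/-- Cutoffs in time which increase to the indicator function of `(0,T)`. -/
def timeCutoff (T : ℝ) (n : ℕ) (p : ℝ × Torus d) : ℝ :=
  max 0 (min 1 (n * min p.1 (T - p.1) - 1))

theorem timeCutoff_nonneg (n : ℕ) (p : ℝ × Torus d) : 0 ≤ timeCutoff T n p := le_max_left _ _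

theorem timeCutoff_le_one (n : ℕ) (p : ℝ × Torus d) : timeCutoff T n p ≤ 1 :=
  max_le zero_le_one (min_le_left _ _)

theorem timeCutoff_eq_zero {n : ℕ} {p : ℝ × Torus d} (h : n * min p.1 (T - p.1) ≤ 1) :
    timeCutoff T n p = 0 :=
  max_eq_left ((min_le_right _ _).trans (by linarith))

theorem tendsto_timeCutoff {p : ℝ × Torus d} (hp : p.1 ∈ Set.Ioo 0 T) :
    Tendsto (fun n => timeCutoff T n p) atTop (𝓝 1) := by
  have hpos : 0 < min p.1 (T - p.1) := lt_min hp.1 (by linarith [hp.2])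
  refine tendsto_const_nhds.congr' ?_
  obtain ⟨N, hN⟩ := exists_nat_gt (2 / min p.1 (T - p.1))
  filter_upwards [eventually_ge_atTop N] with n hn
  have h1 : 2 / min p.1 (T - p.1) < n := hN.trans_le (by exact_mod_cast hn)
  rw [div_lt_iff₀ hpos] at h1
  unfold timeCutoff
  rw [min_eq_left (by linarith), max_eq_right zero_le_one]

/-- Nothing is known about φ at times outside (0,T), but the cutoff vanishes in a whole
neighbourhood of each such point. -/
theorem continuous_timeCutoff_mul {φ : ℝ × Torus d → ℝ}
    (hφ : ContinuousOn φ (Set.Ioo 0 T ×ˢ Set.univ)) (n : ℕ) :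
    Continuous fun p => timeCutoff T n p * φ p := by
  have hc : Continuous (timeCutoff (d := d) T n) := by unfold timeCutoff; fun_prop
  rw [continuous_iff_continuousAt]
  intro p
  by_cases hp : p.1 ∈ Set.Ioo 0 T
  · have hO : IsOpen (Set.Ioo 0 T ×ˢ (Set.univ : Set (Torus d))) := isOpen_Ioo.prod isOpen_univ
    exact hc.continuousAt.mul (hφ.continuousAt (hO.mem_nhds ⟨hp, trivial⟩))
  · have hmin : min p.1 (T - p.1) ≤ 0 := by
      by_contra hcon
      rw [not_le, lt_min_iff] at hcon
      exact hp ⟨hcon.1, by linarith [hcon.2]⟩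
    have hlt : n * min p.1 (T - p.1) < 1 :=
      (mul_nonpos_of_nonneg_of_nonpos (Nat.cast_nonneg n) hmin).trans_lt one_pos
    have hcm : Continuous fun q : ℝ × Torus d => n * min q.1 (T - q.1) := by fun_prop
    have hev : ∀ᶠ q in 𝓝 p, (0 : ℝ) = timeCutoff T n q * φ q := by
      filter_upwards [hcm.continuousAt.eventually_lt_const hlt] with q hq
      rw [timeCutoff_eq_zero hq.le, zero_mul]
    exact continuousAt_const.congr hev

theorem hasCompactSupport_timeCutoff_mul (φ : ℝ × Torus d → ℝ) (n : ℕ) :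
    HasCompactSupport fun p => timeCutoff T n p * φ p := by
  refine hasCompactSupport_of_time (isCompact_Icc (a := 0) (b := T)) fun t ht x => ?_
  rw [timeCutoff_eq_zero, zero_mul]
  have hmin : min t (T - t) ≤ 0 := by
    by_contra hcon
    rw [not_le, lt_min_iff] at hcon
    exact ht ⟨hcon.1.le, by linarith [hcon.2]⟩
  exact (mul_nonpos_of_nonneg_of_nonpos (Nat.cast_nonneg n) hmin).trans zero_le_one

end TimeCutoff

/-! ### Lower semicontinuity integrated over the shifts. -/

section LscInSpace

/-- Lower semicontinuity, integrated over the shifts. -/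
theorem lintegral_prod_le_liminf {μ : Measure (ℝ × Torus d)} [IsFiniteMeasure μ]
    (hconc : μ (Set.Ioo 0 T ×ˢ Set.univ)ᶜ = 0)
    {f g : ℕ → Euc d → ℝ × Torus d → ℝ} (hfm : ∀ k, Measurable fun q : Euc d × (ℝ × Torus d) =>
      f k q.1 q.2) (hg : ∀ k z, Integrable (g k z) (spaceTime d T))
    (hf : ∀ k z, Integrable (f k z) (spaceTime d T)) (hf0 : ∀ k z p, 0 ≤ f k z p)
    (hgf : ∀ k z p, g k z p ≤ f k z p) {w : Euc d → ℝ × Torus d → ℝ}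
    (hwm : Measurable fun q : Euc d × (ℝ × Torus d) => w q.1 q.2)
    (hw : ∀ z, Integrable (w z) μ)
    (hlim : ∀ (z : Euc d) (η : ℝ × Torus d → ℝ), Continuous η → HasCompactSupport η →
      Tendsto (fun k => ∫ p, η p * g k z p ∂(spaceTime d T)) atTop (𝓝 (∫ p, η p * w z p ∂μ)))
    {Φ : Euc d × (ℝ × Torus d) → ℝ} (hΦm : Measurable Φ) (hΦ0 : ∀ q, 0 ≤ Φ q)
    (hΦ : ContinuousOn Φ (Set.univ ×ˢ (Set.Ioo 0 T ×ˢ Set.univ))) :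
    ∫⁻ q, ENNReal.ofReal (Φ q * (gauss 1 q.1 * max (w q.1 q.2) 0)) ∂(volume.prod μ) ≤
      liminf (fun k => ∫⁻ q, ENNReal.ofReal (Φ q * (gauss 1 q.1 * f k q.1 q.2))
        ∂(volume.prod (spaceTime d T))) atTop := by
  have hgm : Measurable fun q : Euc d × (ℝ × Torus d) => gauss 1 q.1 :=
    (continuous_gauss 1).measurable.comp measurable_fst
  have hm : ∀ k, Measurable fun q : Euc d × (ℝ × Torus d) =>
      ENNReal.ofReal (Φ q * (gauss 1 q.1 * f k q.1 q.2)) := fun k =>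
    (hΦm.mul (hgm.mul (hfm k))).ennreal_ofReal
  have hm' : Measurable fun q : Euc d × (ℝ × Torus d) =>
      ENNReal.ofReal (Φ q * (gauss 1 q.1 * max (w q.1 q.2) 0)) :=
    (hΦm.mul (hgm.mul (hwm.max measurable_const))).ennreal_ofReal
  rw [lintegral_prod _ hm'.aemeasurable]
  simp_rw [fun k => lintegral_prod (μ := (volume : Measure (Euc d))) (ν := spaceTime d T) _
    (hm k).aemeasurable]
  -- Fatou's lemma in z reduces the claim to a fixed shift, where the weight G_1(z)Φ(z, ·) is an
  -- increasing limit of compactly supported functions through the time cutoffs.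
  refine le_trans (lintegral_mono fun z => ?_)
    (lintegral_liminf_le fun k => (hm k).lintegral_prod_right')
  have hae : ∀ᵐ p ∂μ, p.1 ∈ Set.Ioo 0 T := by
    rw [ae_iff]
    refine measure_mono_null (fun p hp => ?_) hconc
    simpa using hp
  have hΦz : ContinuousOn (fun p => Φ (z, p) * gauss 1 z) (Set.Ioo 0 T ×ˢ Set.univ) := by
    refine ContinuousOn.mul (hΦ.comp (by fun_prop) fun p hp => ⟨trivial, hp⟩) continuousOn_const
  have h1 := lintegral_posPart_le_liminf (fun k => hg k z) (fun k => hf k z) (fun k => hf0 k z)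
    (fun k => hgf k z) (hw z) (hlim z) (φ := fun p => Φ (z, p) * gauss 1 z)
    (fun p => mul_nonneg (hΦ0 _) (gauss_nonneg _ _)) (θ := timeCutoff T)
    timeCutoff_nonneg timeCutoff_le_one (continuous_timeCutoff_mul hΦz)
    (hasCompactSupport_timeCutoff_mul _) (hae.mono fun p hp => tendsto_timeCutoff hp)
  simp only [mul_assoc] at h1
  exact h1

/-- Integrating over z first yields c₀ at μ-almost every point, because ν is a unit vector there. -/
theorem lintegral_prod_gauss_posPart {μ : Measure (ℝ × Torus d)} [IsFiniteMeasure μ]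
    {ν : ℝ × Torus d → Euc d} (hν : Measurable ν) (hν1 : ∀ᵐ p ∂μ, ‖ν p‖ = 1) :
    ∫⁻ q, ENNReal.ofReal (gauss 1 q.1 * max (inner ℝ (ν q.2) q.1) 0) ∂(volume.prod μ) =
      ENNReal.ofReal c₀ * μ Set.univ := by
  have hm : Measurable fun q : Euc d × (ℝ × Torus d) =>
      ENNReal.ofReal (gauss 1 q.1 * max (inner ℝ (ν q.2) q.1) 0) := by
    have h1 : Measurable fun q : Euc d × (ℝ × Torus d) => gauss 1 q.1 :=
      (continuous_gauss 1).measurable.comp measurable_fst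
    fun_prop
  rw [lintegral_prod_symm _ hm.aemeasurable, ← lintegral_const]
  refine lintegral_congr_ae ?_
  filter_upwards [hν1] with p hp using lintegral_gauss_mul_inner hp

/-- Fubini and `energy_eq`: the Gaussian-weighted jump mass is exactly the time-integrated energy,
so statements on jump measures translate into statements on energies. -/
theorem lintegral_prod_inJump {u : ℝ × Torus d → ℝ} {h : ℝ} (hh : 0 < h) (hm : Measurable u)
    (h01 : ∀ p, u p ∈ Set.Icc (0 : ℝ) 1) :
    ∫⁻ q, ENNReal.ofReal (gauss 1 q.1 * inJump h u q.1 q.2) ∂(volume.prod (spaceTime d T)) =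
      ENNReal.ofReal (∫ t in Set.Ioo 0 T, energy h (fun x => u (t, x))) := by
  have hgm : Measurable fun q : Euc d × (ℝ × Torus d) => gauss 1 q.1 :=
    (continuous_gauss 1).measurable.comp measurable_fst
  have hint : Integrable (fun q : Euc d × (ℝ × Torus d) => gauss 1 q.1 * inJump h u q.1 q.2)
      (volume.prod (spaceTime d T)) := by
    have h1 : Integrable (fun q : Euc d × (ℝ × Torus d) => gauss 1 q.1 * (1 / Real.sqrt h))
        (volume.prod (spaceTime d T)) := integrable_gauss_one.mul_prod (integrable_const _)
    refine h1.mono' (hgm.mul (measurable_uncurry_inJump hm)).aestronglyMeasurable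
      (Eventually.of_forall fun q => ?_)
    rw [Real.norm_of_nonneg (mul_nonneg (gauss_nonneg _ _) (inJump_nonneg h01 _ _))]
    apply mul_le_mul_of_nonneg_left _ (gauss_nonneg _ _)
    exact mul_le_of_le_one_right (by positivity)
      (mul_mem_Icc (one_sub_mem_Icc (h01 _)) (h01 _)).2
  rw [← ofReal_integral_eq_lintegral_ofReal hint (Eventually.of_forall fun q =>
    mul_nonneg (gauss_nonneg _ _) (inJump_nonneg h01 _ _)), integral_prod _ hint]
  congr 1
  have h2 : ∀ z : Euc d, ∫ p, gauss 1 z * inJump h u z p ∂(spaceTime d T) =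
      ∫ t in Set.Ioo 0 T, gauss 1 z *
        (1 / Real.sqrt h * defect (fun x => u (t, x)) (proj (Real.sqrt h • z))) := by
    intro z
    have := setIntegral_inJump (T := T) (h := h) hm h01 z Set.univ
    simp only [Set.univ_prod_univ, Measure.restrict_univ] at this
    rw [integral_const_mul, this, ← integral_const_mul]
  simp_rw [h2]
  rw [integral_integral_swap]
  · refine integral_congr_ae (Eventually.of_forall fun t => ?_)
    simp only
    rw [energy_eq (v := fun x => u (t, x)) (by fun_prop) (fun x => h01 _) hh, ← integral_const_mul]
    congr 1; funext z; ring
  · have h1 : Integrable (fun q : Euc d × ℝ => gauss 1 q.1 * (1 / Real.sqrt h))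
        (volume.prod (volume.restrict (Set.Ioo 0 T))) :=
      integrable_gauss_one.mul_prod (integrable_const _)
    refine h1.mono' (Measurable.aestronglyMeasurable ?_) (Eventually.of_forall fun q => ?_)
    · have hd : Measurable fun q : Euc d × ℝ =>
          defect (fun x => u (q.2, x)) (proj (Real.sqrt h • q.1)) := by
        have : Measurable (Function.uncurry fun (q : Euc d × ℝ) (x : Torus d) =>
            u (q.2, x) * (1 - u (q.2, x - proj (Real.sqrt h • q.1)))) := by
          unfold Function.uncurry; fun_prop
        exact (this.stronglyMeasurable.integral_prod_right'
          (ν := (volume : Measure (Torus d)))).measurable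
      have hg2 : Measurable fun q : Euc d × ℝ => gauss 1 q.1 :=
        (continuous_gauss 1).measurable.comp measurable_fst
      exact hg2.mul (hd.const_mul _)
    · have hmt : Measurable fun x => u (q.2, x) := by fun_prop
      have h3 := defect_nonneg (v := fun x => u (q.2, x)) (fun x => h01 _)
        (proj (Real.sqrt h • q.1))
      have h4 := defect_le_one hmt (fun x => h01 _) (proj (Real.sqrt h • q.1))
      simp only [Function.uncurry]
      rw [Real.norm_of_nonneg (mul_nonneg (gauss_nonneg _ _) (mul_nonneg (by positivity) h3))]
      apply mul_le_mul_of_nonneg_left _ (gauss_nonneg _ _)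
      exact mul_le_of_le_one_right (by positivity) h4

end LscInSpace

end

/-! ### From lower semicontinuity and convergence of mass to weak convergence. -/

section

variable {d : ℕ} {T : ℝ}

/-- Weak convergence from lower semicontinuity and convergence of the total mass, for test functions
dominated by a function `P` with bounded second moments. -/
theorem tendsto_integral_of_lsc {Y : Type*} [MeasurableSpace Y] {m : ℕ → Measure Y} {M : Measure Y}
    [IsFiniteMeasure M] {A : (Y → ℝ) → Prop}
    (hL : ∀ W, A W → (∀ q, 0 ≤ W q) →
      ∫⁻ q, ENNReal.ofReal (W q) ∂M ≤ liminf (fun k => ∫⁻ q, ENNReal.ofReal (W q) ∂(m k)) atTop)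
    (hM : limsup (fun k => m k Set.univ) atTop ≤ M Set.univ) {P ζ : Y → ℝ} (hP : Measurable P)
    (hζ : Measurable ζ) (hP0 : ∀ q, 0 ≤ P q) (hζP : ∀ q, |ζ q| ≤ P q)
    (hA1 : ∀ R : ℝ, A fun q => R - min (P q) R) (hA2 : A fun q => P q + ζ q)
    (hA3 : A fun q => P q - ζ q) (hPM : Integrable P M) {B : ℝ}
    (hB : ∀ᶠ k in atTop, Integrable (fun q => P q ^ 2) (m k) ∧ ∫ q, P q ^ 2 ∂(m k) ≤ B) :
    Tendsto (fun k => ∫ q, ζ q ∂(m k)) atTop (𝓝 (∫ q, ζ q ∂M)) := by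
  -- The lower semicontinuity inequality restated for real integrals, with an error ε for large k.
  have hR : ∀ W, A W → (∀ q, 0 ≤ W q) → Integrable W M → (∀ᶠ k in atTop, Integrable W (m k)) →
      ∀ ε > 0, ∀ᶠ k in atTop, ∫ q, W q ∂M - ε ≤ ∫ q, W q ∂(m k) := by
    intro W hAW hW0 hWM hWk ε hε
    rcases le_or_gt (∫ q, W q ∂M - ε) 0 with hle | hgt
    · exact Eventually.of_forall fun k => hle.trans (integral_nonneg hW0)
    have h1 := hL W hAW hW0
    rw [← ofReal_integral_eq_lintegral_ofReal hWM (Eventually.of_forall hW0)] at h1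
    have h2 : ENNReal.ofReal (∫ q, W q ∂M - ε) < ENNReal.ofReal (∫ q, W q ∂M) :=
      (ENNReal.ofReal_lt_ofReal_iff (by linarith)).2 (by linarith)
    filter_upwards [eventually_lt_of_lt_liminf (h2.trans_le h1), hWk] with k hk hki
    rw [← ofReal_integral_eq_lintegral_ofReal hki (Eventually.of_forall hW0)] at hk
    exact (ENNReal.lt_ofReal_iff_toReal_lt ENNReal.ofReal_ne_top).1 hk |>.le.trans' (by
      rw [ENNReal.toReal_ofReal hgt.le])
  have hmass : ∀ ε > 0, ∀ᶠ k in atTop, IsFiniteMeasure (m k) ∧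
      (m k).real Set.univ ≤ M.real Set.univ + ε := by
    intro ε hε
    have h1 : limsup (fun k => m k Set.univ) atTop < M Set.univ + ENNReal.ofReal ε :=
      hM.trans_lt (ENNReal.lt_add_right (measure_ne_top _ _) (by simpa using hε))
    filter_upwards [eventually_lt_of_limsup_lt h1] with k hk
    refine ⟨⟨hk.trans (by finiteness)⟩, ?_⟩
    have h2 := ENNReal.toReal_mono (by finiteness) hk.le
    rwa [ENNReal.toReal_add (by finiteness) (by finiteness), ENNReal.toReal_ofReal hε.le] at h2
  have hPk : ∀ᶠ k in atTop, Integrable P (m k) := by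
    filter_upwards [hB, hmass 1 one_pos] with k hk hfin
    have := hfin.1
    refine ((integrable_const (1 : ℝ)).add hk.1).mono' hP.aestronglyMeasurable
      (Eventually.of_forall fun q => ?_)
    rw [Real.norm_of_nonneg (hP0 q)]
    simp only [Pi.add_apply]
    nlinarith [sq_nonneg (P q - 1), hP0 q]
  have hdom : ∀ (n : Measure Y), Integrable P n → Integrable ζ n := fun n hn =>
    hn.mono' hζ.aestronglyMeasurable (Eventually.of_forall hζP)
  have hmin : ∀ (n : Measure Y) (R : ℝ), 0 ≤ R → Integrable P n →
      Integrable (fun q => min (P q) R) n := fun n R hR0 hn =>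
    hn.mono' (hP.min measurable_const).aestronglyMeasurable (Eventually.of_forall fun q => by
      rw [Real.norm_of_nonneg (le_min (hP0 q) hR0)]; exact min_le_left _ _)
  rw [Metric.tendsto_atTop']
  intro ε hε
  set δ := ε / 4
  have hδ : 0 < δ := by positivity
  -- With this truncation level, the second moment bound makes the part of P above R contribute at
  -- most B/R ≤ δ.
  set R := |B| / δ + 1
  have hR0 : 0 < R := by positivity
  have hBR : B / R ≤ δ := by
    rw [div_le_iff₀ hR0]
    have h1 : δ * R = |B| + δ := by simp only [R]; field_simp
    rw [h1]; linarith [le_abs_self B]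
  have hcut0 : ∀ q, 0 ≤ R - min (P q) R := fun q => by linarith [min_le_right (P q) R]
  -- Lower semicontinuity for R - min(P, R), combined with the upper bound on the total mass, is an
  -- upper bound for the integral of min(P, R). Choosing both errors as δ/(R + 1) makes R times the
  -- first plus the second equal to δ.
  have e1 := hR _ (hA1 R) hcut0 ((integrable_const R).sub (hmin M R hR0.le hPM))
    (by
      filter_upwards [hPk, hmass 1 one_pos] with k hk hfin
      have := hfin.1
      exact (integrable_const R).sub (hmin (m k) R hR0.le hk)) (δ / (R + 1)) (by positivity)
  have e2 := hR _ hA2 (fun q => by linarith [neg_abs_le (ζ q), hζP q]) (hPM.add (hdom M hPM))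
    (hPk.mono fun k hk => hk.add (hdom _ hk)) δ hδ
  have e3 := hR _ hA3 (fun q => by linarith [le_abs_self (ζ q), hζP q]) (hPM.sub (hdom M hPM))
    (hPk.mono fun k hk => hk.sub (hdom _ hk)) δ hδ
  obtain ⟨N, hN⟩ := eventually_atTop.1 (e1.and (e2.and (e3.and (hPk.and
    (hB.and (hmass (δ / (R + 1)) (by positivity)))))))
  -- Altogether ∫ P exceeds its limit by at most 2δ; subtracting this from the lower bounds for P ±
  -- ζ leaves an error of at most 3δ < ε for ζ.
  refine ⟨N, fun k hk => ?_⟩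
  obtain ⟨h1, h2, h3, hPi, ⟨hP2, hP2B⟩, hfin, hmk⟩ := hN k hk.le
  rw [integral_add hPi (hdom _ hPi), integral_add hPM (hdom _ hPM)] at h2
  rw [integral_sub hPi (hdom _ hPi), integral_sub hPM (hdom _ hPM)] at h3
  rw [integral_sub (integrable_const R) (hmin _ R hR0.le hPi),
    integral_sub (integrable_const R) (hmin _ R hR0.le hPM), integral_const, integral_const,
    smul_eq_mul, smul_eq_mul] at h1
  have h4 : ∫ q, P q ∂(m k) ≤ ∫ q, min (P q) R ∂(m k) + B / R := by
    have : ∫ q, P q ∂(m k) ≤ ∫ q, (min (P q) R + P q ^ 2 / R) ∂(m k) := by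
      refine integral_mono hPi ((hmin _ R hR0.le hPi).add (hP2.div_const R)) fun q => ?_
      simp only
      rcases le_total (P q) R with h | h
      · rw [min_eq_left h]
        have : 0 ≤ P q ^ 2 / R := by positivity
        linarith
      · rw [min_eq_right h]
        have : P q ≤ P q ^ 2 / R := by
          rw [le_div_iff₀ hR0, sq]
          exact mul_le_mul_of_nonneg_left h (hP0 q)
        linarith
    rw [integral_add (hmin _ R hR0.le hPi) (hP2.div_const R), integral_div] at this
    refine this.trans ?_
    gcongr
  have h5 : ∫ q, min (P q) R ∂M ≤ ∫ q, P q ∂M :=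
    integral_mono (hmin _ R hR0.le hPM) hPM fun q => min_le_left _ _
  have h6 : (m k).real Set.univ * R ≤ (M.real Set.univ + δ / (R + 1)) * R := by gcongr
  have h7 : δ / (R + 1) * R + δ / (R + 1) = δ := by field_simp
  have h8 : ∫ q, P q ∂(m k) ≤ ∫ q, P q ∂M + 2 * δ := by linarith
  have h9 : ε = 4 * δ := by simp only [δ]; ring
  rw [Real.dist_eq, abs_lt]
  constructor <;> linarith

/-- Weak convergence of the jump measures, for test functions of polynomial growth. -/
theorem tendsto_integral_jump {μ : Measure (ℝ × Torus d)} [IsFiniteMeasure μ]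
    (hconc : μ (Set.Ioo 0 T ×ˢ Set.univ)ᶜ = 0)
    {f g : ℕ → Euc d → ℝ × Torus d → ℝ} (hfm : ∀ k, Measurable fun q : Euc d × (ℝ × Torus d) =>
      f k q.1 q.2) (hg : ∀ k z, Integrable (g k z) (spaceTime d T))
    (hfb : ∀ k, ∃ b, ∀ z p, f k z p ≤ b) (hf0 : ∀ k z p, 0 ≤ f k z p)
    (hgf : ∀ k z p, g k z p ≤ f k z p) {w : Euc d → ℝ × Torus d → ℝ}
    (hwm : Measurable fun q : Euc d × (ℝ × Torus d) => w q.1 q.2)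
    (hw : ∀ᵐ p ∂μ, ∀ z, |w z p| ≤ ‖z‖)
    (hlim : ∀ (z : Euc d) (η : ℝ × Torus d → ℝ), Continuous η → HasCompactSupport η →
      Tendsto (fun k => ∫ p, η p * g k z p ∂(spaceTime d T)) atTop (𝓝 (∫ p, η p * w z p ∂μ)))
    {B : ℝ} (hB : ∀ᶠ k in atTop, ∀ z, ∫ p, f k z p ∂(spaceTime d T) ≤ B * (1 + ‖z‖))
    (hM : limsup (fun k => ∫⁻ q, ENNReal.ofReal (gauss 1 q.1 * f k q.1 q.2)
        ∂(volume.prod (spaceTime d T))) atTop ≤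
      ∫⁻ q, ENNReal.ofReal (gauss 1 q.1 * max (w q.1 q.2) 0) ∂(volume.prod μ))
    {ζ : Euc d × (ℝ × Torus d) → ℝ} (hζm : Measurable ζ)
    (hζ : ContinuousOn ζ (Set.univ ×ˢ (Set.Ioo 0 T ×ˢ Set.univ))) {C : ℝ} {n : ℕ}
    (hζb : ∀ q, |ζ q| ≤ C * (1 + ‖q.1‖) ^ n) :
    Tendsto (fun k => ∫ q, ζ q * (gauss 1 q.1 * f k q.1 q.2) ∂(volume.prod (spaceTime d T))) atTop
      (𝓝 (∫ q, ζ q * (gauss 1 q.1 * max (w q.1 q.2) 0) ∂(volume.prod μ))) := by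
  have hgm : Measurable fun q : Euc d × (ℝ × Torus d) => gauss 1 q.1 :=
    (continuous_gauss 1).measurable.comp measurable_fst
  have hfi : ∀ k z, Integrable (f k z) (spaceTime d T) := fun k z => by
    obtain ⟨b, hb⟩ := hfb k
    refine Integrable.of_bound ((hfm k).comp measurable_prodMk_left).aestronglyMeasurable b
      (Eventually.of_forall fun p => ?_)
    rw [Real.norm_of_nonneg (hf0 k z p)]; exact hb z p
  have hwi : ∀ z, Integrable (w z) μ := fun z =>
    Integrable.of_bound (hwm.comp measurable_prodMk_left).aestronglyMeasurable ‖z‖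
      (hw.mono fun p hp => hp z)
  have hC0 : 0 ≤ C := by
    have h1 := (abs_nonneg _).trans (hζb (0, (0, 0)))
    simpa using h1
  set F : ℕ → Euc d × (ℝ × Torus d) → ℝ := fun k q => gauss 1 q.1 * f k q.1 q.2 with hF
  set F' : Euc d × (ℝ × Torus d) → ℝ := fun q => gauss 1 q.1 * max (w q.1 q.2) 0 with hF'
  have hFm : ∀ k, Measurable (F k) := fun k => hgm.mul (hfm k)
  have hFm' : Measurable F' := hgm.mul (hwm.max measurable_const)
  have hF0 : ∀ k q, 0 ≤ F k q := fun k q => mul_nonneg (gauss_nonneg _ _) (hf0 _ _ _)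
  have hF0' : ∀ q, 0 ≤ F' q := fun q => mul_nonneg (gauss_nonneg _ _) (le_max_right _ _)
  set m : ℕ → Measure (Euc d × (ℝ × Torus d)) := fun k =>
    (volume.prod (spaceTime d T)).withDensity fun q => ENNReal.ofReal (F k q) with hm
  set M : Measure (Euc d × (ℝ × Torus d)) :=
    (volume.prod μ).withDensity fun q => ENNReal.ofReal (F' q) with hMdef
  have hpow : Measurable fun q : Euc d × (ℝ × Torus d) => (1 + ‖q.1‖) := by fun_prop
  have hintk : ∀ k (j : ℕ), Integrable (fun q => (1 + ‖q.1‖) ^ j * F k q)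
      (volume.prod (spaceTime d T)) := by
    intro k j
    obtain ⟨b, hb⟩ := hfb k
    have h1 : Integrable (fun q : Euc d × (ℝ × Torus d) => ((1 + ‖q.1‖) ^ j * gauss 1 q.1) * b)
        (volume.prod (spaceTime d T)) := (integrable_pow_mul_gauss j).mul_prod (integrable_const b)
    refine h1.mono' ((hpow.pow_const j).mul (hFm k)).aestronglyMeasurable
      (Eventually.of_forall fun q => ?_)
    rw [Real.norm_of_nonneg (mul_nonneg (by positivity) (hF0 _ _)), mul_assoc]
    exact mul_le_mul_of_nonneg_left (mul_le_mul_of_nonneg_left (hb _ _) (gauss_nonneg _ _))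
      (by positivity)
  have hint : ∀ j : ℕ, Integrable (fun q => (1 + ‖q.1‖) ^ j * F' q) (volume.prod μ) := by
    intro j
    have h1 : Integrable (fun q : Euc d × (ℝ × Torus d) =>
        ((1 + ‖q.1‖) ^ (j + 1) * gauss 1 q.1) * 1) (volume.prod μ) :=
      (integrable_pow_mul_gauss (j + 1)).mul_prod (integrable_const 1)
    refine h1.mono' ((hpow.pow_const j).mul hFm').aestronglyMeasurable ?_
    filter_upwards [Measure.quasiMeasurePreserving_snd.ae hw] with q hq
    rw [Real.norm_of_nonneg (mul_nonneg (by positivity) (hF0' _))]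
    have h2 : max (w q.1 q.2) 0 ≤ 1 + ‖q.1‖ :=
      max_le (by linarith [le_abs_self (w q.1 q.2), hq q.1]) (by positivity)
    have h3 := gauss_nonneg 1 q.1
    calc (1 + ‖q.1‖) ^ j * F' q ≤ (1 + ‖q.1‖) ^ j * (gauss 1 q.1 * (1 + ‖q.1‖)) := by
          simp only [hF']; gcongr
      _ = _ := by ring
  have hlint : ∀ k (W : Euc d × (ℝ × Torus d) → ℝ), Measurable W → (∀ q, 0 ≤ W q) →
      ∫⁻ q, ENNReal.ofReal (W q) ∂(m k) =
        ∫⁻ q, ENNReal.ofReal (W q * F k q) ∂(volume.prod (spaceTime d T)) := by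
    intro k W hW hW0
    rw [hm, lintegral_withDensity_eq_lintegral_mul _ (hFm k).ennreal_ofReal hW.ennreal_ofReal]
    refine lintegral_congr fun q => ?_
    rw [Pi.mul_apply, mul_comm, ENNReal.ofReal_mul (hW0 q)]
  have hlint' : ∀ (W : Euc d × (ℝ × Torus d) → ℝ), Measurable W → (∀ q, 0 ≤ W q) →
      ∫⁻ q, ENNReal.ofReal (W q) ∂M = ∫⁻ q, ENNReal.ofReal (W q * F' q) ∂(volume.prod μ) := by
    intro W hW hW0
    rw [hMdef, lintegral_withDensity_eq_lintegral_mul _ hFm'.ennreal_ofReal hW.ennreal_ofReal]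
    refine lintegral_congr fun q => ?_
    rw [Pi.mul_apply, mul_comm, ENNReal.ofReal_mul (hW0 q)]
  have hmi : ∀ k (W : Euc d × (ℝ × Torus d) → ℝ), ∫ q, W q ∂(m k) =
      ∫ q, W q * F k q ∂(volume.prod (spaceTime d T)) := by
    intro k W
    rw [hm, integral_withDensity_eq_integral_toReal_smul (hFm k).ennreal_ofReal (by simp)]
    refine integral_congr_ae (Eventually.of_forall fun q => ?_)
    simp only [ENNReal.toReal_ofReal (hF0 k q), smul_eq_mul, mul_comm]
  have hMi : ∀ (W : Euc d × (ℝ × Torus d) → ℝ), ∫ q, W q ∂M =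
      ∫ q, W q * F' q ∂(volume.prod μ) := by
    intro W
    rw [hMdef, integral_withDensity_eq_integral_toReal_smul hFm'.ennreal_ofReal (by simp)]
    refine integral_congr_ae (Eventually.of_forall fun q => ?_)
    simp only [ENNReal.toReal_ofReal (hF0' q), smul_eq_mul, mul_comm]
  have hmin : ∀ k (W : Euc d × (ℝ × Torus d) → ℝ),
      Integrable (fun q => W q * F k q) (volume.prod (spaceTime d T)) → Integrable W (m k) := by
    intro k W hW
    rw [hm, integrable_withDensity_iff_integrable_smul' (hFm k).ennreal_ofReal (by simp)]
    refine hW.congr (Eventually.of_forall fun q => ?_)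
    simp only [ENNReal.toReal_ofReal (hF0 k q), smul_eq_mul, mul_comm]
  have hMin : ∀ (W : Euc d × (ℝ × Torus d) → ℝ),
      Integrable (fun q => W q * F' q) (volume.prod μ) → Integrable W M := by
    intro W hW
    rw [hMdef, integrable_withDensity_iff_integrable_smul' hFm'.ennreal_ofReal (by simp)]
    refine hW.congr (Eventually.of_forall fun q => ?_)
    simp only [ENNReal.toReal_ofReal (hF0' q), smul_eq_mul, mul_comm]
  have hMfin : IsFiniteMeasure M := isFiniteMeasure_withDensity_ofReal (by simpa using (hint 0).2)
  -- The polynomial majorant of ζ. The bound on its second moment follows from the Gaussian moments,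
  -- since the jump masses grow at most linearly in z.
  set P : Euc d × (ℝ × Torus d) → ℝ := fun q => C * (1 + ‖q.1‖) ^ n with hP
  have hPc : Continuous P := by rw [hP]; fun_prop
  have hgoal := tendsto_integral_of_lsc (m := m) (M := M) (ζ := ζ) (P := P)
    (A := fun W => Measurable W ∧ ContinuousOn W (Set.univ ×ˢ (Set.Ioo 0 T ×ˢ Set.univ)))
    (B := C ^ 2 * ∫ z : Euc d, (1 + ‖z‖) ^ (2 * n) * gauss 1 z * (B * (1 + ‖z‖)))
    (by
      rintro W ⟨hW, hWc⟩ hW0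
      rw [hlint' W hW hW0]
      simp_rw [fun k => hlint k W hW hW0]
      exact lintegral_prod_le_liminf hconc hfm hg hfi hf0 hgf hwm hwi hlim hW hW0 hWc)
    (by
      simp only [hm, hMdef, withDensity_apply _ MeasurableSet.univ, Measure.restrict_univ]
      exact hM)
    hPc.measurable hζm (fun q => by positivity) hζb
    (fun R => ⟨by fun_prop, by fun_prop⟩) ⟨hPc.measurable.add hζm, hPc.continuousOn.add hζ⟩
    ⟨hPc.measurable.sub hζm, hPc.continuousOn.sub hζ⟩
    (hMin P (by simpa [hP, mul_assoc] using (hint n).const_mul C))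
    (by
      filter_upwards [hB] with k hk
      have hPF : ∀ q, P q ^ 2 * F k q = C ^ 2 * ((1 + ‖q.1‖) ^ (2 * n) * F k q) := fun q => by
        simp only [hP]; ring
      refine ⟨hmin k _ ?_, ?_⟩
      · simp_rw [hPF]
        exact (hintk k (2 * n)).const_mul _
      · rw [hmi]
        simp_rw [hPF]
        rw [integral_const_mul]
        gcongr
        rw [integral_prod _ (hintk k (2 * n))]
        refine integral_mono (hintk k (2 * n)).integral_prod_left ?_ fun z => ?_
        · have := (integrable_pow_mul_gauss (d := d) (2 * n + 1)).const_mul B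
          refine this.congr (Eventually.of_forall fun z => ?_)
          simp only; ring
        · simp only [hF, ← mul_assoc]
          rw [integral_const_mul, mul_assoc _ B]
          exact mul_le_mul_of_nonneg_left (hk z)
            (mul_nonneg (by positivity) (gauss_nonneg _ _)))
  simp_rw [hmi, hMi] at hgoal
  exact hgoal

/-- Competitors satisfy |ξ| ≤ 1 and |ν| = 1 almost everywhere. This single inequality suffices to
turn the energy assumption of part ii) into an upper bound by c₀ times the mass of μ. -/
theorem IsPolarGradient.totalVariation_le {χ : ℝ → Torus d → ℝ} {μ : Measure (ℝ × Torus d)}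
    {ν : ℝ × Torus d → Euc d} (h : IsPolarGradient T χ μ ν) : totalVariation T χ ≤ μ Set.univ := by
  have := h.finite
  refine iSup_le fun ξ => iSup_le fun hξ => iSup_le fun hb => ?_
  rw [h.integral_eq ξ hξ, ← ofReal_measureReal]
  refine ENNReal.ofReal_le_ofReal ((neg_le_abs _).trans ?_)
  rw [← Real.norm_eq_abs, ← one_mul (μ.real Set.univ)]
  refine norm_integral_le_of_norm_le_const ?_
  filter_upwards [h.unit] with p hp
  calc ‖inner ℝ (ξ p.1 p.2) (ν p)‖ ≤ ‖ξ p.1 p.2‖ * ‖ν p‖ := norm_inner_le_norm _ _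
    _ ≤ 1 := by rw [hp, mul_one]; exact hb _ _

/-! ### The energy inequality and convergence of the jump measures. -/

section Main

variable {h : ℕ → ℝ} {u : ℕ → ℝ × Torus d → ℝ} {μ : Measure (ℝ × Torus d)}
  {ν : ℝ × Torus d → Euc d}

theorem measurable_inner_uncurry (hν : Measurable ν) :
    Measurable fun q : Euc d × (ℝ × Torus d) => inner ℝ (ν q.2) q.1 := by
  fun_prop

theorem inJump_lim_of_outJump_lim
    (hlim : ∀ (z : Euc d) (η : ℝ × Torus d → ℝ), Continuous η →
        HasCompactSupport η → Tendsto (fun k => ∫ p, η p *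
          (outJump (h k) (u k) z p - inJump (h k) (u k) z p) ∂(spaceTime d T)) atTop
          (𝓝 (∫ p, η p * inner ℝ (ν p) z ∂μ))) (z : Euc d) (η : ℝ × Torus d → ℝ)
    (hη : Continuous η) (hηc : HasCompactSupport η) : Tendsto (fun k => ∫ p, η p *
          (inJump (h k) (u k) z p - outJump (h k) (u k) z p) ∂(spaceTime d T)) atTop
          (𝓝 (∫ p, η p * -inner ℝ (ν p) z ∂μ)) := by
  have h1 := (hlim z η hη hηc).neg
  simp_rw [← integral_neg, ← mul_neg, neg_sub] at h1
  exact h1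

/-- Lower semicontinuity of the energy. -/
theorem c₀_mul_le_liminf_energy (hpos : ∀ k, 0 < h k) (hm : ∀ k, Measurable (u k))
    (h01 : ∀ k p, u k p ∈ Set.Icc (0 : ℝ) 1) {χ : ℝ → Torus d → ℝ} (hP : IsPolarGradient T χ μ ν)
    (hlim : ∀ (z : Euc d) (η : ℝ × Torus d → ℝ), Continuous η →
        HasCompactSupport η → Tendsto (fun k => ∫ p, η p *
          (outJump (h k) (u k) z p - inJump (h k) (u k) z p) ∂(spaceTime d T)) atTop
          (𝓝 (∫ p, η p * inner ℝ (ν p) z ∂μ))) :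
    ENNReal.ofReal c₀ * μ Set.univ ≤ liminf (fun k => ENNReal.ofReal
      (∫ t in Set.Ioo 0 T, energy (h k) (fun x => u k (t, x)))) atTop := by
  have := hP.finite
  have hν := hP.measurable
  have hw : ∀ z, Integrable (fun p => -inner ℝ (ν p) z) μ := fun z => by
    refine Integrable.of_bound (by fun_prop) ‖z‖ ?_
    filter_upwards [hP.unit] with p hp
    simpa [hp] using abs_real_inner_le_norm (ν p) z
  have h1 := lintegral_prod_le_liminf hP.concentrated
    (f := fun k => inJump (h k) (u k)) (g := fun k z p => inJump (h k) (u k) z p -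
      outJump (h k) (u k) z p) (w := fun z p => -inner ℝ (ν p) z) (Φ := fun _ => 1)
    (fun k => measurable_uncurry_inJump (hm k))
    (fun k z => (integrable_inJump (hm k) (h01 k) z).sub (integrable_outJump (hm k) (h01 k) z))
    (fun k z => integrable_inJump (hm k) (h01 k) z) (fun k z p => inJump_nonneg (h01 k) z p)
    (fun k z p => by linarith [outJump_nonneg (h := h k) (h01 k) z p])
    (measurable_inner_uncurry hν).neg hw
    (inJump_lim_of_outJump_lim hlim) measurable_const (fun _ => zero_le_one) continuousOn_const
  simp only [one_mul] at h1
  simp_rw [fun k => lintegral_prod_inJump (T := T) (hpos k) (hm k) (h01 k)] at h1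
  have h2 := lintegral_prod_gauss_posPart (μ := μ) (ν := fun p => -ν p) hν.neg
    (hP.unit.mono fun p hp => by rw [norm_neg, hp])
  simp only [inner_neg_left] at h2
  rwa [h2] at h1

/-- For each shift the two jump densities have the same total mass, by translation invariance. -/
theorem lintegral_prod_outJump {u : ℝ × Torus d → ℝ} {h : ℝ} (hh : 0 < h) (hm : Measurable u)
    (h01 : ∀ p, u p ∈ Set.Icc (0 : ℝ) 1) :
    ∫⁻ q, ENNReal.ofReal (gauss 1 q.1 * outJump h u q.1 q.2) ∂(volume.prod (spaceTime d T)) =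
      ENNReal.ofReal (∫ t in Set.Ioo 0 T, energy h (fun x => u (t, x))) := by
  have hgm : Measurable fun q : Euc d × (ℝ × Torus d) => gauss 1 q.1 :=
    (continuous_gauss 1).measurable.comp measurable_fst
  have e1 := lintegral_prod (μ := (volume : Measure (Euc d))) (ν := spaceTime d T) _
    (hgm.mul (measurable_uncurry_outJump (h := h) hm)).ennreal_ofReal.aemeasurable
  have e2 := lintegral_prod (μ := (volume : Measure (Euc d))) (ν := spaceTime d T) _
    (hgm.mul (measurable_uncurry_inJump (h := h) hm)).ennreal_ofReal.aemeasurable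
  simp only [Pi.mul_apply] at e1 e2
  rw [← lintegral_prod_inJump hh hm h01, e1, e2]
  refine lintegral_congr fun z => ?_
  rw [← ofReal_integral_eq_lintegral_ofReal ((integrable_outJump hm h01 z).const_mul _)
      (Eventually.of_forall fun p => mul_nonneg (gauss_nonneg _ _) (outJump_nonneg h01 _ _)),
    ← ofReal_integral_eq_lintegral_ofReal ((integrable_inJump hm h01 z).const_mul _)
      (Eventually.of_forall fun p => mul_nonneg (gauss_nonneg _ _) (inJump_nonneg h01 _ _)),
    integral_const_mul, integral_const_mul, integral_outJump_eq hm h01]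

theorem jump_le {a b h : ℝ} (ha : a ∈ Set.Icc (0 : ℝ) 1) (hb : b ∈ Set.Icc (0 : ℝ) 1) :
    1 / Real.sqrt h * (a * b) ≤ 1 / Real.sqrt h :=
  mul_le_of_le_one_right (by positivity) (mul_mem_Icc ha hb).2

/-- Convergence of the jump measures under convergence of the energies. -/
theorem tendsto_jump_of_limsup_energy_le (hpos : ∀ k, 0 < h k) (hm : ∀ k, Measurable (u k))
    (h01 : ∀ k p, u k p ∈ Set.Icc (0 : ℝ) 1) {χ : ℝ → Torus d → ℝ} (hP : IsPolarGradient T χ μ ν)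
    (hlim : ∀ (z : Euc d) (η : ℝ × Torus d → ℝ), Continuous η →
        HasCompactSupport η → Tendsto (fun k => ∫ p, η p *
          (outJump (h k) (u k) z p - inJump (h k) (u k) z p) ∂(spaceTime d T)) atTop
          (𝓝 (∫ p, η p * inner ℝ (ν p) z ∂μ)))
    (hM : limsup (fun k => ENNReal.ofReal
      (∫ t in Set.Ioo 0 T, energy (h k) (fun x => u k (t, x)))) atTop ≤
        ENNReal.ofReal c₀ * totalVariation T χ)
    {C₀ : ℝ} (hE : ∀ᶠ k in atTop, ∀ᵐ t ∂(volume.restrict (Set.Ioo 0 T)),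
      energy (h k) (fun x => u k (t, x)) ≤ C₀)
    {ζ : Euc d × (ℝ × Torus d) → ℝ} (hζm : Measurable ζ)
    (hζ : ContinuousOn ζ (Set.univ ×ˢ (Set.Ioo 0 T ×ˢ Set.univ))) {C : ℝ} {n : ℕ}
    (hζb : ∀ q, |ζ q| ≤ C * (1 + ‖q.1‖) ^ n) :
    Tendsto (fun k => ∫ q, ζ q * (gauss 1 q.1 * outJump (h k) (u k) q.1 q.2)
        ∂(volume.prod (spaceTime d T))) atTop
      (𝓝 (∫ q, ζ q * (gauss 1 q.1 * max (inner ℝ (ν q.2) q.1) 0) ∂(volume.prod μ))) ∧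
    Tendsto (fun k => ∫ q, ζ q * (gauss 1 q.1 * inJump (h k) (u k) q.1 q.2)
        ∂(volume.prod (spaceTime d T))) atTop
      (𝓝 (∫ q, ζ q * (gauss 1 q.1 * max (-inner ℝ (ν q.2) q.1) 0) ∂(volume.prod μ))) := by
  have := hP.finite
  have hν := hP.measurable
  obtain ⟨K, hK0, hK⟩ := exists_defect_le d
  set B := K * C₀ * (volume.restrict (Set.Ioo 0 T)).real Set.univ
  have hBout : ∀ᶠ k in atTop, ∀ z, ∫ p, outJump (h k) (u k) z p ∂(spaceTime d T) ≤
      B * (1 + ‖z‖) := by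
    filter_upwards [hE] with k hk z
    have h1 := setIntegral_outJump_le hK0 hK (hm k) (h01 k) (hpos k) hk z Set.univ
    simp only [Set.univ_prod_univ, Measure.restrict_univ] at h1
    refine h1.trans (le_of_eq ?_)
    simp only [B]; ring
  have hBin : ∀ᶠ k in atTop, ∀ z, ∫ p, inJump (h k) (u k) z p ∂(spaceTime d T) ≤
      B * (1 + ‖z‖) := by
    filter_upwards [hBout] with k hk z
    rw [← integral_outJump_eq (hm k) (h01 k)]; exact hk z
  have hM' : limsup (fun k => ENNReal.ofReal
      (∫ t in Set.Ioo 0 T, energy (h k) (fun x => u k (t, x)))) atTop ≤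
        ENNReal.ofReal c₀ * μ Set.univ :=
    hM.trans (by gcongr; exact hP.totalVariation_le)
  have hinner : ∀ᵐ p ∂μ, ∀ z, |inner ℝ (ν p) z| ≤ ‖z‖ := by
    filter_upwards [hP.unit] with p hp z
    simpa [hp] using abs_real_inner_le_norm (ν p) z
  constructor
  · refine tendsto_integral_jump hP.concentrated (f := fun k => outJump (h k) (u k))
      (g := fun k z p => outJump (h k) (u k) z p - inJump (h k) (u k) z p)
      (w := fun z p => inner ℝ (ν p) z)
      (fun k => measurable_uncurry_outJump (hm k))
      (fun k z => (integrable_outJump (hm k) (h01 k) z).sub (integrable_inJump (hm k) (h01 k) z))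
      (fun k => ⟨_, fun z p => jump_le (h01 k _) (one_sub_mem_Icc (h01 k _))⟩)
      (fun k z p => outJump_nonneg (h01 k) z p)
      (fun k z p => by linarith [inJump_nonneg (h := h k) (h01 k) z p])
      (measurable_inner_uncurry hν) hinner hlim hBout ?_ hζm hζ hζb
    simp_rw [fun k => lintegral_prod_outJump (T := T) (hpos k) (hm k) (h01 k)]
    rwa [lintegral_prod_gauss_posPart hν hP.unit]
  -- Exchanging the two densities amounts to replacing ν by -ν, which turns the positive part into
  -- the negative part.
  · refine tendsto_integral_jump hP.concentrated (f := fun k => inJump (h k) (u k))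
      (g := fun k z p => inJump (h k) (u k) z p - outJump (h k) (u k) z p)
      (w := fun z p => -inner ℝ (ν p) z)
      (fun k => measurable_uncurry_inJump (hm k))
      (fun k z => (integrable_inJump (hm k) (h01 k) z).sub (integrable_outJump (hm k) (h01 k) z))
      (fun k => ⟨_, fun z p => jump_le (one_sub_mem_Icc (h01 k _)) (h01 k _)⟩)
      (fun k z p => inJump_nonneg (h01 k) z p)
      (fun k z p => by linarith [outJump_nonneg (h := h k) (h01 k) z p])
      (measurable_inner_uncurry hν).neg
      (hinner.mono fun p hp z => by rw [abs_neg]; exact hp z)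
      (inJump_lim_of_outJump_lim hlim) hBin ?_ hζm hζ hζb
    simp_rw [fun k => lintegral_prod_inJump (T := T) (hpos k) (hm k) (h01 k)]
    have h2 := lintegral_prod_gauss_posPart (μ := μ) (ν := fun p => -ν p) hν.neg
      (hP.unit.mono fun p hp => by rw [norm_neg, hp])
    simp only [inner_neg_left] at h2
    rwa [h2]

end Main

end

section

variable {d : ℕ} {T : ℝ}

/-! ### Independence of the representatives. -/

section Versions

theorem quasiMeasurePreserving_sub_proj :
    Measure.QuasiMeasurePreserving (fun q : Torus d × Euc d => q.1 - proj q.2)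
      (volume.prod volume) volume :=
  QuasiMeasurePreserving.prod_of_left (by fun_prop) (Eventually.of_forall fun z =>
    (measurePreserving_sub_right volume (proj z)).quasiMeasurePreserving)

/-- Each fixed z gives a measure preserving translation, so null sets of space-time pull back to
null sets in (z, t, x). This permits changing representatives in the translated factor too. -/
theorem quasiMeasurePreserving_shift (r : ℝ) :
    Measure.QuasiMeasurePreserving
      (fun q : Euc d × (ℝ × Torus d) => (q.2.1, q.2.2 - proj (r • q.1)))
      (volume.prod (spaceTime d T)) (spaceTime d T) :=
  QuasiMeasurePreserving.prod_of_right (by fun_prop) (Eventually.of_forall fun z =>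
    (measurePreserving_spaceTime_sub T (proj (r • z))).quasiMeasurePreserving)

theorem gaussConv_congr {v v' : Torus d → ℝ} (hv : v =ᵐ[volume] v') (h : ℝ) :
    gaussConv h v =ᵐ[volume] gaussConv h v' := by
  have h1 := Measure.ae_ae_of_ae_prod (quasiMeasurePreserving_sub_proj.ae_eq_comp hv)
  filter_upwards [h1] with x hx
  unfold gaussConv
  refine integral_congr_ae ?_
  filter_upwards [hx] with z hz
  simp only [Function.comp] at hz
  rw [hz]

theorem energy_congr {v v' : Torus d → ℝ} (hv : v =ᵐ[volume] v') (h : ℝ) :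
    energy h v = energy h v' := by
  unfold energy
  congr 1
  refine integral_congr_ae ?_
  filter_upwards [hv, gaussConv_congr hv h] with x h1 h2
  rw [h1, h2]

/-- Truncating a measurable representative to [0,1] enforces the bounds everywhere without changing
it almost everywhere on (0,T). -/
theorem exists_measurable_version {u : ℝ → Torus d → ℝ}
    (hm : AEMeasurable (fun p : ℝ × Torus d => u p.1 p.2) (spaceTime d T))
    (h01 : ∀ t ∈ Set.Ioo 0 T, ∀ x, u t x ∈ Set.Icc (0 : ℝ) 1) :
    ∃ v : ℝ × Torus d → ℝ, Measurable v ∧ (∀ p, v p ∈ Set.Icc (0 : ℝ) 1) ∧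
      (fun p : ℝ × Torus d => u p.1 p.2) =ᵐ[spaceTime d T] v := by
  refine ⟨fun p => max 0 (min 1 (hm.mk _ p)),
    measurable_const.max (measurable_const.min hm.measurable_mk),
    fun p => ⟨le_max_left _ _, max_le zero_le_one (min_le_left _ _)⟩, ?_⟩
  filter_upwards [hm.ae_eq_mk, ae_spaceTime_mem T] with p hp hpT
  have := h01 p.1 hpT p.2
  rw [← hp, min_eq_right this.2, max_eq_right this.1]

theorem ae_energy_eq {u : ℝ → Torus d → ℝ} {v : ℝ × Torus d → ℝ}
    (huv : (fun p : ℝ × Torus d => u p.1 p.2) =ᵐ[spaceTime d T] v) (h : ℝ) :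
    ∀ᵐ t ∂(volume.restrict (Set.Ioo 0 T)), energy h (u t) = energy h (fun x => v (t, x)) := by
  filter_upwards [Measure.ae_ae_of_ae_prod huv] with t ht
  exact energy_congr ht h

end Versions

/-- The gradient of weak limits of sequences of bounded energy, without measurability everywhere. -/
theorem exists_polarGradient_of_weakL1Tendsto {h : ℕ → ℝ} (hpos : ∀ k, 0 < h k)
    (hlim : Tendsto h atTop (𝓝 0)) {u : ℕ → ℝ → Torus d → ℝ}
    (hm : ∀ k, AEMeasurable (fun p : ℝ × Torus d => u k p.1 p.2) (spaceTime d T))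
    (h01 : ∀ k, ∀ t ∈ Set.Ioo 0 T, ∀ x, u k t x ∈ Set.Icc (0 : ℝ) 1) {χ : ℝ → Torus d → ℝ}
    (hw : WeakL1Tendsto T u χ) {C : ℝ}
    (hE : ∀ᶠ k in atTop, ∀ᵐ t ∂(volume.restrict (Set.Ioo 0 T)), energy (h k) (u k t) ≤ C) :
    ∃ (μ : Measure (ℝ × Torus d)) (ν : ℝ × Torus d → Euc d),
      IsPolarGradient T χ μ ν ∧ EquiIntegrableInTime μ ∧
      ENNReal.ofReal c₀ * μ Set.univ ≤ liminf (fun k => ENNReal.ofReal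
        (∫ t in Set.Ioo 0 T, energy (h k) (u k t))) atTop ∧
      (limsup (fun k => ENNReal.ofReal (∫ t in Set.Ioo 0 T, energy (h k) (u k t))) atTop ≤
        ENNReal.ofReal c₀ * totalVariation T χ →
        ∀ ζ : Euc d × (ℝ × Torus d) → ℝ, IsPolyGrowthTest T ζ →
          Tendsto (fun k => ∫ q : Euc d × (ℝ × Torus d),
              ζ q * (gauss 1 q.1 * (1 / Real.sqrt (h k)) * u k q.2.1 q.2.2 *
                (1 - u k q.2.1 (q.2.2 - proj (Real.sqrt (h k) • q.1))))
              ∂(volume.prod (spaceTime d T))) atTop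
            (𝓝 (∫ q : Euc d × (ℝ × Torus d),
              ζ q * (gauss 1 q.1 * max (inner ℝ (ν q.2) q.1) 0) ∂(volume.prod μ))) ∧
          Tendsto (fun k => ∫ q : Euc d × (ℝ × Torus d),
              ζ q * (gauss 1 q.1 * (1 / Real.sqrt (h k)) * (1 - u k q.2.1 q.2.2) *
                u k q.2.1 (q.2.2 - proj (Real.sqrt (h k) • q.1)))
              ∂(volume.prod (spaceTime d T))) atTop
            (𝓝 (∫ q : Euc d × (ℝ × Torus d),
              ζ q * (gauss 1 q.1 * max (-inner ℝ (ν q.2) q.1) 0) ∂(volume.prod μ)))) := by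
  choose v hvm hv01 huv using fun k => exists_measurable_version (hm k) (h01 k)
  have hEv : ∀ k, (∫ t in Set.Ioo 0 T, energy (h k) (u k t)) =
      ∫ t in Set.Ioo 0 T, energy (h k) (fun x => v k (t, x)) := fun k =>
    integral_congr_ae (ae_energy_eq (huv k) (h k))
  have hE' : ∀ᶠ k in atTop, ∀ᵐ t ∂(volume.restrict (Set.Ioo 0 T)),
      energy (h k) (fun x => v k (t, x)) ≤ C := by
    filter_upwards [hE] with k hk
    filter_upwards [hk, ae_energy_eq (huv k) (h k)] with t h1 h2
    rwa [← h2]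
  obtain ⟨μ, ν, hP, hequi, hconv⟩ := exists_polarGradient hpos hlim hvm hv01 hw.1
    (fun g hg => by
      refine (hw.2 g hg).congr fun k => integral_congr_ae ?_
      filter_upwards [huv k] with p hp
      rw [hp]) hE'
  have := hP.finite
  simp_rw [hEv]
  refine ⟨μ, ν, hP, hequi, c₀_mul_le_liminf_energy hpos hvm hv01 hP hconv, ?_⟩
  rintro hsup ζ ⟨hζc, C', n, hζb⟩
  -- Test functions are constrained only for times in (0,T); extending by zero makes them measurable
  -- and bounded by the polynomial everywhere, and changes no integral.
  set slab : Set (Euc d × (ℝ × Torus d)) := Set.univ ×ˢ (Set.Ioo 0 T ×ˢ Set.univ) with hslab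
  have hslabm : MeasurableSet slab :=
    MeasurableSet.univ.prod (measurableSet_Ioo.prod MeasurableSet.univ)
  set ζ' := slab.indicator ζ with hζ'
  have hζm' : Measurable ζ' := by
    classical
    rw [hζ', ← Set.piecewise_eq_indicator]
    exact hζc.measurable_piecewise continuousOn_const hslabm
  have hζc' : ContinuousOn ζ' slab := hζc.congr fun q hq => Set.indicator_of_mem hq _
  have hζb' : ∀ q, |ζ' q| ≤ |C'| * (1 + ‖q.1‖) ^ n := by
    intro q
    by_cases hq : q ∈ slab
    · rw [hζ', Set.indicator_of_mem hq]
      refine (hζb q.1 q.2.1 hq.2.1 q.2.2).trans ?_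
      gcongr
      exact le_abs_self _
    · rw [hζ', Set.indicator_of_notMem hq, abs_zero]; positivity
  have hconv2 := tendsto_jump_of_limsup_energy_le hpos hvm hv01 hP hconv hsup hE' hζm' hζc' hζb'
  have hμae : ∀ᵐ q ∂((volume : Measure (Euc d)).prod μ), ζ' q = ζ q := by
    have h1 : ∀ᵐ p ∂μ, p.1 ∈ Set.Ioo 0 T := by
      rw [ae_iff]
      refine measure_mono_null (fun p hp => ?_) hP.concentrated
      simpa using hp
    filter_upwards [Measure.quasiMeasurePreserving_snd.ae h1] with q hq
    exact Set.indicator_of_mem (show q ∈ slab from ⟨trivial, hq, trivial⟩) _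
  have hSae : ∀ᵐ q ∂((volume : Measure (Euc d)).prod (spaceTime d T)), ζ' q = ζ q := by
    filter_upwards [Measure.quasiMeasurePreserving_snd.ae (ae_spaceTime_mem T)] with q hq
    exact Set.indicator_of_mem (show q ∈ slab from ⟨trivial, hq, trivial⟩) _
  have hu1 : ∀ k, ∀ᵐ q ∂((volume : Measure (Euc d)).prod (spaceTime d T)),
      u k q.2.1 q.2.2 = v k q.2 := fun k => Measure.quasiMeasurePreserving_snd.ae (huv k)
  have hu2 : ∀ k, ∀ᵐ q ∂((volume : Measure (Euc d)).prod (spaceTime d T)),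
      u k q.2.1 (q.2.2 - proj (Real.sqrt (h k) • q.1)) =
        v k (q.2.1, q.2.2 - proj (Real.sqrt (h k) • q.1)) := fun k =>
    (quasiMeasurePreserving_shift (Real.sqrt (h k))).ae (huv k)
  constructor
  · have e : ∫ q, ζ q * (gauss 1 q.1 * max (inner ℝ (ν q.2) q.1) 0) ∂(volume.prod μ) =
        ∫ q, ζ' q * (gauss 1 q.1 * max (inner ℝ (ν q.2) q.1) 0) ∂(volume.prod μ) :=
      integral_congr_ae (by filter_upwards [hμae] with q hq; rw [hq])
    rw [e]
    refine hconv2.1.congr fun k => integral_congr_ae ?_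
    filter_upwards [hSae, hu1 k, hu2 k] with q h1 h2 h3
    rw [h1, h2, h3]
    simp only [outJump]; ring
  · have e : ∫ q, ζ q * (gauss 1 q.1 * max (-inner ℝ (ν q.2) q.1) 0) ∂(volume.prod μ) =
        ∫ q, ζ' q * (gauss 1 q.1 * max (-inner ℝ (ν q.2) q.1) 0) ∂(volume.prod μ) :=
      integral_congr_ae (by filter_upwards [hμae] with q hq; rw [hq])
    rw [e]
    refine hconv2.2.congr fun k => integral_congr_ae ?_
    filter_upwards [hSae, hu1 k, hu2 k] with q h1 h2 h3
    rw [h1, h2, h3]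
    simp only [inJump]; ring

end

/-! ### Strong L¹ compactness from equicontinuity of translations. -/

section

variable {d : ℕ} {T : ℝ}

/-- Weak sequential compactness of bounded functions on a finite measure space. -/
theorem exists_weak_subseq {X : Type*} [MeasurableSpace X] {S : Measure X} [IsFiniteMeasure S]
    [IsSeparable S] {v : ℕ → X → ℝ} (hm : ∀ k, Measurable (v k))
    (h01 : ∀ k p, v k p ∈ Set.Icc (0 : ℝ) 1) :
    ∃ ψ : ℕ → ℕ, StrictMono ψ ∧ ∃ f : X → ℝ, Measurable f ∧ Integrable f S ∧
      ∀ g : X → ℝ, Measurable g → (∃ B, ∀ x, |g x| ≤ B) →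
        Tendsto (fun k => ∫ x, v (ψ k) x * g x ∂S) atTop (𝓝 (∫ x, f x * g x ∂S)) := by
  have : Fact ((2 : ℝ≥0∞) ≠ ⊤) := ⟨by simp⟩
  have hL : ∀ k, MemLp (v k) 2 S := fun k =>
    MemLp.of_bound (hm k).aestronglyMeasurable 1 (Eventually.of_forall fun p => by
      rw [Real.norm_of_nonneg (h01 k p).1]; exact (h01 k p).2)
  set R : ℝ := (S Set.univ ^ (2 : ℝ≥0∞).toReal⁻¹).toReal
  have hbd : ∀ k, ‖(hL k).toLp (v k)‖ ≤ R := by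
    intro k
    rw [Lp.norm_toLp]
    refine ENNReal.toReal_mono (by finiteness) ?_
    have := eLpNorm_le_of_ae_bound (p := 2) (μ := S) (f := v k) (C := 1)
      (Eventually.of_forall fun p => by
        rw [Real.norm_of_nonneg (h01 k p).1]; exact (h01 k p).2)
    simpa using this
  set Λ : ℕ → WeakDual ℝ (Lp ℝ 2 S) := fun k =>
    StrongDual.toWeakDual (InnerProductSpace.toDual ℝ (Lp ℝ 2 S) ((hL k).toLp (v k))) with hΛ
  -- Sequential Banach-Alaoglu in the dual of the separable space L²; the Riesz representation then
  -- returns the limit as a function.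
  obtain ⟨Λ', -, ψ, hψ, hlim⟩ := WeakDual.isSeqCompact_closedBall ℝ (Lp ℝ 2 S) 0 R
    (x := Λ) (fun k => by
      simp only [Set.mem_preimage, mem_closedBall_zero_iff]
      change ‖InnerProductSpace.toDual ℝ (Lp ℝ 2 S) ((hL k).toLp (v k))‖ ≤ R
      rw [LinearIsometryEquiv.norm_map]
      exact hbd k)
  set f₀ : Lp ℝ 2 S := (InnerProductSpace.toDual ℝ (Lp ℝ 2 S)).symm (WeakDual.toStrongDual Λ')
    with hf₀
  have hfm : AEStronglyMeasurable f₀ S := Lp.aestronglyMeasurable f₀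
  have hfi : Integrable f₀ S := (Lp.memLp f₀).integrable (by norm_num)
  refine ⟨ψ, hψ, hfm.mk f₀, hfm.stronglyMeasurable_mk.measurable, hfi.congr hfm.ae_eq_mk, ?_⟩
  rintro g hg ⟨B, hB⟩
  have hgL : MemLp g 2 S := MemLp.of_bound hg.aestronglyMeasurable B (Eventually.of_forall hB)
  have h1 : Tendsto (fun k => Λ (ψ k) (hgL.toLp g)) atTop (𝓝 (Λ' (hgL.toLp g))) :=
    ((WeakDual.eval_continuous (hgL.toLp g)).tendsto Λ').comp hlim
  have h2 : ∀ k, Λ k (hgL.toLp g) = ∫ x, v k x * g x ∂S := by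
    intro k
    change inner ℝ ((hL k).toLp (v k)) (hgL.toLp g) = _
    rw [L2.inner_def]
    refine integral_congr_ae ?_
    filter_upwards [(hL k).coeFn_toLp, hgL.coeFn_toLp] with x e1 e2
    rw [e1, e2]
    simp [mul_comm]
  have h3 : Λ' (hgL.toLp g) = ∫ x, hfm.mk f₀ x * g x ∂S := by
    have : Λ' (hgL.toLp g) = inner ℝ f₀ (hgL.toLp g) := by
      rw [hf₀, InnerProductSpace.toDual_symm_apply]; rfl
    rw [this, L2.inner_def]
    refine integral_congr_ae ?_
    filter_upwards [hfm.ae_eq_mk, hgL.coeFn_toLp] with x e1 e2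
    rw [← e1, e2]
    simp [mul_comm]
  simp_rw [h2, h3] at h1
  exact h1

instance isAddRightInvariant_volume_prod :
    (volume : Measure (ℝ × Torus d)).IsAddRightInvariant := by
  have : (volume : Measure (ℝ × Torus d)).IsAddLeftInvariant := by
    rw [Measure.volume_eq_prod]; exact Measure.prod.instIsAddLeftInvariant
  infer_instance

instance isSeparable_spaceTime : IsSeparable (spaceTime d T) := by
  have : MeasurableSpace.CountablyGenerated (ℝ × Torus d) := inferInstance
  infer_instance

/-- The box of shifts over which functions are averaged. -/
def shiftBox (d : ℕ) (δ : ℝ) : Set (ℝ × Torus d) :=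
  Set.Ioo (-δ) 0 ×ˢ (proj '' Metric.ball (0 : Euc d) δ)

theorem isOpen_shiftBox (δ : ℝ) : IsOpen (shiftBox d δ) :=
  isOpen_Ioo.prod (isOpenQuotientMap_proj.isOpenMap _ Metric.isOpen_ball)

theorem volume_shiftBox_pos {δ : ℝ} (hδ : 0 < δ) : 0 < volume (shiftBox d δ) := by
  refine (isOpen_shiftBox δ).measure_pos _ ⟨(-(δ / 2), 0), ?_, ?_⟩
  · constructor <;> simp <;> linarith
  · exact ⟨0, Metric.mem_ball_self hδ, proj_zero⟩

theorem volume_shiftBox_lt_top (δ : ℝ) : volume (shiftBox d δ) < ⊤ := by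
  unfold shiftBox
  rw [Measure.volume_eq_prod, Measure.prod_prod]
  exact ENNReal.mul_lt_top (by simp) (measure_lt_top _ _)

/-- The integral of `v` over `p + shiftBox d δ`. -/
def boxIntegral (T δ : ℝ) (v : ℝ × Torus d → ℝ) (p : ℝ × Torus d) : ℝ :=
  ∫ p', v p' * (shiftBox d δ).indicator (fun _ => 1) (p' - p) ∂(spaceTime d T)

/-- The box reaches only backwards in time, by less than δ, so for times in (δ, T) the shifted box
stays inside (0,T). -/
theorem boxIntegral_eq {δ : ℝ} (v : ℝ × Torus d → ℝ) {p : ℝ × Torus d} (hp : δ < p.1)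
    (hpT : p.1 < T) : boxIntegral T δ v p = ∫ q in shiftBox d δ, v (p + q) := by
  have hms : MeasurableSet (Set.Ioo 0 T ×ˢ (Set.univ : Set (Torus d))) :=
    measurableSet_Ioo.prod MeasurableSet.univ
  unfold boxIntegral
  rw [spaceTime_eq_restrict, ← integral_indicator hms,
    ← integral_indicator (isOpen_shiftBox δ).measurableSet,
    ← integral_add_right_eq_self (μ := (volume : Measure (ℝ × Torus d))) _ p]
  congr 1; funext q
  by_cases hq : q ∈ shiftBox d δ
  · have h1 : q + p ∈ Set.Ioo 0 T ×ˢ (Set.univ : Set (Torus d)) := by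
      have h2 := hq.1
      refine ⟨⟨?_, ?_⟩, trivial⟩
      · have := h2.1; simp only [Prod.fst_add]; linarith
      · have := h2.2; simp only [Prod.fst_add]; linarith
    rw [Set.indicator_of_mem h1, Set.indicator_of_mem hq, add_sub_cancel_right,
      Set.indicator_of_mem hq, mul_one, add_comm]
  · rw [Set.indicator_of_notMem hq]
    have : (shiftBox d δ).indicator (fun _ => (1 : ℝ)) (q + p - p) = 0 := by
      rw [add_sub_cancel_right, Set.indicator_of_notMem hq]
    by_cases h1 : q + p ∈ Set.Ioo 0 T ×ˢ (Set.univ : Set (Torus d))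
    · rw [Set.indicator_of_mem h1, this, mul_zero]
    · rw [Set.indicator_of_notMem h1]

theorem measurable_boxIntegral {δ : ℝ} {v : ℝ × Torus d → ℝ} (hv : Measurable v) :
    Measurable (boxIntegral T δ v) := by
  have : Measurable (Function.uncurry fun (p p' : ℝ × Torus d) =>
      v p' * (shiftBox d δ).indicator (fun _ => 1) (p' - p)) := by
    have h1 : Measurable ((shiftBox d δ).indicator (fun _ => (1 : ℝ))) :=
      measurable_const.indicator (isOpen_shiftBox δ).measurableSet
    unfold Function.uncurry
    fun_prop
  exact (this.stronglyMeasurable.integral_prod_right' (ν := spaceTime d T)).measurable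

/-- Functions are close to their averages when their translates are close to them. -/
theorem integral_abs_sub_boxIntegral_le {δ ε : ℝ} {v : ℝ × Torus d → ℝ}
    (hm : Measurable v) (h01 : ∀ p, v p ∈ Set.Icc (0 : ℝ) 1)
    (hshift : ∀ s ∈ Set.Icc 0 δ, ∀ w : Euc d, ‖w‖ ≤ δ →
      ∫ p in {p | δ < p.1}, |v p - v (p.1 - s, p.2 - proj w)| ∂(spaceTime d T) ≤ ε) :
    ∫ p in {p | δ < p.1}, |volume.real (shiftBox d δ) * v p - boxIntegral T δ v p|
      ∂(spaceTime d T) ≤ volume.real (shiftBox d δ) * ε := by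
  set Q := shiftBox d δ with hQ
  set Sδ := (spaceTime d T).restrict {p | δ < p.1} with hSδ
  have hQm : MeasurableSet Q := (isOpen_shiftBox δ).measurableSet
  have : IsFiniteMeasure ((volume : Measure (ℝ × Torus d)).restrict Q) :=
    ⟨by rw [Measure.restrict_apply_univ]; exact volume_shiftBox_lt_top δ⟩
  have hae : ∀ᵐ p ∂Sδ, δ < p.1 ∧ p.1 < T := by
    have hms : MeasurableSet {p : ℝ × Torus d | δ < p.1} := measurableSet_lt (by fun_prop) (by fun_prop)
    filter_upwards [ae_restrict_mem hms, ae_restrict_of_ae (ae_spaceTime_mem T)] with p h1 h2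
    exact ⟨h1, h2.2⟩
  have hint : Integrable (Function.uncurry fun (p q : ℝ × Torus d) => |v p - v (p + q)|)
      (Sδ.prod (volume.restrict Q)) := by
    refine Integrable.of_bound (Measurable.aestronglyMeasurable ?_) 1
      (Eventually.of_forall fun x => ?_)
    · unfold Function.uncurry; fun_prop
    · unfold Function.uncurry
      rw [Real.norm_eq_abs, abs_abs, abs_le]
      have h1 := h01 x.1
      have h2 := h01 (x.1 + x.2)
      constructor <;> linarith [h1.1, h1.2, h2.1, h2.2]
  have hpt : ∀ᵐ p ∂Sδ, |volume.real Q * v p - boxIntegral T δ v p| ≤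
      ∫ q in Q, |v p - v (p + q)| := by
    filter_upwards [hae] with p hp
    rw [boxIntegral_eq v hp.1 hp.2, ← hQ]
    have h1 : volume.real Q * v p = ∫ _ in Q, v p := by simp [Measure.real]
    rw [h1, ← integral_sub (integrable_const _)
      (integrable_of_mem_Icc (f := fun q => v (p + q)) (by fun_prop) fun q => h01 _)]
    exact abs_integral_le_integral_abs
  calc ∫ p, |volume.real Q * v p - boxIntegral T δ v p| ∂Sδ
      ≤ ∫ p, (∫ q in Q, |v p - v (p + q)|) ∂Sδ := by
        refine integral_mono_of_nonneg (Eventually.of_forall fun p => abs_nonneg _)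
          hint.integral_prod_left hpt
    _ = ∫ q in Q, (∫ p, |v p - v (p + q)| ∂Sδ) := integral_integral_swap hint
    _ ≤ ∫ _ in Q, ε := by
        refine setIntegral_mono_on hint.integral_prod_right (integrable_const _) hQm fun q hq => ?_
        obtain ⟨h1, w, hw, hwq⟩ := hq
        have h2 := hshift (-q.1) ⟨by linarith [h1.2], by linarith [h1.1]⟩ (-w)
          (by rw [norm_neg]; exact (mem_ball_zero_iff.1 hw).le)
        refine le_trans (le_of_eq ?_) h2
        refine integral_congr_ae (Eventually.of_forall fun p => ?_)
        have h3 : (p.1 - -q.1, p.2 - proj (-w)) = p + q := by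
          have : proj (-w) = -q.2 := by
            rw [← hwq, ← zero_sub, proj_sub, proj_zero, zero_sub]
          rw [this]; ext <;> simp
        simp only [h3]
    _ = _ := by simp [Measure.real]

/-- Compactness in `L¹` from equicontinuity of translations. -/
theorem exists_strong_subseq {v : ℕ → ℝ × Torus d → ℝ} (hm : ∀ k, Measurable (v k))
    (h01 : ∀ k p, v k p ∈ Set.Icc (0 : ℝ) 1) {r : ℕ → ℝ} (hr : Tendsto r atTop (𝓝 0)) {A : ℝ}
    (hA : 0 ≤ A) (hshift : ∀ᶠ k in atTop, ∀ δ > 0, ∀ s ∈ Set.Icc 0 δ, ∀ w : Euc d, ‖w‖ ≤ δ →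
      ∫ p in {p | δ < p.1}, |v k p - v k (p.1 - s, p.2 - proj w)| ∂(spaceTime d T) ≤
        A * (δ + r k)) :
    ∃ ψ : ℕ → ℕ, StrictMono ψ ∧ ∃ f : ℝ × Torus d → ℝ, Integrable f (spaceTime d T) ∧
      Tendsto (fun k => ∫ p, |v (ψ k) p - f p| ∂(spaceTime d T)) atTop (𝓝 0) := by
  set S := spaceTime d T with hS
  obtain ⟨ψ, hψ, f, hfm, hfi, hweak⟩ := exists_weak_subseq (S := S) hm h01
  refine ⟨ψ, hψ, f, hfi, ?_⟩
  set V : ℕ → ℝ × Torus d → ℝ := fun k => v (ψ k) with hV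
  have hVi : ∀ k (n : Measure (ℝ × Torus d)) [IsFiniteMeasure n], Integrable (V k) n :=
    fun k n _ => integrable_of_mem_Icc (hm _) (h01 _)
  have hVV : ∀ k l p, |V k p - V l p| ≤ 1 := fun k l p => by
    have h1 := h01 (ψ k) p
    have h2 := h01 (ψ l) p
    rw [abs_le]
    constructor <;> simp only [hV] <;> linarith [h1.1, h1.2, h2.1, h2.2]
  -- the Cauchy property
  have hcauchy : ∀ ε > 0, ∃ N, ∀ k ≥ N, ∀ l ≥ N, ∫ p, |V k p - V l p| ∂S ≤ ε := by
    intro ε hε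
    -- Replacing both functions by averages costs 4Aδ, the times up to δ cost δ, and the averages
    -- themselves cost ε/4; in total at most 3ε/4.
    set δ := ε / (8 * (A + 1)) with hδdef
    have hδ : 0 < δ := by positivity
    set Q := volume.real (shiftBox d δ) with hQ
    have hQ0 : 0 < Q := ENNReal.toReal_pos (volume_shiftBox_pos hδ).ne'
      (volume_shiftBox_lt_top δ).ne
    have hbm : Measurable ((shiftBox d δ).indicator (fun _ => (1 : ℝ))) :=
      measurable_const.indicator (isOpen_shiftBox δ).measurableSet
    have hind : ∀ q, ‖(shiftBox d δ).indicator (fun _ => (1 : ℝ)) q‖ ≤ 1 := fun q => by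
      by_cases hq : q ∈ shiftBox d δ <;> simp [hq]
    -- At a fixed point p the box average is a pairing with a bounded function, so weak convergence
    -- gives pointwise convergence and domination gives convergence in L¹.
    have hW : Tendsto (fun k => ∫ p, |boxIntegral T δ (V k) p - boxIntegral T δ f p| ∂S) atTop
        (𝓝 0) := by
      have hdc := tendsto_integral_of_dominated_convergence (μ := S)
        (F := fun k p => |boxIntegral T δ (V k) p - boxIntegral T δ f p|) (f := fun _ => 0)
        (fun _ => S.real Set.univ + ∫ p, ‖f p‖ ∂S)
        (fun k => ((measurable_boxIntegral (hm _)).sub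
          (measurable_boxIntegral hfm)).abs.aestronglyMeasurable)
        (integrable_const _)
        (fun k => Eventually.of_forall fun p => by
          rw [Real.norm_eq_abs, abs_abs]
          refine (abs_sub _ _).trans (add_le_add ?_ ?_)
          · rw [← Real.norm_eq_abs, ← one_mul (S.real Set.univ)]
            refine norm_integral_le_of_norm_le_const (Eventually.of_forall fun q => ?_)
            rw [norm_mul, Real.norm_of_nonneg (h01 _ q).1]
            exact mul_le_one₀ (h01 _ q).2 (norm_nonneg _) (hind _)
          · rw [← Real.norm_eq_abs]
            refine norm_integral_le_of_norm_le hfi.norm (Eventually.of_forall fun q => ?_)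
            rw [norm_mul]
            exact mul_le_of_le_one_right (norm_nonneg _) (hind _))
        (Eventually.of_forall fun p => by
          have h1 := hweak (fun p' => (shiftBox d δ).indicator (fun _ => 1) (p' - p))
            (by fun_prop) ⟨1, fun q => hind _⟩
          have h2 := (h1.sub_const (boxIntegral T δ f p)).abs
          have h3 : ∫ x, f x * (shiftBox d δ).indicator (fun _ => 1) (x - p) ∂S =
            boxIntegral T δ f p := rfl
          rw [h3, sub_self, abs_zero] at h2
          exact h2)
      simpa using hdc
    -- From some index on r < δ, so the translation bound A(δ + r) is at most 2Aδ.
    have hψt : Tendsto ψ atTop atTop := hψ.tendsto_atTop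
    have hev := (((hr.comp hψt).eventually (gt_mem_nhds hδ)).and
      ((hψt.eventually hshift).and
        (hW.eventually (gt_mem_nhds (show 0 < Q * ε / 8 by positivity)))))
    obtain ⟨N, hN⟩ := eventually_atTop.1 hev
    have hbox : ∀ k ≥ N, ∫ p in {p | δ < p.1}, |Q * V k p - boxIntegral T δ (V k) p| ∂S ≤
        Q * (A * (2 * δ)) := by
      intro k hk
      obtain ⟨h1, h2, -⟩ := hN k hk
      refine (integral_abs_sub_boxIntegral_le (hm _) (h01 _) (h2 δ hδ)).trans ?_
      gcongr
      simp only [Function.comp] at h1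
      linarith
    refine ⟨N, fun k hk l hl => ?_⟩
    have hms : MeasurableSet {p : ℝ × Torus d | δ < p.1} :=
      measurableSet_lt (by fun_prop) (by fun_prop)
    have hi0 : Integrable (fun p => |V k p - V l p|) S := ((hVi k S).sub (hVi l S)).abs
    rw [← integral_add_compl hms hi0]
    have hsmall : ∫ p in {p | δ < p.1}ᶜ, |V k p - V l p| ∂S ≤ δ := by
      have h1 : ∫ p in {p | δ < p.1}ᶜ, |V k p - V l p| ∂S ≤
          ∫ _ in {p : ℝ × Torus d | δ < p.1}ᶜ, (1 : ℝ) ∂S :=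
        integral_mono hi0.integrableOn (integrable_const _) fun p => hVV k l p
      refine h1.trans ?_
      rw [setIntegral_const, smul_eq_mul, mul_one]
      have h2 : {p : ℝ × Torus d | δ < p.1}ᶜ = Set.Iic δ ×ˢ Set.univ := by ext p; simp
      rw [h2, Measure.real, hS, spaceTime, Measure.prod_prod, Measure.restrict_apply measurableSet_Iic,
        measure_univ, mul_one]
      refine ENNReal.toReal_le_of_le_ofReal hδ.le ?_
      calc volume (Set.Iic δ ∩ Set.Ioo 0 T) ≤ volume (Set.Icc 0 δ) :=
            measure_mono fun t ht => ⟨ht.2.1.le, ht.1⟩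
        _ = ENNReal.ofReal δ := by simp
    have hbi : ∀ k, Integrable (boxIntegral T δ (V k)) S := fun k =>
      Integrable.of_bound (measurable_boxIntegral (hm _)).aestronglyMeasurable (1 * S.real Set.univ)
        (Eventually.of_forall fun p => norm_integral_le_of_norm_le_const
          (Eventually.of_forall fun q => by
            rw [norm_mul, Real.norm_of_nonneg (h01 _ q).1]
            exact mul_le_one₀ (h01 _ q).2 (norm_nonneg _) (hind _)))
    have hfb : Integrable (boxIntegral T δ f) S :=
      Integrable.of_bound (measurable_boxIntegral hfm).aestronglyMeasurable (∫ p, ‖f p‖ ∂S)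
        (Eventually.of_forall fun p => norm_integral_le_of_norm_le hfi.norm
          (Eventually.of_forall fun q => by
            rw [norm_mul]
            exact mul_le_of_le_one_right (norm_nonneg _) (hind _)))
    have hmain : ∫ p in {p | δ < p.1}, Q * |V k p - V l p| ∂S ≤
        Q * (A * (2 * δ)) + Q * (A * (2 * δ)) + (Q * ε / 8 + Q * ε / 8) := by
      have i1 := fun k => (((hVi k S).const_mul Q).sub (hbi k)).abs.integrableOn
        (s := {p | δ < p.1})
      have i2 := fun k => ((hbi k).sub hfb).abs.integrableOn (s := {p | δ < p.1})
      have h1 : ∫ p in {p | δ < p.1}, Q * |V k p - V l p| ∂S ≤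
          ∫ p in {p | δ < p.1}, ((|Q * V k p - boxIntegral T δ (V k) p| +
            |Q * V l p - boxIntegral T δ (V l) p|) +
            (|boxIntegral T δ (V k) p - boxIntegral T δ f p| +
            |boxIntegral T δ (V l) p - boxIntegral T δ f p|)) ∂S := by
        refine integral_mono (hi0.integrableOn.const_mul Q) (((i1 k).add (i1 l)).add
          ((i2 k).add (i2 l))) fun p => ?_
        simp only
        have e : Q * |V k p - V l p| = |Q * V k p - Q * V l p| := by
          rw [← mul_sub, abs_mul, abs_of_pos hQ0]
        rw [e]
        have a1 := abs_sub_le (Q * V k p) (boxIntegral T δ (V k) p) (Q * V l p)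
        have a2 := abs_sub_le (boxIntegral T δ (V k) p) (boxIntegral T δ f p) (Q * V l p)
        have a3 := abs_sub_le (boxIntegral T δ f p) (boxIntegral T δ (V l) p) (Q * V l p)
        rw [abs_sub_comm (boxIntegral T δ f p) (boxIntegral T δ (V l) p),
          abs_sub_comm (boxIntegral T δ (V l) p) (Q * V l p)] at a3
        linarith
      have e1 := integral_add ((i1 k).add (i1 l)) ((i2 k).add (i2 l))
      have e2 := integral_add (i1 k) (i1 l)
      have e3 := integral_add (i2 k) (i2 l)
      simp only [Pi.add_apply, Pi.sub_apply] at e1 e2 e3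
      rw [e1, e2, e3] at h1
      refine h1.trans (add_le_add (add_le_add (hbox k hk) (hbox l hl)) (add_le_add ?_ ?_))
      · refine (setIntegral_le_integral ((hbi k).sub hfb).abs
          (Eventually.of_forall fun p => abs_nonneg _)).trans (hN k hk).2.2.le
      · refine (setIntegral_le_integral ((hbi l).sub hfb).abs
          (Eventually.of_forall fun p => abs_nonneg _)).trans (hN l hl).2.2.le
    rw [integral_const_mul] at hmain
    have h3 : ∫ p in {p | δ < p.1}, |V k p - V l p| ∂S ≤ 4 * A * δ + ε / 4 := by
      have : Q * ∫ p in {p | δ < p.1}, |V k p - V l p| ∂S ≤ Q * (4 * A * δ + ε / 4) := by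
        linarith
      exact le_of_mul_le_mul_left this hQ0
    have h4 : 8 * (A + 1) * δ = ε := by rw [hδdef]; field_simp
    nlinarith [hsmall]
  -- strong convergence, testing weak convergence with the sign of the difference
  rw [Metric.tendsto_atTop]
  intro ε hε
  obtain ⟨N, hN⟩ := hcauchy (ε / 2) (half_pos hε)
  refine ⟨N, fun k hk => ?_⟩
  rw [Real.dist_0_eq_abs, abs_of_nonneg (integral_nonneg fun p => abs_nonneg _)]
  refine lt_of_le_of_lt ?_ (half_lt_self hε)
  set σ : ℝ × Torus d → ℝ := fun p => if f p ≤ V k p then 1 else -1 with hσ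
  have hσm : Measurable σ :=
    Measurable.ite (measurableSet_le hfm (hm _)) measurable_const measurable_const
  have hσ1 : ∀ p, |σ p| ≤ 1 := fun p => by
    by_cases hp : f p ≤ V k p <;> simp [hσ, hp]
  have hσf : ∀ p, |V k p - f p| = V k p * σ p - f p * σ p := fun p => by
    by_cases hp : f p ≤ V k p
    · simp [hσ, hp]
    · simp only [hσ, hp, if_false]
      rw [abs_of_nonpos (by linarith)]; ring
  have hi : ∀ {g : ℝ × Torus d → ℝ}, Integrable g S → Integrable (fun p => g p * σ p) S :=
    fun hg => by
      simpa [mul_comm] using hg.bdd_mul (c := 1) hσm.aestronglyMeasurable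
        (Eventually.of_forall fun p => hσ1 p)
  change ∫ p, |V k p - f p| ∂S ≤ ε / 2
  simp_rw [hσf]
  rw [integral_sub (hi (hVi k S)) (hi hfi)]
  have hlim := (hweak σ hσm ⟨1, hσ1⟩).const_sub (∫ p, V k p * σ p ∂S)
  refine le_of_tendsto hlim ?_
  filter_upwards [eventually_ge_atTop N] with l hl
  refine le_trans ?_ (hN k hk l hl)
  rw [← integral_sub (hi (hVi k S)) (hi (hVi l S))]
  refine integral_mono ((hi (hVi k S)).sub (hi (hVi l S))) ((hVi k S).sub (hVi l S)).abs fun p => ?_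
  change V k p * σ p - V l p * σ p ≤ |V k p - V l p|
  rw [← sub_mul]
  calc (V k p - V l p) * σ p ≤ |(V k p - V l p) * σ p| := le_abs_self _
    _ = |V k p - V l p| * |σ p| := abs_mul _ _
    _ ≤ |V k p - V l p| := mul_le_of_le_one_right (abs_nonneg _) (hσ1 p)

end

section

variable {d : ℕ} {T : ℝ}

/-! ### Gaussian convolution of characteristic functions. -/

section GaussConv

variable {h : ℝ} {v v' : Torus d → ℝ}

theorem measurable_gaussConv (hm : Measurable v) (h : ℝ) : Measurable (gaussConv h v) := by
  have : Measurable (Function.uncurry fun (x : Torus d) (z : Euc d) =>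
      gauss h z * v (x - proj z)) := by
    unfold Function.uncurry
    have := (continuous_gauss (d := d) h).measurable
    fun_prop
  exact (this.stronglyMeasurable.integral_prod_right' (ν := (volume : Measure (Euc d)))).measurable

theorem integrable_gauss_mul_comp (hm : Measurable v) (hv : ∀ x, v x ∈ Set.Icc (0 : ℝ) 1)
    (hh : 0 < h) (x : Torus d) : Integrable (fun z : Euc d => gauss h z * v (x - proj z)) := by
  have := (continuous_gauss (d := d) h).measurable
  refine (integrable_gauss hh).mono' (by fun_prop) (Eventually.of_forall fun z => ?_)
  rw [Real.norm_of_nonneg (mul_nonneg (gauss_nonneg _ _) (hv _).1)]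
  exact mul_le_of_le_one_right (gauss_nonneg _ _) (hv _).2

theorem gaussConv_mem_Icc (hm : Measurable v) (hv : ∀ x, v x ∈ Set.Icc (0 : ℝ) 1) (hh : 0 < h)
    (x : Torus d) : gaussConv h v x ∈ Set.Icc (0 : ℝ) 1 := by
  refine ⟨integral_nonneg fun z => mul_nonneg (gauss_nonneg _ _) (hv _).1, ?_⟩
  rw [← integral_gauss (d := d) hh]
  exact integral_mono (integrable_gauss_mul_comp hm hv hh x) (integrable_gauss hh) fun z =>
    mul_le_of_le_one_right (gauss_nonneg _ _) (hv _).2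

theorem gaussConv_sub (hm : Measurable v) (hv : ∀ x, v x ∈ Set.Icc (0 : ℝ) 1)
    (hm' : Measurable v') (hv' : ∀ x, v' x ∈ Set.Icc (0 : ℝ) 1) (hh : 0 < h) (x : Torus d) :
    gaussConv h (fun y => v y - v' y) x = gaussConv h v x - gaussConv h v' x := by
  unfold gaussConv
  rw [← integral_sub (integrable_gauss_mul_comp hm hv hh x)
    (integrable_gauss_mul_comp hm' hv' hh x)]
  simp_rw [mul_sub]

theorem mem_Icc_of_eq_zero_or_one (h01 : ∀ x, v x = 0 ∨ v x = 1) (x : Torus d) :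
    v x ∈ Set.Icc (0 : ℝ) 1 := by
  rcases h01 x with e | e <;> simp [e]

/-- For values in {0,1}, |a - b| = a(1 - b) + (1 - a)b. This is where the {0,1} constraint turns the
energy bound into an L¹ estimate. -/
theorem integral_abs_sub_translate (hm : Measurable v) (h01 : ∀ x, v x = 0 ∨ v x = 1)
    (y : Torus d) : ∫ x, |v x - v (x - y)| = 2 * defect v y := by
  rw [two_mul_defect hm (mem_Icc_of_eq_zero_or_one h01)]
  congr 1; funext x
  rcases h01 x with e | e <;> rcases h01 (x - y) with e' | e' <;> simp [e, e']

/-- Convolution with the Gaussian displaces characteristic functions by a multiple of `√h`. -/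
theorem integral_abs_sub_gaussConv_le {K C : ℝ}
    (hK : ∀ z : Euc d, defect v (proj (Real.sqrt h • z)) ≤ K * C * Real.sqrt h * (1 + ‖z‖))
    (hm : Measurable v) (h01 : ∀ x, v x = 0 ∨ v x = 1) (hh : 0 < h) :
    ∫ x, |v x - gaussConv (h / 2) v x| ≤
      2 * (K * C * Real.sqrt h) * ∫ z : Euc d, gauss 1 z * (1 + ‖z‖) := by
  have hv := mem_Icc_of_eq_zero_or_one h01
  have hh2 : 0 < h / 2 := half_pos hh
  have hKC : 0 ≤ K * C * Real.sqrt h := by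
    have := (defect_nonneg hv _).trans (hK 0)
    simpa using this
  have hmom : Integrable (fun z : Euc d => gauss 1 z * (1 + ‖z‖)) := by
    simpa [mul_comm] using integrable_pow_mul_gauss (d := d) 1
  have hint : Integrable (Function.uncurry fun (x : Torus d) (z : Euc d) =>
      gauss (h / 2) z * |v x - v (x - proj z)|) (volume.prod volume) := by
    have hg : Integrable (fun q : Torus d × Euc d => (1 : ℝ) * gauss (h / 2) q.2)
        (volume.prod volume) := (integrable_const (1 : ℝ)).mul_prod (integrable_gauss hh2)
    refine hg.mono' ?_ (Eventually.of_forall fun q => ?_)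
    · apply Measurable.aestronglyMeasurable
      unfold Function.uncurry
      have := (continuous_gauss (d := d) (h / 2)).measurable
      fun_prop
    · unfold Function.uncurry
      rw [Real.norm_of_nonneg (mul_nonneg (gauss_nonneg _ _) (abs_nonneg _)), one_mul]
      refine mul_le_of_le_one_right (gauss_nonneg _ _) ?_
      have h1 := hv q.1
      have h2 := hv (q.1 - proj q.2)
      rw [abs_le]
      constructor <;> linarith [h1.1, h1.2, h2.1, h2.2]
  have hpt : ∀ x, |v x - gaussConv (h / 2) v x| ≤
      ∫ z : Euc d, gauss (h / 2) z * |v x - v (x - proj z)| := by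
    intro x
    have h1 : v x = ∫ z : Euc d, gauss (h / 2) z * v x := by
      rw [integral_mul_const, integral_gauss hh2, one_mul]
    unfold gaussConv
    nth_rewrite 1 [h1]
    rw [← integral_sub ((integrable_gauss hh2).mul_const _)
      (integrable_gauss_mul_comp hm hv hh2 x)]
    refine abs_integral_le_integral_abs.trans (le_of_eq ?_)
    congr 1; funext z
    rw [← mul_sub, abs_mul, abs_of_nonneg (gauss_nonneg _ _)]
  have hdm : Measurable (defect v) := measurable_defect hm
  calc ∫ x, |v x - gaussConv (h / 2) v x|
      ≤ ∫ x, ∫ z : Euc d, gauss (h / 2) z * |v x - v (x - proj z)| :=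
        integral_mono_of_nonneg (Eventually.of_forall fun x => abs_nonneg _)
          hint.integral_prod_left (Eventually.of_forall hpt)
    _ = ∫ z : Euc d, ∫ x, gauss (h / 2) z * |v x - v (x - proj z)| := integral_integral_swap hint
    _ = ∫ z : Euc d, gauss (h / 2) z * (2 * defect v (proj z)) := by
        congr 1; funext z
        rw [integral_const_mul, integral_abs_sub_translate hm h01]
    _ = ∫ z : Euc d, gauss 1 z * (2 * defect v (proj (Real.sqrt (h / 2) • z))) :=
        integral_gauss_mul hh2 _
    _ ≤ ∫ z : Euc d, 2 * (K * C * Real.sqrt h) * (gauss 1 z * (1 + ‖z‖)) := by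
        refine integral_mono_of_nonneg (Eventually.of_forall fun z =>
          mul_nonneg (gauss_nonneg _ _) (mul_nonneg zero_le_two (defect_nonneg hv _)))
          (hmom.const_mul _) (Eventually.of_forall fun z => ?_)
        -- The kernel G_{h/2} lives at scale √(h/2); the factor 1/√2 ≤ 1 is absorbed into z, so that
        -- the defect bound at scale √h applies.
        have h1 : Real.sqrt (h / 2) • z = Real.sqrt h • ((Real.sqrt 2)⁻¹ • z) := by
          rw [smul_smul, Real.sqrt_div hh.le, div_eq_mul_inv]
        have h2 : ‖(Real.sqrt 2)⁻¹ • z‖ ≤ ‖z‖ := by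
          rw [norm_smul, Real.norm_of_nonneg (by positivity)]
          refine mul_le_of_le_one_left (norm_nonneg _) (inv_le_one_of_one_le₀ ?_)
          exact Real.one_le_sqrt.2 one_le_two
        have h3 : defect v (proj (Real.sqrt (h / 2) • z)) ≤
            K * C * Real.sqrt h * (1 + ‖z‖) := by
          rw [h1]
          refine (hK _).trans ?_
          gcongr
        have h4 := mul_le_mul_of_nonneg_left h3 (gauss_nonneg 1 z)
        simp only
        linarith
    _ = _ := integral_const_mul _ _

end GaussConv

/-! ### Step functions in time: shifts and chaining. -/

section StepFunctions

variable {h : ℝ}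

/-- The integral over `(0,T)` of the step function with values `F 0, F 1, …` and step size `h`. -/
def stepIntegral (T h : ℝ) (F : ℕ → ℝ) : ℝ := ∫ t in Set.Ioo 0 T, F ⌊t / h⌋₊

theorem integrableOn_step (hh : 0 < h) (F : ℕ → ℝ) :
    IntegrableOn (fun t : ℝ => F ⌊t / h⌋₊) (Set.Ioo 0 T) := by
  refine Measure.integrableOn_of_bounded (M := ∑ i ∈ Finset.range (⌊T / h⌋₊ + 1), |F i|) (by simp)
    (Measurable.aestronglyMeasurable ?_) ?_
  · exact (measurable_from_nat (f := F)).comp (Nat.measurable_floor.comp (by fun_prop))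
  · filter_upwards [ae_restrict_mem measurableSet_Ioo] with t ht
    rw [Real.norm_eq_abs]
    refine Finset.single_le_sum (f := fun i => |F i|) (fun i _ => abs_nonneg _) ?_
    rw [Finset.mem_range, Nat.lt_succ_iff]
    exact Nat.floor_mono (div_le_div_of_nonneg_right ht.2.le hh.le)

theorem stepIntegral_mono (hh : 0 < h) {F G : ℕ → ℝ} (hFG : ∀ n, F n ≤ G n) :
    stepIntegral T h F ≤ stepIntegral T h G :=
  integral_mono (integrableOn_step hh F) (integrableOn_step hh G) fun _ => hFG _

theorem stepIntegral_add (hh : 0 < h) (F G : ℕ → ℝ) :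
    stepIntegral T h (fun n => F n + G n) = stepIntegral T h F + stepIntegral T h G :=
  integral_add (integrableOn_step hh F) (integrableOn_step hh G)

theorem stepIntegral_const_mul (a : ℝ) (F : ℕ → ℝ) :
    stepIntegral T h (fun n => a * F n) = a * stepIntegral T h F :=
  integral_const_mul _ _

theorem stepIntegral_const (hT : 0 < T) (a : ℝ) : stepIntegral T h (fun _ => a) = T * a := by
  simp [stepIntegral, hT.le]

theorem stepIntegral_sum (hh : 0 < h) {r : ℕ} (F : ℕ → ℕ → ℝ) :
    stepIntegral T h (fun n => ∑ j ∈ Finset.range r, F j n) =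
      ∑ j ∈ Finset.range r, stepIntegral T h (F j) :=
  integral_finsetSum _ fun _ _ => integrableOn_step hh _

/-- A shift by j steps is a translation of time by jh. Near the initial time the truncated
subtraction produces the value F 0 = 0, so nothing is added there. -/
theorem stepIntegral_shift_le (hh : 0 < h) {F : ℕ → ℝ} (hF : ∀ n, 0 ≤ F n) (hF0 : F 0 = 0)
    (j : ℕ) : stepIntegral T h (fun n => F (n - j)) ≤ stepIntegral T h F := by
  set Φ : ℝ → ℝ := (Set.Ioo 0 T).indicator fun t => F ⌊t / h⌋₊ with hΦ
  have hΦi : Integrable Φ := (integrable_indicator_iff measurableSet_Ioo).2 (integrableOn_step hh F)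
  have hΦ0 : ∀ t, 0 ≤ Φ t := fun t => Set.indicator_nonneg (fun _ _ => hF _) t
  have h1 : stepIntegral T h F = ∫ t, Φ (t - j * h) := by
    rw [integral_sub_right_eq_self Φ (j * h), hΦ, integral_indicator measurableSet_Ioo]; rfl
  rw [h1]
  refine (setIntegral_mono_on (integrableOn_step hh fun n => F (n - j))
    (hΦi.comp_sub_right (j * h)).integrableOn measurableSet_Ioo fun t ht => ?_).trans
    (setIntegral_le_integral (hΦi.comp_sub_right (j * h)) (Eventually.of_forall fun t => hΦ0 _))
  have h2 : ⌊t / h⌋₊ - j = ⌊(t - j * h) / h⌋₊ := by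
    rw [sub_div, mul_div_cancel_right₀ _ hh.ne', Nat.floor_sub_natCast]
  simp only [h2]
  by_cases h3 : 0 < t - j * h
  · have : 0 ≤ j * h := by positivity
    rw [hΦ, Set.indicator_of_mem (show t - j * h ∈ Set.Ioo 0 T from ⟨h3, by linarith [ht.2]⟩)]
  · rw [Nat.floor_of_nonpos (div_nonpos_of_nonpos_of_nonneg (not_lt.1 h3) hh.le), hF0]
    exact hΦ0 _

/-- A time shift s not aligned with the grid moves the step index by one of two consecutive
integers. -/
theorem floor_sub_div_eq (hh : 0 < h) {s t : ℝ} (hs : 0 ≤ s) (hst : s ≤ t) :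
    ⌊(t - s) / h⌋₊ = ⌊t / h⌋₊ - ⌊s / h⌋₊ ∨ ⌊(t - s) / h⌋₊ = ⌊t / h⌋₊ - (⌊s / h⌋₊ + 1) := by
  have e : (t - s) / h = t / h - s / h := sub_div _ _ _
  have h1 := Nat.floor_le (div_nonneg (sub_nonneg.2 hst) hh.le)
  have h2 := Nat.lt_floor_add_one ((t - s) / h)
  have h3 := Nat.floor_le (div_nonneg (hs.trans hst) hh.le)
  have h4 := Nat.lt_floor_add_one (t / h)
  have h5 := Nat.floor_le (div_nonneg hs hh.le)
  have h6 := Nat.lt_floor_add_one (s / h)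
  rw [e] at h1 h2 ⊢
  have a1 : ⌊t / h - s / h⌋₊ + ⌊s / h⌋₊ < ⌊t / h⌋₊ + 1 := by
    have : ((⌊t / h - s / h⌋₊ + ⌊s / h⌋₊ : ℕ) : ℝ) < ((⌊t / h⌋₊ + 1 : ℕ) : ℝ) := by
      push_cast; linarith
    exact_mod_cast this
  have a2 : ⌊t / h⌋₊ < ⌊t / h - s / h⌋₊ + ⌊s / h⌋₊ + 2 := by
    have : ((⌊t / h⌋₊ : ℕ) : ℝ) < ((⌊t / h - s / h⌋₊ + ⌊s / h⌋₊ + 2 : ℕ) : ℝ) := by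
      push_cast; linarith
    exact_mod_cast this
  omega

/-- The `L¹` distance of two members of a sequence of functions of space. -/
def stepDist (c : ℕ → Torus d → ℝ) (n m : ℕ) : ℝ := ∫ x, |c n x - c m x|

variable {c : ℕ → Torus d → ℝ}

theorem stepDist_nonneg (n m : ℕ) : 0 ≤ stepDist c n m := integral_nonneg fun _ => abs_nonneg _

theorem stepDist_self (n : ℕ) : stepDist c n n = 0 := by simp [stepDist]

theorem stepDist_triangle (hci : ∀ n, Integrable (c n)) (l m n : ℕ) :
    stepDist c l n ≤ stepDist c l m + stepDist c m n := by
  have e := integral_add ((hci l).sub (hci m)).abs ((hci m).sub (hci n)).abs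
  simp only [Pi.sub_apply] at e
  unfold stepDist
  rw [← e]
  exact integral_mono ((hci l).sub (hci n)).abs (((hci l).sub (hci m)).abs.add
    ((hci m).sub (hci n)).abs) fun x => abs_sub_le _ _ _

/-- Triangle inequality through the intermediate step n - r, followed by `stepIntegral_shift_le`,
whose initial condition holds because the distance from step 0 to itself vanishes. -/
theorem stepIntegral_stepDist_add_le (hh : 0 < h) (hci : ∀ n, Integrable (c n)) (r r' : ℕ) :
    stepIntegral T h (fun n => stepDist c n (n - (r + r'))) ≤
      stepIntegral T h (fun n => stepDist c n (n - r)) +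
        stepIntegral T h (fun n => stepDist c n (n - r')) := by
  refine le_trans ?_ (add_le_add le_rfl (stepIntegral_shift_le hh
    (F := fun n => stepDist c n (n - r')) (fun n => stepDist_nonneg _ _) (by rw [Nat.zero_sub, stepDist_self]) r))
  rw [← stepIntegral_add hh]
  refine stepIntegral_mono hh fun n => ?_
  rw [← Nat.sub_sub]
  exact stepDist_triangle hci _ _ _

theorem stepIntegral_stepDist_mul_le (hh : 0 < h) (hci : ∀ n, Integrable (c n)) (q r : ℕ) :
    stepIntegral T h (fun n => stepDist c n (n - q * r)) ≤
      q * stepIntegral T h (fun n => stepDist c n (n - r)) := by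
  induction q with
  | zero => simp [stepDist_self, stepIntegral]
  | succ q ih =>
    have := stepIntegral_stepDist_add_le (T := T) hh hci (q * r) r
    rw [Nat.succ_mul]
    push_cast
    linarith

/-- A bound for shifts by up to `√h` extends to a modulus of continuity in time. -/
theorem stepIntegral_stepDist_le_of_short (hh : 0 < h) (h1 : h ≤ 1)
    (hci : ∀ n, Integrable (c n)) {A : ℝ}
    (hA : ∀ r : ℕ, r * h ≤ 2 * Real.sqrt h →
      stepIntegral T h (fun n => stepDist c n (n - r)) ≤ A * Real.sqrt h) (hA0 : 0 ≤ A) (n : ℕ) :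
    stepIntegral T h (fun k => stepDist c k (k - n)) ≤ A * (n * h + Real.sqrt h) := by
  have hs : 0 < Real.sqrt h := Real.sqrt_pos.2 hh
  have hs2 : Real.sqrt h * Real.sqrt h = h := Real.mul_self_sqrt hh.le
  have hs1 : Real.sqrt h ≤ 1 := Real.sqrt_le_one.2 h1
  -- A block of N steps lasts between √h and 2√h. The shift by n steps is split into q = n / N such
  -- blocks and a shorter remainder.
  set N := ⌈1 / Real.sqrt h⌉₊ with hN
  have hN1 : 1 / Real.sqrt h ≤ N := Nat.le_ceil _
  have hN2 : (N : ℝ) < 1 / Real.sqrt h + 1 := Nat.ceil_lt_add_one (by positivity)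
  have hN3 : 1 ≤ N * Real.sqrt h := by rwa [div_le_iff₀ hs] at hN1
  have hN4 : (N : ℝ) * h ≤ 2 * Real.sqrt h := by
    have : (N : ℝ) * h ≤ (1 / Real.sqrt h + 1) * h := by gcongr
    refine this.trans ?_
    have e : (1 / Real.sqrt h + 1) * h = Real.sqrt h + h := by
      rw [add_mul, one_mul]
      congr 1
      nth_rewrite 2 [← hs2]
      field_simp
    rw [e]
    nlinarith
  have hNpos : 0 < N := Nat.ceil_pos.2 (by positivity)
  have hdm := Nat.div_add_mod n N
  set q := n / N
  set r := n % N
  have hr : r ≤ N := (Nat.mod_lt n hNpos).le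
  have b1 := stepIntegral_stepDist_add_le (T := T) hh hci (q * N) r
  have b2 := stepIntegral_stepDist_mul_le (T := T) hh hci q N
  have b3 := hA N hN4
  have b4 := hA r ((mul_le_mul_of_nonneg_right (Nat.cast_le.2 hr) hh.le).trans hN4)
  rw [mul_comm q N, hdm] at b1
  rw [mul_comm q N] at b2
  have b5 : (q : ℝ) * stepIntegral T h (fun n => stepDist c n (n - N)) ≤
      q * (A * Real.sqrt h) := by gcongr
  -- Since each block lasts at least √h, there are at most nh/√h = n√h of them, each costing A√h;
  -- the total is A n h.
  have b6 : (q : ℝ) ≤ n * Real.sqrt h := by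
    have e1 : ((N * q : ℕ) : ℝ) ≤ n := Nat.cast_le.2 (by omega)
    push_cast at e1
    have e2 : (q : ℝ) * 1 ≤ q * (N * Real.sqrt h) := by gcongr
    nlinarith
  have b7 : (q : ℝ) * (A * Real.sqrt h) ≤ n * Real.sqrt h * (A * Real.sqrt h) := by gcongr
  have b8 : n * Real.sqrt h * (A * Real.sqrt h) = A * (n * h) := by
    linear_combination (n * A) * hs2
  linarith

end StepFunctions

end

section

variable {d : ℕ} {T : ℝ}

/-! ### The modulus of continuity in space-time from energy and dissipation. -/

section StepCompactness

variable {h : ℝ} {c : ℕ → Torus d → ℝ}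

theorem thDist_sq {v v' : Torus d → ℝ} (hm : Measurable v) (hv : ∀ x, v x ∈ Set.Icc (0 : ℝ) 1)
    (hm' : Measurable v') (hv' : ∀ x, v' x ∈ Set.Icc (0 : ℝ) 1) (hh : 0 < h) :
    thDist h v v' ^ 2 =
      2 * Real.sqrt h * ∫ x, (gaussConv (h / 2) v x - gaussConv (h / 2) v' x) ^ 2 := by
  unfold thDist
  rw [Real.sq_sqrt (mul_nonneg (by positivity) (integral_nonneg fun x => by positivity))]
  simp_rw [sq_abs, gaussConv_sub hm hv hm' hv' (half_pos hh)]

theorem thDist_congr {v v' w w' : Torus d → ℝ} (hv : v =ᵐ[volume] v') (hw : w =ᵐ[volume] w')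
    (h : ℝ) : thDist h v w = thDist h v' w' := by
  unfold thDist
  congr 2
  refine integral_congr_ae ?_
  filter_upwards [gaussConv_congr (hv.sub hw) (h / 2)] with x hx
  exact congrArg (fun a => |a| ^ 2) hx

theorem integrable_sq_sub {f g : Torus d → ℝ} (hf : Measurable f)
    (hf01 : ∀ x, f x ∈ Set.Icc (0 : ℝ) 1) (hg : Measurable g)
    (hg01 : ∀ x, g x ∈ Set.Icc (0 : ℝ) 1) : Integrable (fun x => (f x - g x) ^ 2) := by
  refine integrable_of_mem_Icc (by fun_prop) fun x => ⟨sq_nonneg _, ?_⟩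
  have h1 := hf01 x
  have h2 := hg01 x
  rw [sq_le_one_iff_abs_le_one, abs_le]
  constructor <;> linarith [h1.1, h1.2, h2.1, h2.2]

/-- For characteristic functions the L¹ distance is the squared L² distance, which splits into the
squared distance of the approximations P and two errors c - P; as |c - P| ≤ 1, the squared errors
are bounded by the L¹ errors. -/
theorem stepDist_le {P : ℕ → Torus d → ℝ} (hm : ∀ n, Measurable (c n))
    (h01 : ∀ n x, c n x = 0 ∨ c n x = 1) (hPm : ∀ n, Measurable (P n))
    (hP : ∀ n x, P n x ∈ Set.Icc (0 : ℝ) 1) {b : ℝ} (hb : ∀ n, ∫ x, |c n x - P n x| ≤ b)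
    (n m : ℕ) : stepDist c n m ≤ 8 * b + 2 * ∫ x, (P n x - P m x) ^ 2 := by
  have hc := fun n => mem_Icc_of_eq_zero_or_one (h01 n)
  have i1 : ∀ n, Integrable (fun x => |c n x - P n x|) := fun n =>
    ((integrable_of_mem_Icc (hm n) (hc n)).sub (integrable_of_mem_Icc (hPm n) (hP n))).abs
  have i2 := integrable_sq_sub (hPm n) (hP n) (hPm m) (hP m)
  have hpt : ∀ x, |c n x - c m x| ≤
      (4 * |c n x - P n x| + 4 * |c m x - P m x|) + 2 * (P n x - P m x) ^ 2 := by
    intro x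
    have e1 : |c n x - c m x| = (c n x - c m x) ^ 2 := by
      rcases h01 n x with e | e <;> rcases h01 m x with e' | e' <;> simp [e, e']
    have e2 : ∀ n, (c n x - P n x) ^ 2 ≤ |c n x - P n x| := by
      intro n
      have h1 := hc n x
      have h2 := hP n x
      have h3 : |c n x - P n x| ≤ 1 := by
        rw [abs_le]; constructor <;> linarith [h1.1, h1.2, h2.1, h2.2]
      rw [← sq_abs]
      nlinarith [abs_nonneg (c n x - P n x)]
    have e3 := e2 n
    have e4 := e2 m
    rw [e1]
    nlinarith [sq_nonneg ((c n x - P n x) + (c m x - P m x)),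
      sq_nonneg ((c n x - P n x) - (c m x - P m x) - (P n x - P m x))]
  have h1 := integral_mono_of_nonneg (μ := volume) (Eventually.of_forall fun x => abs_nonneg _)
    ((((i1 n).const_mul 4).add ((i1 m).const_mul 4)).add (i2.const_mul 2))
    (Eventually.of_forall hpt)
  have h2 := integral_add (((i1 n).const_mul 4).add ((i1 m).const_mul 4)) (i2.const_mul 2)
  have h3 := integral_add ((i1 n).const_mul 4) ((i1 m).const_mul 4)
  simp only [Pi.add_apply, integral_const_mul] at h1 h2 h3
  have h4 := hb n
  have h5 := hb m
  unfold stepDist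
  linarith

/-- Telescope into r single steps. Cauchy-Schwarz costs one factor r, and the r shifted copies of
the one-step increment give the other. Indices truncated at 0 contribute zero increments. -/
theorem stepIntegral_sq_sub_le (hh : 0 < h) {P : ℕ → Torus d → ℝ} (hPm : ∀ n, Measurable (P n))
    (hP : ∀ n x, P n x ∈ Set.Icc (0 : ℝ) 1) (r : ℕ) :
    stepIntegral T h (fun n => ∫ x, (P n x - P (n - r) x) ^ 2) ≤
      r ^ 2 * stepIntegral T h (fun n => ∫ x, (P n x - P (n - 1) x) ^ 2) := by
  set G : ℕ → ℝ := fun n => ∫ x, (P n x - P (n - 1) x) ^ 2 with hG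
  have hi : ∀ n m, Integrable (fun x => (P n x - P m x) ^ 2) := fun n m =>
    integrable_sq_sub (hPm n) (hP n) (hPm m) (hP m)
  have h1 : ∀ n, ∫ x, (P n x - P (n - r) x) ^ 2 ≤ r * ∑ j ∈ Finset.range r, G (n - j) := by
    intro n
    rw [hG, ← integral_finsetSum _ fun j _ => hi _ _, ← integral_const_mul]
    refine integral_mono (hi _ _) ((integrable_finsetSum _ fun j _ => hi _ _).const_mul _)
      fun x => ?_
    have h2 := Finset.sum_range_sub' (fun j => P (n - j) x) r
    rw [Nat.sub_zero] at h2
    simp only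
    rw [← h2]
    have h3 := sq_sum_le_card_mul_sum_sq (s := Finset.range r)
      (f := fun j => P (n - j) x - P (n - (j + 1)) x)
    rw [Finset.card_range] at h3
    simpa only [Nat.sub_sub] using h3
  have hG0 : ∀ n, 0 ≤ G n := fun n => integral_nonneg fun x => sq_nonneg _
  calc stepIntegral T h (fun n => ∫ x, (P n x - P (n - r) x) ^ 2)
      ≤ stepIntegral T h (fun n => r * ∑ j ∈ Finset.range r, G (n - j)) :=
        stepIntegral_mono hh h1
    _ = r * ∑ j ∈ Finset.range r, stepIntegral T h (fun n => G (n - j)) := by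
        rw [stepIntegral_const_mul, stepIntegral_sum hh (fun j n => G (n - j))]
    _ ≤ r * ∑ j ∈ Finset.range r, stepIntegral T h G := by
        gcongr with j
        exact stepIntegral_shift_le hh hG0 (by simp [hG]) j
    _ = _ := by rw [Finset.sum_const, Finset.card_range, nsmul_eq_mul]; ring

/-- The modulus of continuity in time of the thresholding scheme. -/
theorem stepIntegral_stepDist_le (hT : 0 < T) (hh : 0 < h) (h1 : h ≤ 1)
    (hm : ∀ n, Measurable (c n)) (h01 : ∀ n x, c n x = 0 ∨ c n x = 1) {K C C' : ℝ}
    (hK : ∀ n, ∀ z : Euc d,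
      defect (c n) (proj (Real.sqrt h • z)) ≤ K * C * Real.sqrt h * (1 + ‖z‖))
    (hKC : 0 ≤ K * C) (hC' : 0 ≤ C')
    (hD : stepIntegral T h (fun n => 1 / (2 * h ^ 2) * thDist h (c n) (c (n - 1)) ^ 2) ≤ C')
    (n : ℕ) : stepIntegral T h (fun k => stepDist c k (k - n)) ≤
      (T * (16 * (K * C) * ∫ z : Euc d, gauss 1 z * (1 + ‖z‖)) + 8 * C') *
        (n * h + Real.sqrt h) := by
  have hs : 0 < Real.sqrt h := Real.sqrt_pos.2 hh
  have hs2 : Real.sqrt h * Real.sqrt h = h := Real.mul_self_sqrt hh.le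
  have hc := fun n => mem_Icc_of_eq_zero_or_one (h01 n)
  set M := ∫ z : Euc d, gauss 1 z * (1 + ‖z‖) with hM
  have hM0 : 0 ≤ M := integral_nonneg fun z => mul_nonneg (gauss_nonneg _ _) (by positivity)
  set P : ℕ → Torus d → ℝ := fun n => gaussConv (h / 2) (c n) with hPdef
  have hPm : ∀ n, Measurable (P n) := fun n => measurable_gaussConv (hm n) _
  have hP : ∀ n x, P n x ∈ Set.Icc (0 : ℝ) 1 := fun n =>
    gaussConv_mem_Icc (hm n) (hc n) (half_pos hh)
  have hb : ∀ n, ∫ x, |c n x - P n x| ≤ 2 * (K * C * Real.sqrt h) * M := fun n =>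
    integral_abs_sub_gaussConv_le (hK n) (hm n) (h01 n) hh
  set J := stepIntegral T h (fun n => ∫ x, (P n x - P (n - 1) x) ^ 2) with hJ
  -- The dissipation 1/(2h²) · 2√h · J is bounded by C', where J is the summed squared L² increment
  -- over one step.
  have hJle : Real.sqrt h * J ≤ C' * h ^ 2 := by
    simp_rw [thDist_sq (hm _) (hc _) (hm _) (hc _) hh, ← mul_assoc] at hD
    rw [stepIntegral_const_mul] at hD
    have e : 1 / (2 * h ^ 2) * 2 * Real.sqrt h * J = Real.sqrt h * J / h ^ 2 := by
      field_simp
    rw [← hJ, e, div_le_iff₀ (by positivity)] at hD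
    exact hD
  refine stepIntegral_stepDist_le_of_short hh h1
    (fun n => integrable_of_mem_Icc (hm n) (hc n)) (fun r hr => ?_) (by positivity) n
  have h2 : stepIntegral T h (fun n => stepDist c n (n - r)) ≤
      stepIntegral T h (fun n => 8 * (2 * (K * C * Real.sqrt h) * M) +
        2 * ∫ x, (P n x - P (n - r) x) ^ 2) :=
    stepIntegral_mono hh fun n => stepDist_le hm h01 hPm hP hb _ _
  rw [stepIntegral_add hh (fun _ => 8 * (2 * (K * C * Real.sqrt h) * M)), stepIntegral_const hT,
    stepIntegral_const_mul] at h2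
  have h3 := stepIntegral_sq_sub_le (T := T) hh hPm hP r
  rw [← hJ] at h3
  -- Here √h r² J ≤ C'(rh)² ≤ 4C'h, so the quadratic cost of telescoping is still of order √h
  -- exactly up to times rh of order √h.
  have h4 : (r : ℝ) ^ 2 * J ≤ 4 * C' * Real.sqrt h := by
    refine le_of_mul_le_mul_left ?_ hs
    have h5 : (r * h) ^ 2 ≤ (2 * Real.sqrt h) ^ 2 := by gcongr
    calc Real.sqrt h * ((r : ℝ) ^ 2 * J) = r ^ 2 * (Real.sqrt h * J) := by ring
      _ ≤ r ^ 2 * (C' * h ^ 2) := by gcongr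
      _ = C' * (r * h) ^ 2 := by ring
      _ ≤ C' * (2 * Real.sqrt h) ^ 2 := by gcongr
      _ = _ := by ring
  linarith

theorem measurable_step (hm : ∀ n, Measurable (c n)) (h : ℝ) :
    Measurable (fun p : ℝ × Torus d => c ⌊p.1 / h⌋₊ p.2) := by
  have h1 : Measurable (fun q : ℕ × Torus d => c q.1 q.2) := measurable_from_prod_countable_right hm
  have h2 : Measurable (fun p : ℝ × Torus d => (⌊p.1 / h⌋₊, p.2)) :=
    (Nat.measurable_floor.comp (by fun_prop)).prodMk measurable_snd
  exact h1.comp h2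

/-- The modulus of continuity in time and space of a step function. -/
theorem integral_abs_sub_shift_le (hT : 0 < T) (hh : 0 < h) (h1 : h ≤ 1)
    (hm : ∀ n, Measurable (c n)) (h01 : ∀ n x, c n x = 0 ∨ c n x = 1) {B A : ℝ}
    (hB : ∀ n, ∀ z : Euc d, defect (c n) (proj (Real.sqrt h • z)) ≤ B * Real.sqrt h * (1 + ‖z‖))
    (hB0 : 0 ≤ B) (hA0 : 0 ≤ A)
    (hA : ∀ n : ℕ, stepIntegral T h (fun k => stepDist c k (k - n)) ≤ A * (n * h + Real.sqrt h))
    {δ s : ℝ} (hs : s ∈ Set.Icc 0 δ) {w : Euc d} (hw : ‖w‖ ≤ δ) :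
    ∫ p in {p : ℝ × Torus d | δ < p.1}, |c ⌊p.1 / h⌋₊ p.2 -
      c ⌊(p.1 - s) / h⌋₊ (p.2 - proj w)| ∂(spaceTime d T) ≤
      (3 * A + 2 * B * T) * (δ + Real.sqrt h) := by
  have hsq : 0 < Real.sqrt h := Real.sqrt_pos.2 hh
  have hs2 : Real.sqrt h * Real.sqrt h = h := Real.mul_self_sqrt hh.le
  have hs1 : Real.sqrt h ≤ 1 := Real.sqrt_le_one.2 h1
  have hc := fun n => mem_Icc_of_eq_zero_or_one (h01 n)
  have hci : ∀ n, Integrable (c n) := fun n => integrable_of_mem_Icc (hm n) (hc n)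
  have hci' : ∀ n, Integrable (fun x => c n (x - proj w)) := fun n =>
    integrable_of_mem_Icc ((hm n).comp (by fun_prop)) fun x => hc n _
  set m := ⌊s / h⌋₊ with hmdef
  -- The defect bound is used with z = w/√h, which gives √h + |w|.
  have hspace : ∀ l, ∫ x, |c l x - c l (x - proj w)| ≤ 2 * (B * (Real.sqrt h + δ)) := by
    intro l
    rw [integral_abs_sub_translate (hm l) (h01 l)]
    have h2 := hB l ((Real.sqrt h)⁻¹ • w)
    rw [smul_inv_smul₀ hsq.ne', norm_smul, Real.norm_of_nonneg (by positivity)] at h2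
    have h3 : B * Real.sqrt h * (1 + (Real.sqrt h)⁻¹ * ‖w‖) = B * (Real.sqrt h + ‖w‖) := by
      field_simp
    rw [h3] at h2
    have : B * (Real.sqrt h + ‖w‖) ≤ B * (Real.sqrt h + δ) := by gcongr
    linarith
  set F : ℕ → ℝ := fun n => (stepDist c n (n - m) + stepDist c n (n - (m + 1))) +
    2 * (B * (Real.sqrt h + δ)) with hF
  have hδ0 : 0 ≤ δ := hs.1.trans hs.2
  have hF0 : ∀ n, 0 ≤ F n := fun n => add_nonneg (add_nonneg (stepDist_nonneg _ _)
    (stepDist_nonneg _ _)) (by positivity)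
  have hset : MeasurableSet {p : ℝ × Torus d | δ < p.1} :=
    measurableSet_lt (by fun_prop) (by fun_prop)
  set f : ℝ × Torus d → ℝ := fun p => |c ⌊p.1 / h⌋₊ p.2 - c ⌊(p.1 - s) / h⌋₊ (p.2 - proj w)| with hf
  have hfm : Measurable f := by
    have h2 := measurable_step hm h
    have h3 := h2.comp (show Measurable fun p : ℝ × Torus d => (p.1 - s, p.2 - proj w) by fun_prop)
    exact (h2.sub h3).abs
  have hf01 : ∀ p, f p ∈ Set.Icc (0 : ℝ) 1 := by
    intro p
    have h2 := hc ⌊p.1 / h⌋₊ p.2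
    have h3 := hc ⌊(p.1 - s) / h⌋₊ (p.2 - proj w)
    refine ⟨abs_nonneg _, ?_⟩
    rw [hf, abs_le]
    constructor <;> linarith [h2.1, h2.2, h3.1, h3.2]
  have hfi : Integrable ({p : ℝ × Torus d | δ < p.1}.indicator f) (spaceTime d T) :=
    (integrable_of_mem_Icc hfm hf01).indicator hset
  have hmain : ∫ p in {p : ℝ × Torus d | δ < p.1}, f p ∂(spaceTime d T) ≤ stepIntegral T h F := by
    rw [← integral_indicator hset]
    unfold spaceTime at hfi ⊢
    rw [integral_prod _ hfi]
    refine integral_mono_of_nonneg (Eventually.of_forall fun t => integral_nonneg fun x =>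
      Set.indicator_nonneg (fun p _ => (hf01 p).1) _) (integrableOn_step hh F)
      (Eventually.of_forall fun t => ?_)
    by_cases ht : δ < t
    · have e : ∀ x : Torus d, {p : ℝ × Torus d | δ < p.1}.indicator f (t, x) = f (t, x) :=
        fun x => Set.indicator_of_mem (show (t, x) ∈ {p : ℝ × Torus d | δ < p.1} from ht) _
      simp only [e]
      set n := ⌊t / h⌋₊
      set l := ⌊(t - s) / h⌋₊ with hl
      have h2 : ∫ x, f (t, x) ≤ stepDist c n l + 2 * (B * (Real.sqrt h + δ)) := by
        refine le_trans ?_ (add_le_add le_rfl (hspace l))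
        have e2 := integral_add ((hci n).sub (hci l)).abs ((hci l).sub (hci' l)).abs
        simp only [Pi.sub_apply] at e2
        unfold stepDist
        rw [← e2]
        exact integral_mono ((hci n).sub (hci' l)).abs (((hci n).sub (hci l)).abs.add
          ((hci l).sub (hci' l)).abs) fun x => abs_sub_le _ _ _
      refine h2.trans (add_le_add ?_ le_rfl)
      -- Both possible index shifts, m and m + 1, are included in F, so either case is covered.
      rcases floor_sub_div_eq hh hs.1 (hs.2.trans ht.le) with e3 | e3
      · rw [hl, e3]
        exact le_add_of_nonneg_right (stepDist_nonneg _ _)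
      · rw [hl, e3]
        exact le_add_of_nonneg_left (stepDist_nonneg _ _)
    · have e : ∀ x : Torus d, {p : ℝ × Torus d | δ < p.1}.indicator f (t, x) = 0 :=
        fun x => Set.indicator_of_notMem (show (t, x) ∉ {p : ℝ × Torus d | δ < p.1} from ht) _
      simp only [e, integral_zero]
      exact hF0 _
  refine hmain.trans ?_
  rw [hF, stepIntegral_add hh (fun n => stepDist c n (n - m) + stepDist c n (n - (m + 1))),
    stepIntegral_add hh, stepIntegral_const hT]
  have h2 := hA m
  have h3 := hA (m + 1)
  push_cast at h3
  have h4 : m * h ≤ s := by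
    rw [← le_div_iff₀ hh]; exact Nat.floor_le (div_nonneg hs.1 hh.le)
  have h5 : h ≤ Real.sqrt h := by nlinarith
  have h6 : A * (m * h + Real.sqrt h) ≤ A * (δ + Real.sqrt h) := by
    gcongr; linarith [hs.2]
  have h7 : A * ((m + 1) * h + Real.sqrt h) ≤ A * (δ + 2 * Real.sqrt h) :=
    mul_le_mul_of_nonneg_left (by linarith [hs.2]) hA0
  have h8 : 0 ≤ A * δ := by positivity
  linarith

end StepCompactness

/-- The values of a piecewise constant function, modified on null sets so as to be measurable. -/
theorem exists_measurable_steps {h : ℝ} (hT : 0 < T) (hh : 0 < h) {χ : ℝ → Torus d → ℝ}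
    (hm : AEMeasurable (fun p : ℝ × Torus d => χ p.1 p.2) (spaceTime d T))
    (h01 : ∀ t ∈ Set.Ioo 0 T, ∀ x, χ t x = 0 ∨ χ t x = 1) {c : ℕ → Torus d → ℝ}
    (hc : ∀ t < T, χ t = c ⌊t / h⌋₊) {C : ℝ}
    (hE : ∀ᵐ t ∂(volume.restrict (Set.Ioo 0 T)), energy h (χ t) ≤ C) :
    ∃ c' : ℕ → Torus d → ℝ, ∀ n, Measurable (c' n) ∧ (∀ x, c' n x = 0 ∨ c' n x = 1) ∧
      energy h (c' n) ≤ C ∧ (n * h < T → c n =ᵐ[volume] c' n) := by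
  obtain ⟨v, hvm, -, hv⟩ := exists_measurable_version hm fun t ht x => by
    rcases h01 t ht x with e | e <;> simp [e]
  have key : ∀ n : ℕ, n * h < T → ∃ f : Torus d → ℝ, Measurable f ∧ (∀ x, f x = 0 ∨ f x = 1) ∧
      energy h f ≤ C ∧ c n =ᵐ[volume] f := by
    intro n hn
    have hlt : n * h < min ((n + 1) * h) T := lt_min (by nlinarith) hn
    have hsub : Set.Ioo (n * h) (min ((n + 1) * h) T) ⊆ Set.Ioo 0 T := fun t ht =>
      ⟨lt_of_le_of_lt (by positivity) ht.1, ht.2.trans_le (min_le_right _ _)⟩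
    have hev : ∀ᵐ t ∂(volume.restrict (Set.Ioo (n * h) (min ((n + 1) * h) T))),
        energy h (χ t) ≤ C ∧ χ t =ᵐ[volume] fun x => v (t, x) :=
      ae_restrict_of_ae_restrict_of_subset hsub (hE.and (Measure.ae_ae_of_ae_prod hv))
    have hne : (volume.restrict (Set.Ioo (n * h) (min ((n + 1) * h) T))) ≠ 0 := by
      rw [Ne, Measure.restrict_eq_zero, Real.volume_Ioo, ENNReal.ofReal_eq_zero]
      linarith
    have : (ae (volume.restrict (Set.Ioo (n * h) (min ((n + 1) * h) T)))).NeBot :=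
      ae_neBot.2 hne
    -- Each step interval meeting (0,T) has positive measure, hence contains a time at which the
    -- energy bound holds and the slice agrees almost everywhere with the measurable version.
    obtain ⟨t, ⟨h1, h2⟩, ht⟩ := (hev.and (ae_restrict_mem measurableSet_Ioo)).exists
    have htT := hsub ht
    have h3 : χ t = c n := by
      rw [hc t htT.2]
      congr 1
      rw [Nat.floor_eq_iff (div_nonneg htT.1.le hh.le), le_div_iff₀ hh, div_lt_iff₀ hh]
      exact ⟨ht.1.le, ht.2.trans_le (min_le_left _ _)⟩
    have h4 : c n =ᵐ[volume] {x | v (t, x) = 1}.indicator fun _ => 1 := by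
      filter_upwards [h2] with x hx
      have h5 := h01 t htT x
      rw [h3] at h5 hx
      rcases h5 with e | e
      · rw [e, Set.indicator_of_notMem]
        simp [← hx, e]
      · rw [e, Set.indicator_of_mem]
        simp [← hx, e]
    refine ⟨_, measurable_const.indicator ((hvm.comp (by fun_prop)) (measurableSet_singleton 1)),
      fun x => ?_, ?_, h4⟩
    · exact (Set.indicator_eq_zero_or_self _ _ x)
    · exact (energy_congr h4 h).symm.trans_le (h3 ▸ h1)
  have h0 : ((0 : ℕ) : ℝ) * h < T := by simpa using hT
  have hall : ∀ n : ℕ, ∃ f : Torus d → ℝ, Measurable f ∧ (∀ x, f x = 0 ∨ f x = 1) ∧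
      energy h f ≤ C ∧ (n * h < T → c n =ᵐ[volume] f) := by
    intro n
    by_cases hn : n * h < T
    · obtain ⟨f, a1, a2, a3, a4⟩ := key n hn
      exact ⟨f, a1, a2, a3, fun _ => a4⟩
    -- Steps starting after T are never seen; the first step serves as filler so that the bounds
    -- hold for all n.
    · obtain ⟨f, a1, a2, a3, -⟩ := key 0 h0
      exact ⟨f, a1, a2, a3, fun hn' => absurd hn' hn⟩
  choose c' hc' using hall
  exact ⟨c', hc'⟩

/-- Bounds on the energy and on the dissipation give a modulus of continuity in space-time. -/
theorem exists_modulus (d : ℕ) (hT : 0 < T) (C : ℝ) : ∃ A : ℝ, 0 ≤ A ∧ ∀ h : ℝ, 0 < h → h ≤ 1 →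
    ∀ χ : ℝ → Torus d → ℝ,
      AEMeasurable (fun p : ℝ × Torus d => χ p.1 p.2) (spaceTime d T) →
      (∀ t ∈ Set.Ioo 0 T, ∀ x, χ t x = 0 ∨ χ t x = 1) → IsPiecewiseConstant T h χ →
      (∀ᵐ t ∂(volume.restrict (Set.Ioo 0 T)), energy h (χ t) ≤ C) →
      ∫ t in Set.Ioo 0 T, 1 / (2 * h ^ 2) * thDist h (χ t) (χ (t - h)) ^ 2 ≤ C →
      ∃ v : ℝ × Torus d → ℝ, Measurable v ∧ (∀ p, v p ∈ Set.Icc (0 : ℝ) 1) ∧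
        (fun p : ℝ × Torus d => χ p.1 p.2) =ᵐ[spaceTime d T] v ∧
        ∀ δ > 0, ∀ s ∈ Set.Icc 0 δ, ∀ w : Euc d, ‖w‖ ≤ δ →
          ∫ p in {p | δ < p.1}, |v p - v (p.1 - s, p.2 - proj w)| ∂(spaceTime d T) ≤
            A * (δ + Real.sqrt h) := by
  obtain ⟨K, hK0, hK⟩ := exists_defect_le d
  set M := ∫ z : Euc d, gauss 1 z * (1 + ‖z‖) with hM
  have hM0 : 0 ≤ M := integral_nonneg fun z => mul_nonneg (gauss_nonneg _ _) (by positivity)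
  refine ⟨3 * (T * (16 * (K * |C|) * M) + 8 * |C|) + 2 * (K * |C|) * T, by positivity, ?_⟩
  rintro h hh hh1 χ hm h01 ⟨c, hc⟩ hE hD
  obtain ⟨c', hc'⟩ := exists_measurable_steps hT hh hm h01 hc hE
  have hcm := fun n => (hc' n).1
  have hc01 := fun n => (hc' n).2.1
  have hdef : ∀ n, ∀ z : Euc d,
      defect (c' n) (proj (Real.sqrt h • z)) ≤ K * |C| * Real.sqrt h * (1 + ‖z‖) := by
    intro n z
    refine (hK (c' n) (hcm n) (mem_Icc_of_eq_zero_or_one (hc01 n)) h hh z).trans ?_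
    gcongr
    exact (hc' n).2.2.1.trans (le_abs_self C)
  have hfl : ∀ t ∈ Set.Ioo 0 T, (⌊t / h⌋₊ : ℝ) * h < T := fun t ht =>
    lt_of_le_of_lt (by rw [← le_div_iff₀ hh]; exact Nat.floor_le (div_nonneg ht.1.le hh.le)) ht.2
  have hD' : stepIntegral T h (fun n => 1 / (2 * h ^ 2) * thDist h (c' n) (c' (n - 1)) ^ 2) ≤
      |C| := by
    refine le_trans (le_of_eq ?_) (hD.trans (le_abs_self C))
    refine setIntegral_congr_fun measurableSet_Ioo fun t ht => ?_
    have h1 : ((⌊t / h⌋₊ - 1 : ℕ) : ℝ) * h < T := by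
      refine lt_of_le_of_lt ?_ (hfl t ht)
      gcongr
      exact Nat.sub_le _ _
    -- For t < h both sides are 0 by truncation, in accordance with the constant extension to
    -- negative times.
    have h2 : ⌊(t - h) / h⌋₊ = ⌊t / h⌋₊ - 1 := by
      rw [sub_div, div_self hh.ne', Nat.floor_sub_one]
    simp only
    rw [hc t ht.2, hc (t - h) (by linarith [ht.2]), h2,
      thDist_congr ((hc' _).2.2.2 (hfl t ht)) ((hc' _).2.2.2 h1)]
  refine ⟨fun p => c' ⌊p.1 / h⌋₊ p.2, measurable_step hcm h,
    fun p => mem_Icc_of_eq_zero_or_one (hc01 _) _, ?_, fun δ _ s hs w hw => ?_⟩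
  · have h1 : ∀ᵐ p ∂(spaceTime d T), ∀ n : ℕ, n * h < T → c n p.2 = c' n p.2 := by
      rw [ae_all_iff]
      intro n
      by_cases hn : n * h < T
      · filter_upwards [Measure.quasiMeasurePreserving_snd.ae ((hc' n).2.2.2 hn)] with p hp _
          using hp
      · exact Eventually.of_forall fun p hp => absurd hp hn
    filter_upwards [h1, ae_spaceTime_mem T] with p h2 hp
    rw [hc p.1 hp.2]
    exact h2 _ (hfl p.1 hp)
  · exact integral_abs_sub_shift_le hT hh hh1 hcm hc01 hdef (by positivity) (by positivity)
      (stepIntegral_stepDist_le hT hh hh1 hcm hc01 hdef (by positivity) (abs_nonneg C) hD') hs hw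

/-- Compactness of sequences of bounded energy and dissipation. -/
theorem exists_strongL1_subseq (hT : 0 < T) {h : ℕ → ℝ} (hpos : ∀ k, 0 < h k)
    (hlim : Tendsto h atTop (𝓝 0)) {χ : ℕ → ℝ → Torus d → ℝ}
    (hm : ∀ k, AEMeasurable (fun p : ℝ × Torus d => χ k p.1 p.2) (spaceTime d T))
    (h01 : ∀ k, ∀ t ∈ Set.Ioo 0 T, ∀ x, χ k t x = 0 ∨ χ k t x = 1)
    (hpc : ∀ k, IsPiecewiseConstant T (h k) (χ k)) {C : ℝ}
    (hC : ∀ᶠ k in atTop,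
      (∀ᵐ t ∂(volume.restrict (Set.Ioo 0 T)), energy (h k) (χ k t) ≤ C) ∧
      ∫ t in Set.Ioo 0 T,
        1 / (2 * h k ^ 2) * thDist (h k) (χ k t) (χ k (t - h k)) ^ 2 ≤ C) :
    ∃ ψ : ℕ → ℕ, StrictMono ψ ∧
      ∃ χ' : ℝ → Torus d → ℝ, StrongL1Tendsto T (fun k => χ (ψ k)) χ' := by
  obtain ⟨A, hA, hmod⟩ := exists_modulus d hT C
  have hv : ∀ k, ∃ v : ℝ × Torus d → ℝ, Measurable v ∧ (∀ p, v p ∈ Set.Icc (0 : ℝ) 1) ∧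
      (fun p : ℝ × Torus d => χ k p.1 p.2) =ᵐ[spaceTime d T] v ∧
      ((h k ≤ 1 ∧ (∀ᵐ t ∂(volume.restrict (Set.Ioo 0 T)), energy (h k) (χ k t) ≤ C) ∧
        ∫ t in Set.Ioo 0 T,
          1 / (2 * h k ^ 2) * thDist (h k) (χ k t) (χ k (t - h k)) ^ 2 ≤ C) →
        ∀ δ > 0, ∀ s ∈ Set.Icc 0 δ, ∀ w : Euc d, ‖w‖ ≤ δ →
          ∫ p in {p | δ < p.1}, |v p - v (p.1 - s, p.2 - proj w)| ∂(spaceTime d T) ≤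
            A * (δ + Real.sqrt (h k))) := by
    intro k
    -- The bounds hold only for large k; for the remaining indices any measurable version will do.
    by_cases hk : h k ≤ 1 ∧ (∀ᵐ t ∂(volume.restrict (Set.Ioo 0 T)), energy (h k) (χ k t) ≤ C) ∧
        ∫ t in Set.Ioo 0 T,
          1 / (2 * h k ^ 2) * thDist (h k) (χ k t) (χ k (t - h k)) ^ 2 ≤ C
    · obtain ⟨v, a1, a2, a3, a4⟩ :=
        hmod (h k) (hpos k) hk.1 (χ k) (hm k) (h01 k) (hpc k) hk.2.1 hk.2.2
      exact ⟨v, a1, a2, a3, fun _ => a4⟩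
    · obtain ⟨v, a1, a2, a3⟩ := exists_measurable_version (hm k) fun t ht x => by
        rcases h01 k t ht x with e | e <;> simp [e]
      exact ⟨v, a1, a2, a3, fun hk' => absurd hk' hk⟩
  choose v hvm hv01 hχv hvmod using hv
  have hr : Tendsto (fun k => Real.sqrt (h k)) atTop (𝓝 0) := by
    simpa [Function.comp_def] using (Real.continuous_sqrt.tendsto 0).comp hlim
  obtain ⟨ψ, hψ, f, hfi, hf⟩ := exists_strong_subseq hvm hv01 hr hA (by
    filter_upwards [hC, hlim.eventually (ge_mem_nhds one_pos)] with k h1 h2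
    exact hvmod k ⟨h2, h1⟩)
  refine ⟨ψ, hψ, fun t x => f (t, x), hfi, hf.congr fun k => integral_congr_ae ?_⟩
  filter_upwards [hχv (ψ k)] with p hp
  rw [hp]

end

end Thresholding

end

open Thresholding in
theorem lemma3 (d : ℕ) (T : ℝ) (hT : 0 < T) (h : ℕ → ℝ) (hpos : ∀ k, 0 < h k)
    (hlim : Tendsto h atTop (𝓝 0)) :
    -- part i)
    (∀ χ : ℕ → ℝ → Torus d → ℝ,
      (∀ k, AEMeasurable (fun p : ℝ × Torus d => χ k p.1 p.2) (spaceTime d T)) →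
      (∀ k, ∀ t ∈ Set.Ioo 0 T, ∀ x, χ k t x = 0 ∨ χ k t x = 1) →
      (∀ k, IsPiecewiseConstant T (h k) (χ k)) →
      (∃ C : ℝ, ∀ᶠ k in atTop,
        (∀ᵐ t ∂(volume.restrict (Set.Ioo 0 T)), energy (h k) (χ k t) ≤ C) ∧
        ∫ t in Set.Ioo 0 T,
          1 / (2 * h k ^ 2) * thDist (h k) (χ k t) (χ k (t - h k)) ^ 2 ≤ C) →
      (∀ φ : ℕ → ℕ, StrictMono φ → ∃ ψ : ℕ → ℕ, StrictMono ψ ∧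
        ∃ χ' : ℝ → Torus d → ℝ, StrongL1Tendsto T (fun k => χ (φ (ψ k))) χ') ∧
      (∀ φ : ℕ → ℕ, StrictMono φ → ∀ χ' : ℝ → Torus d → ℝ,
        WeakL1Tendsto T (fun k => χ (φ k)) χ' →
        ∃ (μ : Measure (ℝ × Torus d)) (ν : ℝ × Torus d → Euc d),
          IsPolarGradient T χ' μ ν ∧ EquiIntegrableInTime μ ∧
          ENNReal.ofReal c₀ * μ Set.univ ≤
            liminf (fun k => ENNReal.ofReal
              (∫ t in Set.Ioo 0 T, energy (h (φ k)) (χ (φ k) t))) atTop)) ∧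
    -- part ii)
    (∀ (u : ℕ → ℝ → Torus d → ℝ) (χ : ℝ → Torus d → ℝ),
      (∀ k, AEMeasurable (fun p : ℝ × Torus d => u k p.1 p.2) (spaceTime d T)) →
      (∀ k, ∀ t ∈ Set.Ioo 0 T, ∀ x, u k t x ∈ Set.Icc (0 : ℝ) 1) →
      (∀ t ∈ Set.Ioo 0 T, ∀ x, χ t x = 0 ∨ χ t x = 1) →
      WeakL1Tendsto T u χ →
      limsup (fun k => ENNReal.ofReal (∫ t in Set.Ioo 0 T, energy (h k) (u k t))) atTop ≤
        ENNReal.ofReal c₀ * totalVariation T χ →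
      (∃ C : ℝ, ∀ᶠ k in atTop,
        ∀ᵐ t ∂(volume.restrict (Set.Ioo 0 T)), energy (h k) (u k t) ≤ C) →
      ∃ (μ : Measure (ℝ × Torus d)) (ν : ℝ × Torus d → Euc d),
        IsPolarGradient T χ μ ν ∧ EquiIntegrableInTime μ ∧
        ∀ ζ : Euc d × (ℝ × Torus d) → ℝ, IsPolyGrowthTest T ζ →
          Tendsto (fun k => ∫ q : Euc d × (ℝ × Torus d),
              ζ q * (gauss 1 q.1 * (1 / Real.sqrt (h k)) * u k q.2.1 q.2.2 *
                (1 - u k q.2.1 (q.2.2 - proj (Real.sqrt (h k) • q.1))))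
              ∂(volume.prod (spaceTime d T))) atTop
            (𝓝 (∫ q : Euc d × (ℝ × Torus d),
              ζ q * (gauss 1 q.1 * max (inner ℝ (ν q.2) q.1) 0) ∂(volume.prod μ))) ∧
          Tendsto (fun k => ∫ q : Euc d × (ℝ × Torus d),
              ζ q * (gauss 1 q.1 * (1 / Real.sqrt (h k)) * (1 - u k q.2.1 q.2.2) *
                u k q.2.1 (q.2.2 - proj (Real.sqrt (h k) • q.1)))
              ∂(volume.prod (spaceTime d T))) atTop
            (𝓝 (∫ q : Euc d × (ℝ × Torus d),
              ζ q * (gauss 1 q.1 * max (-inner ℝ (ν q.2) q.1) 0) ∂(volume.prod μ)))) := by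
  refine ⟨fun χ hm h01 hpc => ?_, fun u χ hm h01 _ hw hsup => ?_⟩
  · rintro ⟨C, hC⟩
    refine ⟨fun φ hφ => ?_, fun φ hφ χ' hw => ?_⟩
    · exact exists_strongL1_subseq hT (fun k => hpos (φ k)) (hlim.comp hφ.tendsto_atTop)
        (fun k => hm (φ k)) (fun k => h01 (φ k)) (fun k => hpc (φ k))
        (hφ.tendsto_atTop.eventually hC)
    · obtain ⟨μ, ν, hP, hequi, hlow, -⟩ := exists_polarGradient_of_weakL1Tendsto
        (fun k => hpos (φ k)) (hlim.comp hφ.tendsto_atTop) (fun k => hm (φ k))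
        (fun k t ht x => by rcases h01 (φ k) t ht x with e | e <;> simp [e]) hw
        ((hφ.tendsto_atTop.eventually hC).mono fun k hk => hk.1)
      exact ⟨μ, ν, hP, hequi, hlow⟩
  · rintro ⟨C, hC⟩
    obtain ⟨μ, ν, hP, hequi, -, hconv⟩ :=
      exists_polarGradient_of_weakL1Tendsto hpos hlim hm h01 hw hC
    exact ⟨μ, ν, hP, hequi, hconv hsup⟩
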